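/- Let $K$ be any field, $m\ge 1$, $n\ge 0$, and let $Z_1,\dots,Z_m$ be effective algebraic cycles on $\mathbb A^n_K$, i.e. finite formal sums $\sum_i a_i[X_i]$ with coefficients $a_i\in\mathbb N$ of reduced and irreducible closed subschemes, possibly of different dimensions. For such a cycle put $I(\sum_i a_i[X_i])=\prod_i I(X_i)^{a_i}\subset K[x_1,\dots,x_n]$. For a closed subscheme $Y$ let $[Y]$ be its cycle: the sum of its irreducible components, each counted with the length of the local ring of $Y$ at its generic point. *Intersection cycles.* For a cycle $Z=\sum_i a_i[X_i]$ on an affine space and a hyperplane $H=(\ell=0)$ set $Z⋒H=\sum_i a_i\,([X_i]⋒H)$, where $[X_i]⋒H=[X_i]$ if $X_i\subset H$ and $[X_i]⋒H=[X_i\cap H]$ (scheme-theoretic intersection) otherwise. Let $Z_1\times\cdots\times Z_m$ be the product cycle on $\mathbb A^{nm}=\mathbb A^n\times\cdots\times\mathbb A^n$ (multilinear in the $Z_i$, and equal to the cycle of the product subscheme for irreducible subvarieties). Let $\mathcal L=(L_1,\dots,L_{n(m-1)})$ be any ordered sequence of hyperplanes of $\mathbb A^{nm}$ whose intersection is the diagonal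 $\Delta\cong\mathbb A^n$. All components of $(\cdots((Z_1\times\cdots\times Z_m)⋒L_1)⋒\cdots)⋒L_{n(m-1)}$ lie in $\Delta$; the corresponding cycle on $\mathbb A^n$ is the Vogel–Tworzewski intersection cycle $(Z_1⋒\cdots⋒Z_m,\mathcal L)$. *Ideal of Chow equations.* Let first $K$ be infinite. If $Z$ is an effective cycle of pure dimension $d$, a linear projection $\pi:\mathbb A^n\to\mathbb A^{d+1}$ is allowable if its restriction to every component of $Z$ is finite; then $\pi_*Z$ is an effective divisor in $\mathbb A^{d+1}$, and $f(\pi,Z)\in K[x_1,\dots,x_n]$ denotes the pull-back by $\pi$ of an equation of this divisor. Let $I^{ch}(Z)$ be the ideal generated by the $f(\pi,Z)$ for all allowable $\pi$ (so $I^{ch}(Z)=0$ if $d=n$). For an arbitrary effective cycle $Z$ let $I^{ch}(Z)=\prod_d I^{ch}(Z^d)$, the product over the nonzero pure dimensional parts $Z^d$ of $Z$. If $K$ is finite, $I^{ch}(Z)$ is the ideal of $K[x_1,\dots,x_n]$ obtained by passing to an infinite extension field $L$ of $K$, say $L=K(t)$, i.e. $I^{ch}(Z)=I^{ch}(Z_L)\cap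 K[x_1,\dots,x_n]$. **Theorem.** For every choice of $\mathcal L$, $$I^{ch}\big((Z_1⋒\cdots⋒Z_m,\mathcal L)\big)\subset\overline{(I(Z_1),\dots,I(Z_m))},$$ where $\overline I$ is the integral closure of the ideal $I$: the set of all $r$ satisfying an equation $r^k+\sum_{j=1}^k c_j r^{k-j}=0$ with $k\ge1$ and $c_j\in I^j$. -/

import Mathlib

open MvPolynomial

noncomputable section

/-- Effective algebraic cycles on `Spec A`: finite formal combinations, with natural-number
coefficients, of reduced and irreducible closed subschemes, i.e. of prime ideals of `A`.
The subschemes need not have the same dimension. -/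
abbrev EffCycle (A : Type*) [CommRing A] := PrimeSpectrum A →₀ ℕ

namespace EffCycle

section General

variable {A B : Type*} [CommRing A] [CommRing B]

/-- The ideal `I(Z) = ∏ I(Z_i) ^ a_i` of the cycle `Z = ∑ a_i [Z_i]`. -/
def ideal (Z : EffCycle A) : Ideal A :=
  Z.prod fun P a => P.asIdeal ^ a

/-- The length of the local ring of the closed subscheme `V(J)` at the point `P`. -/
def lengthAt (J : Ideal A) (P : PrimeSpectrum A) : ℕ :=
  (Module.length (Localization.AtPrime P.asIdeal)
    (Localization.AtPrime P.asIdeal ⧸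
      J.map (algebraMap A (Localization.AtPrime P.asIdeal)))).toNat

open Classical in
/-- The cycle `[V(J)]` of the closed subscheme `V(J)`: the sum of its irreducible components, each
one counted with the length of the local ring of `V(J)` at its generic point. -/
def ofIdeal [IsNoetherianRing A] (J : Ideal A) : EffCycle A :=
  Finsupp.onFinset
    (Set.Finite.toFinset (s := {P : PrimeSpectrum A | P.asIdeal ∈ J.minimalPrimes})
      ((J.finite_minimalPrimes_of_isNoetherianRing A).preimage
        (fun _ _ _ _ h => PrimeSpectrum.ext h)))
    (fun P => if P.asIdeal ∈ J.minimalPrimes then lengthAt J P else 0)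
    (fun P h => by
      by_contra h'
      simp_all)

open Classical in
/-- The cycle `Z ⋒ (f = 0)`: a component contained in the divisor `f = 0` is kept, every other
component is replaced by the cycle of its scheme theoretic intersection with `f = 0`. -/
def capDivisor [IsNoetherianRing A] (Z : EffCycle A) (f : A) : EffCycle A :=
  Z.sum fun P a => a •
    (if f ∈ P.asIdeal then Finsupp.single P 1 else ofIdeal (P.asIdeal ⊔ Ideal.span {f}))

/-- The degree of `V(P)` over (the closure of) its image under the morphism
`Spec B → Spec A` given by `φ`, i.e. the degree of the extension of function fields. -/
def mapDegree (φ : A →+* B) (P : PrimeSpectrum B) : ℕ :=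
  letI := (Ideal.ResidueField.map (PrimeSpectrum.comap φ P).asIdeal P.asIdeal φ rfl).toAlgebra
  Module.finrank (PrimeSpectrum.comap φ P).asIdeal.ResidueField P.asIdeal.ResidueField

/-- Push-forward of cycles along the morphism `Spec B → Spec A` given by `φ` (used only if this
morphism is finite on every component of the cycle). -/
def pushforward (φ : A →+* B) (Z : EffCycle B) : EffCycle A :=
  Z.sum fun P a => Finsupp.single (PrimeSpectrum.comap φ P) (a * mapDegree φ P)

open Classical in
/-- The `d`-dimensional part of a cycle. -/
def purePart (d : ℕ) (Z : EffCycle A) : EffCycle A :=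
  Z.filter fun P => ringKrullDim (A ⧸ P.asIdeal) = d

end General

section AffineSpace

variable {K : Type*} [Field K] {n : ℕ}

/-- The comorphism `K[y_0, …, y_d] → K[x_1, …, x_n]` of the linear map
`𝔸ⁿ → 𝔸^(d+1)` with matrix `M`. -/
def linComorphism {d : ℕ} (M : Matrix (Fin (d + 1)) (Fin n) K) :
    MvPolynomial (Fin (d + 1)) K →+* MvPolynomial (Fin n) K :=
  (aeval fun i => ∑ j, C (M i j) * X j : MvPolynomial (Fin (d + 1)) K →ₐ[K] _).toRingHom

/-- The linear map `𝔸ⁿ → 𝔸^(d+1)` with matrix `M` is a projection (it is surjective, i.e. the rows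
of `M` are linearly independent) that is finite on each component of `Z`. -/
def IsAllowable {d : ℕ} (Z : EffCycle (MvPolynomial (Fin n) K))
    (M : Matrix (Fin (d + 1)) (Fin n) K) : Prop :=
  LinearIndependent K M.row ∧
    ∀ P ∈ Z.support, ((Ideal.Quotient.mk P.asIdeal).comp (linComorphism M)).Finite

/-- The ideal generated by the Chow equations `f(π, Z)` of a purely `d`-dimensional cycle `Z`:
for every allowable projection `π : 𝔸ⁿ → 𝔸^(d+1)`, take an equation `g` of the effective divisor
`π_* Z` and pull it back by `π`. -/
def chowIdealPure (d : ℕ) (Z : EffCycle (MvPolynomial (Fin n) K)) :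
    Ideal (MvPolynomial (Fin n) K) :=
  Ideal.span {f | ∃ M : Matrix (Fin (d + 1)) (Fin n) K, IsAllowable Z M ∧
    ∃ g, Ideal.span {g} = (pushforward (linComorphism M) Z).ideal ∧ f = linComorphism M g}

open Classical in
/-- The product of the ideals `chowIdealPure d` of the nonzero pure dimensional parts of `Z`. -/
def chowIdealOfInfinite (Z : EffCycle (MvPolynomial (Fin n) K)) :
    Ideal (MvPolynomial (Fin n) K) :=
  ∏ d ∈ (Finset.range (n + 1)).filter (fun d => purePart d Z ≠ 0), chowIdealPure d (purePart d Z)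

/-- The cycle `Z_L` on `𝔸ⁿ_L` obtained from a cycle on `𝔸ⁿ_K` by extension of the base field. -/
def baseChange (L : Type*) [Field L] [Algebra K L] (Z : EffCycle (MvPolynomial (Fin n) K)) :
    EffCycle (MvPolynomial (Fin n) L) :=
  Z.sum fun P a => a • ofIdeal (P.asIdeal.map (MvPolynomial.map (algebraMap K L)))

open Classical in
/-- The ideal of Chow equations `I^ch(Z)`. If `K` is finite, it is the ideal of `K[x_1, …, x_n]`
that becomes `I^ch(Z_L)` over an infinite extension field `L` of `K`, here `L = K(t)`. -/
def chowIdeal (Z : EffCycle (MvPolynomial (Fin n) K)) : Ideal (MvPolynomial (Fin n) K) :=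
  if Infinite K then chowIdealOfInfinite Z
  else (chowIdealOfInfinite (baseChange (RatFunc K) Z)).comap
    (MvPolynomial.map (algebraMap K (RatFunc K)))

variable {m : ℕ}

/-- The product cycle `∏ Z_i` on `𝔸ⁿ × ⋯ × 𝔸ⁿ` (`m` factors, with coordinates `x_(i,j)`): multilinear
in the `Z_i`, and for subvarieties it is the cycle of the product subscheme. -/
def prodCycle (Z : Fin m → EffCycle (MvPolynomial (Fin n) K)) :
    EffCycle (MvPolynomial (Fin m × Fin n) K) :=
  ∑ P ∈ Fintype.piFinset fun i => (Z i).support,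
    (∏ i, Z i (P i)) • ofIdeal (⨆ i, (P i).asIdeal.map (rename (Prod.mk i) :
      MvPolynomial (Fin n) K →ₐ[K] MvPolynomial (Fin m × Fin n) K))

/-- The ideal of the diagonal in `𝔸ⁿ × ⋯ × 𝔸ⁿ`: the kernel of the comorphism `x_(i,j) ↦ x_j` of the
diagonal embedding. -/
def diagonalIdeal (K : Type*) [Field K] (m n : ℕ) : Ideal (MvPolynomial (Fin m × Fin n) K) :=
  RingHom.ker (rename Prod.snd : MvPolynomial (Fin m × Fin n) K →ₐ[K] MvPolynomial (Fin n) K)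

/-- `ℓ` is an ordered sequence of `n(m-1)` equations (of degree one) of hyperplanes whose
intersection is the diagonal. -/
def IsDiagonalSystem (ℓ : Fin (n * (m - 1)) → MvPolynomial (Fin m × Fin n) K) : Prop :=
  (∀ k, (ℓ k).totalDegree = 1) ∧ Ideal.span (Set.range ℓ) = diagonalIdeal K m n

/-- The intersection cycle `(Z_1 ⋒ ⋯ ⋒ Z_m, ℓ)`: intersect `∏ Z_i` with the hyperplanes `ℓ k = 0`,
one after the other. The components of the resulting cycle lie on the diagonal, which is identified
with `𝔸ⁿ` by the projection to the `r`-th factor. -/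
def vtCycle (Z : Fin m → EffCycle (MvPolynomial (Fin n) K))
    (ℓ : Fin (n * (m - 1)) → MvPolynomial (Fin m × Fin n) K) (r : Fin m) :
    EffCycle (MvPolynomial (Fin n) K) :=
  ((List.ofFn ℓ).foldl capDivisor (prodCycle Z)).mapDomain
    (PrimeSpectrum.comap (rename (Prod.mk r) :
      MvPolynomial (Fin n) K →ₐ[K] MvPolynomial (Fin m × Fin n) K).toRingHom)

end AffineSpace

end EffCycle

/-- `r` is integral over the ideal `I`, i.e. it lies in the integral closure of `I`:
`r ^ k + ∑_{j = 1}^k c_j r ^ (k - j) = 0` for some `k ≥ 1` and some `c_j ∈ I ^ j`. -/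
def Ideal.IsIntegralElem {R : Type*} [CommRing R] (I : Ideal R) (r : R) : Prop :=
  ∃ (k : ℕ) (c : ℕ → R), 1 ≤ k ∧ (∀ j ∈ Finset.Icc 1 k, c j ∈ I ^ j) ∧
    r ^ k + ∑ j ∈ Finset.Icc 1 k, c j * r ^ (k - j) = 0

end

/-! To a variety `V` of dimension `d` an ideal `varietyContent V` is attached. Over the field
generated by the coefficients of `d + 1` generic affine-linear forms `U`, the map given by `U` is
finite on `V`, and the greatest common divisor of its zeroth Fitting ideal plays the role of the
Chow form. Substituting `U` back into it and taking all coefficients with respect to a `K`-basis of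
the generic field gives the ideal. The multiplicative extension to cycles is `cycleContent`.

This ideal lies between the two ideals of interest: it contains `I^ch(Z)`
(`EffCycle.chowIdeal_le_cycleContent`) and is contained in `I(Z)` (`cycleContent_le_ideal`). The
first inclusion rests on specialisation: for every finite tuple of affine-linear forms, a common
divisor of the Fitting elements has its value in the content (`hasChowForm_affineForm`), and such a
divisor divides the equation of the pushed-forward divisor (`DvdFitting.dvd_pow_mapDegree`).

The heart is one hyperplane section. For `V` not contained in `ℓ = 0`, the tuple of `d` generic
forms and `ℓ` is finite on `V`. Setting the last coordinate to zero gives a polynomial that divides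
the product of the Chow forms of the primes in a filtration of the coordinate ring of `V ∩ (ℓ = 0)`;
components of dimension `d - 1` occur in it at most as often as their multiplicity, smaller ones
contribute units. Hence a product of Chow forms has its coefficients in `varietyContent V + (ℓ)`.
The step from the content of a product to the product of contents is the lemma of Gauss, valid in
valuation rings; this is the source of the integral closure (`valuativeLE_cycleContent_ofIdeal`).

Iterating over the hyperplanes and restricting to the diagonal, where all `ℓ k` vanish, leaves the
restriction of `I(Z_1 × ⋯ × Z_m)`. It lies in the sum of the `I(Z_i)`, because a product of
varieties has no embedded components (`EffCycle.map_prodCycle_ideal_le`). The valuative criterion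
then produces the integral equation. -/

noncomputable section

/-! ### Fitting elements: determinants of relations of a finite module -/

section Fitting

variable {S T S' T' : Type*} [CommRing S] [CommRing T] [CommRing S'] [CommRing T']

/-- The family `t` spans `T ⧸ J` as a module over `S`, which acts through `φ`. -/
def SpansModulo (φ : S →+* T) (J : Ideal T) {ι : Type*} [Fintype ι] (t : ι → T) : Prop :=
  ∀ x, ∃ c : ι → S, x - ∑ i, φ (c i) * t i ∈ J

/-- `g` is the determinant of a square matrix of relations of a finite family spanning the
`S`-module `T ⧸ J`; these elements generate the zeroth Fitting ideal of this module. -/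
def IsFittingElem (φ : S →+* T) (J : Ideal T) (g : S) : Prop :=
  ∃ (b : ℕ) (t : Fin b → T) (N : Matrix (Fin b) (Fin b) S),
    SpansModulo φ J t ∧ (∀ i, ∑ j, φ (N i j) * t j ∈ J) ∧ N.det = g

lemma IsFittingElem.of_fintype {φ : S →+* T} {J : Ideal T} {ι : Type*} [Fintype ι] [DecidableEq ι]
    (t : ι → T) (N : Matrix ι ι S) (ht : SpansModulo φ J t)
    (hN : ∀ i, ∑ j, φ (N i j) * t j ∈ J) : IsFittingElem φ J N.det := by
  classical
  let e := Fintype.equivFin ι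
  refine ⟨Fintype.card ι, t ∘ e.symm, N.submatrix e.symm e.symm, fun x => ?_, fun i => ?_,
    Matrix.det_submatrix_equiv_self _ _⟩
  · obtain ⟨c, hc⟩ := ht x
    refine ⟨c ∘ e.symm, ?_⟩
    rwa [← e.symm.sum_comp (fun i => φ (c i) * t i)] at hc
  · have := hN (e.symm i)
    rwa [← e.symm.sum_comp] at this

lemma SpansModulo.sumElim_right {φ : S →+* T} {J : Ideal T} {ι κ : Type*} [Fintype ι] [Fintype κ]
    (t : ι → T) {u : κ → T} (hu : SpansModulo φ J u) : SpansModulo φ J (Sum.elim t u) := fun x => by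
  obtain ⟨c, hc⟩ := hu x
  exact ⟨Sum.elim 0 c, by simpa using hc⟩

/-- Multiplicativity of Fitting elements along `T ⧸ Q → T ⧸ J → T ⧸ (J + (a)) → 0`. -/
lemma IsFittingElem.mul {φ : S →+* T} {J Q : Ideal T} {a : T} (ha : ∀ q ∈ Q, a * q ∈ J)
    {g h : S} (hg : IsFittingElem φ Q g) (hh : IsFittingElem φ (J ⊔ Ideal.span {a}) h) :
    IsFittingElem φ J (g * h) := by
  classical
  obtain ⟨b, t, N, ht, hN, rfl⟩ := hg
  obtain ⟨b', t', N', ht', hN', rfl⟩ := hh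
  -- Multiplication by `a` factors through `T ⧸ Q`, so the elements `a * t i` span the kernel of `T
  -- ⧸ J → T ⧸ (J + (a))`. Correcting the relations of the `t'` by them gives a block triangular
  -- relation matrix.
  have key : ∀ y ∈ J ⊔ Ideal.span {a}, ∃ c : Fin b → S, y - ∑ i, φ (c i) * (a * t i) ∈ J := by
    intro y hy
    obtain ⟨j, hj, z, hz, rfl⟩ := Submodule.mem_sup.1 hy
    obtain ⟨x, rfl⟩ := Ideal.mem_span_singleton'.1 hz
    obtain ⟨c, hc⟩ := ht x
    refine ⟨c, ?_⟩
    have h1 := J.add_mem hj (ha _ hc)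
    convert h1 using 1
    rw [mul_sub, Finset.mul_sum, add_sub_assoc, mul_comm x a]
    congr 2
    exact Finset.sum_congr rfl fun i _ => by ring
  choose c hc using fun i => key _ (hN' i)
  have hspan : SpansModulo φ J (Sum.elim t' fun i => a * t i) := fun x => by
    obtain ⟨d, hd⟩ := ht' x
    obtain ⟨e, he⟩ := key _ hd
    refine ⟨Sum.elim d e, ?_⟩
    simpa [sub_sub] using he
  have := IsFittingElem.of_fintype (Sum.elim t' fun i => a * t i)
    (Matrix.fromBlocks N' (Matrix.of fun i j => - c i j) 0 N) hspan (by
      rintro (i | i)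
      · simpa [sub_eq_add_neg] using hc i
      · have := ha _ (hN i)
        rw [Finset.mul_sum] at this
        simp only [Fintype.sum_sum_type, Matrix.fromBlocks_apply₂₁, Matrix.zero_apply, map_zero,
          zero_mul, Finset.sum_const_zero, zero_add, Matrix.fromBlocks_apply₂₂, Sum.elim_inr]
        convert this using 2 with j
        exact mul_left_comm _ _ _)
  rwa [Matrix.det_fromBlocks_zero₂₁, mul_comm] at this

/-- Fitting elements of a specialisation lift. -/
lemma IsFittingElem.exists_lift {φ : S →+* T} {J : Ideal T} {φ' : S' →+* T'} {J' : Ideal T'}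
    (ρ : S →+* S') (ψ : T →+* T') (hρ : Function.Surjective ρ) (hψ : Function.Surjective ψ)
    (hc : ∀ s, φ' (ρ s) - ψ (φ s) ∈ J') (hk : ∀ x, ψ x ∈ J' → x ∈ J ⊔ (RingHom.ker ρ).map φ)
    {κ : Type*} [Fintype κ] (u : κ → T) (hu : SpansModulo φ J u) {g' : S'}
    (hg : IsFittingElem φ' J' g') : ∃ g, IsFittingElem φ J g ∧ ρ g = g' := by
  classical
  obtain ⟨b, t', N', ht', hN', rfl⟩ := hg
  choose t ht using fun i => hψ (t' i)
  choose N hN using fun i j => hρ (N' i j)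
  choose c' hc' using fun k => ht' (ψ (u k))
  choose c hcc using fun k i => hρ (c' k i)
  let w : Fin b ⊕ κ → T := Sum.elim t u
  -- The lifted family `t` need not span before specialisation, so the generators `u` are appended,
  -- together with the relations expressing their images through `t'`. The rows are relations only
  -- up to the extension of `ker ρ`. That error is absorbed below in the `u` columns with entries in
  -- `ker ρ`, which leaves the image of the determinant unchanged.
  let A : Matrix (Fin b ⊕ κ) (Fin b ⊕ κ) S := Matrix.fromBlocks (Matrix.of N) 0 (Matrix.of fun k i => - c k i) 1
  have hmem : ∀ (d : Fin b → S), ψ (∑ i, φ (d i) * t i) - ∑ i, φ' (ρ (d i)) * t' i ∈ J' := by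
    intro d
    rw [map_sum, ← Finset.sum_sub_distrib]
    refine J'.sum_mem fun i _ => ?_
    rw [map_mul, ht, ← sub_mul]
    refine J'.mul_mem_right _ ?_
    rw [← neg_sub]
    exact J'.neg_mem (hc _)
  have hA : ∀ i, ∑ j, φ (A i j) * w j ∈ J ⊔ (RingHom.ker ρ).map φ := by
    rintro (i | k)
    · apply hk
      have h1 := J'.add_mem (hmem (N i)) (hN' i)
      simpa [A, w, Fintype.sum_sum_type, hN] using h1
    · apply hk
      have h1 := J'.sub_mem (hc' k) (hmem (c k))
      convert h1 using 1
      simp [A, w, Fintype.sum_sum_type, Matrix.one_apply, hcc]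
      ring
  have key : ∀ y ∈ J ⊔ (RingHom.ker ρ).map φ,
      ∃ d : κ → S, (∀ k, ρ (d k) = 0) ∧ y - ∑ k, φ (d k) * u k ∈ J := by
    intro y hy
    obtain ⟨j, hj, z, hz, rfl⟩ := Submodule.mem_sup.1 hy
    suffices ∃ d : κ → S, (∀ k, ρ (d k) = 0) ∧ z - ∑ k, φ (d k) * u k ∈ J by
      obtain ⟨d, h0, hd⟩ := this
      exact ⟨d, h0, by rw [add_sub_assoc]; exact J.add_mem hj hd⟩
    refine Submodule.span_induction (p := fun z _ => ∃ d : κ → S, (∀ k, ρ (d k) = 0) ∧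
      z - ∑ k, φ (d k) * u k ∈ J) ?_ ⟨0, by simp, by simp⟩ ?_ ?_ hz
    · rintro _ ⟨s, hs, rfl⟩
      obtain ⟨e, he⟩ := hu 1
      have hs' : ρ s = 0 := hs
      refine ⟨fun k => s * e k, fun k => by simp [hs'], ?_⟩
      convert J.mul_mem_left (φ s) he using 1
      simp [mul_sub, Finset.mul_sum, mul_assoc]
    · rintro x y _ _ ⟨d, h0, hd⟩ ⟨e, h1, he⟩
      refine ⟨d + e, fun k => by simp [h0, h1], ?_⟩
      convert J.add_mem hd he using 1
      simp [add_mul, Finset.sum_add_distrib]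
      ring
    · rintro a x _ ⟨d, h0, hd⟩
      choose e he using fun k => hu (a * u k)
      refine ⟨fun l => ∑ k, d k * e k l, fun l => by simp [h0], ?_⟩
      have h1 := J.add_mem (J.mul_mem_left a hd)
        (J.sum_mem (t := Finset.univ) fun k _ => J.mul_mem_left (φ (d k)) (he k))
      convert h1 using 1
      simp only [smul_eq_mul, map_sum, map_mul, mul_sub, Finset.sum_sub_distrib, Finset.mul_sum,
        Finset.sum_mul]
      rw [Finset.sum_comm (f := fun x y => φ (d y) * φ (e y x) * u x)]
      have : ∀ i, φ (d i) * (a * u i) = a * (φ (d i) * u i) := fun i => by ring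
      simp only [this, mul_assoc]
      abel
  choose d hd0 hd using fun i => key _ (hA i)
  let A' : Matrix (Fin b ⊕ κ) (Fin b ⊕ κ) S := A - Matrix.of fun i => Sum.elim 0 (d i)
  refine ⟨A'.det, IsFittingElem.of_fintype w A' (SpansModulo.sumElim_right t hu) fun i => ?_, ?_⟩
  · convert hd i using 1
    simp [A', w, Fintype.sum_sum_type, sub_mul, Finset.sum_sub_distrib]
  · rw [RingHom.map_det]
    have : ρ.mapMatrix A' = Matrix.fromBlocks N' 0 (Matrix.of fun k i => - c' k i) 1 := by
      ext (i | i) (j | j)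
      · simp [A', A, hN]
      · simp [A', A, hd0]
      · simp [A', A, hcc]
      · by_cases h : i = j <;> simp [A', A, hd0, h]
    rw [this, Matrix.det_fromBlocks_zero₁₂]
    simp

/-- Images of Fitting elements under a base change are Fitting elements. -/
lemma IsFittingElem.map {φ : S →+* T} {J : Ideal T} {φ' : S' →+* T'} {J' : Ideal T'}
    (α : S →+* S') (β : T →+* T') (hc : ∀ s, φ' (α s) = β (φ s)) (hJ : ∀ x ∈ J, β x ∈ J')
    (hspan : ∀ x : T', ∃ (n : ℕ) (d : Fin n → S') (y : Fin n → T),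
      x - ∑ k, φ' (d k) * β (y k) ∈ J') {g : S}
    (hg : IsFittingElem φ J g) : IsFittingElem φ' J' (α g) := by
  obtain ⟨b, t, N, ht, hN, rfl⟩ := hg
  rw [RingHom.map_det]
  refine IsFittingElem.of_fintype (β ∘ t) _ (fun x => ?_) fun i => ?_
  · obtain ⟨n, d, y, hx⟩ := hspan x
    choose c hc' using fun k => ht (y k)
    refine ⟨fun i => ∑ k, d k * α (c k i), ?_⟩
    have h1 := J'.add_mem hx (J'.sum_mem (t := Finset.univ) fun k _ =>
      J'.mul_mem_left (φ' (d k)) (hJ _ (hc' k)))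
    convert h1 using 1
    simp only [map_sub, map_sum, map_mul, mul_sub, Finset.sum_sub_distrib, Finset.mul_sum,
      Finset.sum_mul, hc, Function.comp]
    rw [Finset.sum_comm (f := fun x y => φ' (d y) * β (φ (c y x)) * β (t x))]
    simp only [mul_assoc]
    ring
  · have := hJ _ (hN i)
    simpa [hc] using this

/-- Fitting elements annihilate. -/
lemma IsFittingElem.mul_mem {φ : S →+* T} {J : Ideal T} {g : S} (hg : IsFittingElem φ J g)
    (x : T) : φ g * x ∈ J := by
  obtain ⟨b, t, N, ht, hN, rfl⟩ := hg
  have h1 : ∀ i, φ N.det * t i ∈ J := by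
    intro i
    have h2 := J.sum_mem (t := Finset.univ) fun k _ => J.mul_mem_left (φ (N.adjugate i k)) (hN k)
    convert h2 using 1
    simp only [Finset.mul_sum]
    rw [Finset.sum_comm]
    simp only [← mul_assoc, ← map_mul, ← Finset.sum_mul, ← map_sum]
    simp only [← Matrix.mul_apply, Matrix.adjugate_mul]
    simp [Matrix.smul_apply, Matrix.one_apply, apply_ite φ, ite_mul]
  obtain ⟨c, hc⟩ := ht x
  have h2 := J.add_mem (J.mul_mem_left (φ N.det) hc)
    (J.sum_mem (t := Finset.univ) fun i _ => J.mul_mem_left (φ (c i)) (h1 i))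
  convert h2 using 1
  rw [mul_sub, Finset.mul_sum, sub_add]
  have : ∀ i, φ N.det * (φ (c i) * t i) = φ (c i) * (φ N.det * t i) := fun i => by ring
  simp [this]

/-- A power of an annihilating element is a Fitting element. -/
lemma SpansModulo.isFittingElem_pow {φ : S →+* T} {J : Ideal T} {ι : Type*} [Fintype ι]
    {t : ι → T} (ht : SpansModulo φ J t) {s : S} (hs : φ s ∈ J) :
    IsFittingElem φ J (s ^ Fintype.card ι) := by
  classical
  have := IsFittingElem.of_fintype t (Matrix.diagonal fun _ => s) ht fun i => by
    rw [Finset.sum_eq_single i]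
    · simpa using J.mul_mem_right _ hs
    · intro j _ hj
      simp [Matrix.diagonal_apply_ne _ hj.symm]
    · simp
  simpa using this

end Fitting

/-! ### Coefficient functionals and descent of ideal membership -/

namespace MvPolynomial

section MapCoeff

variable {k Λ : Type*} [CommRing k] [CommRing Λ] [Algebra k Λ] {σ τ : Type*}

/-- Apply a linear functional to all coefficients of a polynomial. -/
def mapCoeff (ω : Λ →ₗ[k] k) : MvPolynomial σ Λ →+ MvPolynomial σ k where
  toFun p := ∑ m ∈ p.support, monomial m (ω (p.coeff m))
  map_zero' := by simp
  map_add' p q := by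
    classical
    ext m
    simp only [coeff_sum, coeff_monomial, coeff_add, Finset.sum_ite_eq', mem_support_iff]
    by_cases h1 : coeff m p = 0 <;> by_cases h2 : coeff m q = 0 <;> simp [h1, h2]
    intro h
    rw [← map_add, h, map_zero]

@[simp] lemma coeff_mapCoeff (ω : Λ →ₗ[k] k) (p : MvPolynomial σ Λ) (m : σ →₀ ℕ) :
    (mapCoeff ω p).coeff m = ω (p.coeff m) := by
  classical
  change coeff m (∑ m ∈ p.support, monomial m (ω (p.coeff m))) = _
  simp only [coeff_sum, coeff_monomial, Finset.sum_ite_eq', mem_support_iff]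
  by_cases h1 : coeff m p = 0 <;> simp [h1]

lemma mapCoeff_mul_map (ω : Λ →ₗ[k] k) (p : MvPolynomial σ Λ) (q : MvPolynomial σ k) :
    mapCoeff ω (p * map (algebraMap k Λ) q) = mapCoeff ω p * q := by
  classical
  ext m
  simp only [coeff_mapCoeff, coeff_mul, map_sum, coeff_map]
  refine Finset.sum_congr rfl fun x _ => ?_
  rw [mul_comm, ← Algebra.smul_def, map_smul, smul_eq_mul, mul_comm]

lemma mapCoeff_map (ω : Λ →ₗ[k] k) (q : MvPolynomial σ k) :
    mapCoeff ω (map (algebraMap k Λ) q) = C (ω 1) * q := by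
  rw [← one_mul (map (algebraMap k Λ) q), mapCoeff_mul_map]
  congr 1
  classical
  ext m
  simp only [coeff_mapCoeff, coeff_one, coeff_C]
  split_ifs <;> simp

lemma mapCoeff_mem (ω : Λ →ₗ[k] k) {I : Ideal (MvPolynomial σ k)} {p : MvPolynomial σ Λ}
    (hp : p ∈ I.map (map (algebraMap k Λ))) : mapCoeff ω p ∈ I := by
  refine Submodule.span_induction (p := fun z _ => ∀ q, mapCoeff ω (q * z) ∈ I) ?_ (by simp)
    ?_ ?_ hp 1 |> fun h => by simpa using h
  · rintro _ ⟨a, ha, rfl⟩ q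
    rw [mapCoeff_mul_map]
    exact I.mul_mem_left _ ha
  · intro x y _ _ hx hy q
    rw [mul_add, map_add]
    exact I.add_mem (hx q) (hy q)
  · intro a x _ hx q
    rw [smul_eq_mul, ← mul_assoc]
    exact hx _

lemma mapCoeff_aeval (ω : Λ →ₗ[k] k) (v : τ → MvPolynomial σ k) (c : MvPolynomial τ Λ) :
    mapCoeff ω (aeval (fun i => map (algebraMap k Λ) (v i)) c) = aeval v (mapCoeff ω c) := by
  classical
  induction c using MvPolynomial.induction_on' with
  | monomial m a =>
    have h1 : aeval (fun i => map (algebraMap k Λ) (v i)) (monomial m a) =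
        C a * map (algebraMap k Λ) (aeval v (monomial m (1 : k))) := by
      simp only [aeval_monomial, map_mul, Finsupp.prod, map_prod, map_pow]
      simp [algebraMap_eq]
    have h2 : mapCoeff ω (monomial m a) = monomial m (ω a) := by
      ext m'
      simp only [coeff_mapCoeff, coeff_monomial]
      split_ifs <;> simp
    have h3 : mapCoeff (σ := σ) ω (C a) = C (ω a) := by
      ext m'
      simp only [coeff_mapCoeff, coeff_C]
      split_ifs <;> simp
    rw [h1, mapCoeff_mul_map, h2, h3]
    simp only [aeval_monomial, algebraMap_eq, C_1, one_mul]
  | add p q hp hq => rw [map_add, map_add, map_add, map_add, hp, hq]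

end MapCoeff

section Field

variable {k L : Type*} [Field k] [CommRing L] [Algebra k L] {σ τ : Type*}

/-- Only finitely many vectors of a `k`-basis of `L` occur in the coefficients of finitely many
polynomials. This reduces statements over `L` to statements over `k`. -/
lemma exists_mapCoeff_decomposition {κ : Type*} [Finite κ] (p : κ → MvPolynomial σ L) :
    ∃ (n : ℕ) (e : Fin n → L) (ω : Fin n → (L →ₗ[k] k)),
      ∀ x, p x = ∑ i, C (e i) * map (algebraMap k L) (mapCoeff (ω i) (p x)) := by
  classical
  have := Fintype.ofFinite κ
  let b := Module.Basis.ofVectorSpace k L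
  let F := Finset.univ.biUnion fun x : κ => (p x).support.biUnion fun m =>
    (b.repr ((p x).coeff m)).support
  have hF : ∀ x m, (b.repr ((p x).coeff m)).support ⊆ F := fun x m i hi => by
    simp only [F, Finset.mem_biUnion, Finset.mem_univ, true_and]
    refine ⟨x, m, ?_, hi⟩
    rw [mem_support_iff]
    rintro h
    simp [h] at hi
  let e := F.equivFin.symm
  refine ⟨F.card, fun i => b (e i), fun i => b.coord (e i), fun x => ?_⟩
  ext m
  simp only [coeff_sum, coeff_C_mul, coeff_map, coeff_mapCoeff]
  rw [e.sum_comp (fun i : F => b i * algebraMap k L (b.coord i (coeff m (p x)))),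
    Finset.sum_coe_sort F (fun i => b i * algebraMap k L (b.coord i (coeff m (p x))))]
  conv_lhs => rw [← b.linearCombination_repr (coeff m (p x)), Finsupp.linearCombination_apply,
    Finsupp.sum_of_support_subset _ (hF x m) _ (by simp)]
  exact Finset.sum_congr rfl fun i _ => by
    rw [Algebra.smul_def, mul_comm, Module.Basis.coord_apply]

/-- `L` is free over `k`, so membership in an extended ideal is a condition on each coordinate. It
is what makes a coefficient ideal the smallest ideal whose extension contains a given polynomial. -/
lemma mem_map_iff_mapCoeff {I : Ideal (MvPolynomial σ k)} {p : MvPolynomial σ L} :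
    p ∈ I.map (map (algebraMap k L)) ↔ ∀ ω : L →ₗ[k] k, mapCoeff ω p ∈ I := by
  refine ⟨fun h ω => mapCoeff_mem ω h, fun h => ?_⟩
  obtain ⟨n, e, ω, hp⟩ := exists_mapCoeff_decomposition (k := k) (fun _ : Unit => p)
  rw [hp ()]
  exact Ideal.sum_mem _ fun i _ => Ideal.mul_mem_left _ _ (Ideal.mem_map_of_mem _ (h (ω i)))

/-- Membership in an extended ideal can be tested in a larger coefficient ring. -/
lemma mem_map_of_map_mem_map {L' : Type*} [CommRing L'] [Algebra k L'] (f : L →ₐ[k] L')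
    (hf : Function.Injective f) {I : Ideal (MvPolynomial σ k)} {p : MvPolynomial σ L}
    (h : map f.toRingHom p ∈ I.map (map (algebraMap k L'))) : p ∈ I.map (map (algebraMap k L)) := by
  rw [mem_map_iff_mapCoeff] at h ⊢
  intro ω
  -- A `k`-linear retraction of `f` extends functionals from `L` to `L'`.
  obtain ⟨g, hg⟩ := LinearMap.exists_leftInverse_of_injective f.toLinearMap
    (LinearMap.ker_eq_bot.2 hf)
  have h1 := h (ω ∘ₗ g)
  convert h1 using 1
  ext m
  have := LinearMap.congr_fun hg (coeff m p)
  simp only [coeff_mapCoeff, coeff_map, LinearMap.comp_apply]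
  congr 1
  exact this.symm

lemma map_mem_map_iff {L : Type*} [Field L] [Algebra k L] {I : Ideal (MvPolynomial σ k)}
    {p : MvPolynomial σ k} :
    map (algebraMap k L) p ∈ I.map (map (algebraMap k L)) ↔ p ∈ I := by
  refine ⟨fun h => ?_, fun h => Ideal.mem_map_of_mem _ h⟩
  obtain ⟨ω, hω⟩ : ∃ ω : L →ₗ[k] k, ω 1 = 1 := by
    obtain ⟨g, hg⟩ := LinearMap.exists_leftInverse_of_injective (Algebra.linearMap k L)
      (LinearMap.ker_eq_bot.2 (algebraMap k L).injective)
    exact ⟨g, by simpa using LinearMap.congr_fun hg 1⟩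
  have := mapCoeff_mem ω h
  rwa [mapCoeff_map, hω, C_1, one_mul] at this

end Field

end MvPolynomial

/-! ### Laplace expansion -/

section Laplace

/-- A determinant lies in the ideal generated by the maximal minors of its last columns. -/
lemma Matrix.det_mem_of_minors {S : Type*} [CommRing S] (I : Ideal S) {b : ℕ} :
    ∀ {a : ℕ} (Y : Matrix (Fin (a + b)) (Fin (a + b)) S),
      (∀ f : Fin b → Fin (a + b), (Y.submatrix f (Fin.natAdd a)).det ∈ I) → Y.det ∈ I := by
  intro a
  induction a with
  | zero =>
    intro Y h
    have := h (Fin.natAdd 0)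
    have e : Y.submatrix (Fin.natAdd 0) (Fin.natAdd 0) =
        Y.submatrix (finCongr (Nat.zero_add b).symm) (finCongr (Nat.zero_add b).symm) := by
      ext i j; simp only [Matrix.submatrix_apply]; congr 1 <;> ext <;> simp
    rwa [e, Matrix.det_submatrix_equiv_self] at this
  | succ a ih =>
    intro Y h
    let e : Fin (a + b + 1) ≃ Fin (a + 1 + b) := finCongr (by omega)
    rw [← Matrix.det_submatrix_equiv_self e, Matrix.det_succ_column_zero]
    refine I.sum_mem fun i _ => I.mul_mem_left _ (ih _ fun f => ?_)
    convert h (fun x => e (i.succAbove (f x))) using 2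
    ext x y
    simp only [Matrix.submatrix_apply]
    congr 1
    ext
    simp [e]
    omega

end Laplace

lemma SpansModulo.map {S T S' T' : Type*} [CommRing S] [CommRing T] [CommRing S'] [CommRing T']
    {φ : S →+* T} {J : Ideal T} {φ' : S' →+* T'} {J' : Ideal T'}
    (α : S →+* S') (β : T →+* T') (hc : ∀ s, φ' (α s) = β (φ s)) (hJ : ∀ x ∈ J, β x ∈ J')
    (hspan : ∀ x : T', ∃ (n : ℕ) (d : Fin n → S') (y : Fin n → T),
      x - ∑ k, φ' (d k) * β (y k) ∈ J') {ι : Type*} [Fintype ι] {t : ι → T}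
    (ht : SpansModulo φ J t) : SpansModulo φ' J' (β ∘ t) := fun x => by
  obtain ⟨n, d, y, hx⟩ := hspan x
  choose c hc' using fun k => ht (y k)
  refine ⟨fun i => ∑ k, d k * α (c k i), ?_⟩
  have h1 := J'.add_mem hx (J'.sum_mem (t := Finset.univ) fun k _ =>
    J'.mul_mem_left (φ' (d k)) (hJ _ (hc' k)))
  convert h1 using 1
  simp only [map_sub, map_sum, map_mul, mul_sub, Finset.sum_sub_distrib, Finset.mul_sum,
    Finset.sum_mul, hc, Function.comp]
  rw [Finset.sum_comm (f := fun x y => φ' (d y) * β (φ (c y x)) * β (t x))]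
  simp only [mul_assoc]
  ring

/-! ### Morphisms to affine space given by tuples of polynomials -/

section Tuple

variable {Λ Λ' : Type*} [CommRing Λ] [CommRing Λ'] {σ τ : Type*}

/-- The ring homomorphism `Λ[y_i] → Λ[x_j]` that maps `y_i` to `v i`. -/
def tupleHom (v : τ → MvPolynomial σ Λ) : MvPolynomial τ Λ →+* MvPolynomial σ Λ :=
  (aeval v : MvPolynomial τ Λ →ₐ[Λ] MvPolynomial σ Λ).toRingHom

lemma tupleHom_apply (v : τ → MvPolynomial σ Λ) (p : MvPolynomial τ Λ) :
    tupleHom v p = aeval v p := rfl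

@[simp] lemma tupleHom_X (v : τ → MvPolynomial σ Λ) (i : τ) : tupleHom v (X i) = v i := by
  rw [tupleHom_apply, aeval_X]

@[simp] lemma tupleHom_C (v : τ → MvPolynomial σ Λ) (a : Λ) : tupleHom v (C a) = C a := by
  rw [tupleHom_apply, aeval_C, algebraMap_eq]

/-- Extension of an ideal along a base change of polynomial rings. -/
abbrev extIdeal (f : Λ →+* Λ') (J : Ideal (MvPolynomial σ Λ)) : Ideal (MvPolynomial σ Λ') :=
  J.map (MvPolynomial.map f)

/-- Extension of a tuple along a base change of polynomial rings. -/
abbrev extTuple (f : Λ →+* Λ') (v : τ → MvPolynomial σ Λ) : τ → MvPolynomial σ Λ' :=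
  fun i => MvPolynomial.map f (v i)

lemma tupleHom_map (f : Λ →+* Λ') (v : τ → MvPolynomial σ Λ) (p : MvPolynomial τ Λ) :
    tupleHom (extTuple f v) (MvPolynomial.map f p) = MvPolynomial.map f (tupleHom v p) := by
  induction p using MvPolynomial.induction_on with
  | C a => simp
  | add p q hp hq => simp [hp, hq]
  | mul_X p i hp => rw [map_mul, map_mul, hp, map_mul, map_mul]; simp

/-- The morphism given by the tuple `v` is finite on `V(J)`. -/
def FiniteOn (v : τ → MvPolynomial σ Λ) (J : Ideal (MvPolynomial σ Λ)) : Prop :=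
  ∃ (n : ℕ) (t : Fin n → MvPolynomial σ Λ), SpansModulo (tupleHom v) J t

lemma exists_spanning_base_change (f : Λ →+* Λ') (v : τ → MvPolynomial σ Λ')
    (J : Ideal (MvPolynomial σ Λ')) (x : MvPolynomial σ Λ') :
    ∃ (n : ℕ) (d : Fin n → MvPolynomial τ Λ') (y : Fin n → MvPolynomial σ Λ),
      x - ∑ k, tupleHom v (d k) * MvPolynomial.map f (y k) ∈ J := by
  classical
  let e := x.support.equivFin.symm
  refine ⟨x.support.card, fun k => C (x.coeff (e k)), fun k => monomial (e k) 1, ?_⟩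
  convert J.zero_mem using 1
  rw [sub_eq_zero]
  conv_lhs => rw [x.as_sum]
  simp only [tupleHom_C, map_monomial, map_one, C_mul_monomial, mul_one]
  rw [e.sum_comp (fun i : x.support => monomial (i : σ →₀ ℕ) (coeff i x)),
    Finset.sum_coe_sort x.support (fun i => monomial i (coeff i x))]

lemma SpansModulo.baseChange (f : Λ →+* Λ') {v : τ → MvPolynomial σ Λ}
    {J : Ideal (MvPolynomial σ Λ)} {ι : Type*} [Fintype ι] {t : ι → MvPolynomial σ Λ}
    (ht : SpansModulo (tupleHom v) J t) :
    SpansModulo (tupleHom (extTuple f v)) (extIdeal f J) (MvPolynomial.map f ∘ t) :=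
  ht.map (MvPolynomial.map f) (MvPolynomial.map f) (tupleHom_map f v)
    (fun _ hx => Ideal.mem_map_of_mem _ hx) (exists_spanning_base_change f _ _)

lemma FiniteOn.baseChange (f : Λ →+* Λ') {v : τ → MvPolynomial σ Λ}
    {J : Ideal (MvPolynomial σ Λ)} (h : FiniteOn v J) :
    FiniteOn (extTuple f v) (extIdeal f J) := by
  obtain ⟨n, t, ht⟩ := h
  exact ⟨n, _, ht.baseChange f⟩

lemma IsFittingElem.baseChange (f : Λ →+* Λ') {v : τ → MvPolynomial σ Λ}
    {J : Ideal (MvPolynomial σ Λ)} {g : MvPolynomial τ Λ} (hg : IsFittingElem (tupleHom v) J g) :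
    IsFittingElem (tupleHom (extTuple f v)) (extIdeal f J) (MvPolynomial.map f g) :=
  hg.map (MvPolynomial.map f) (MvPolynomial.map f) (tupleHom_map f v)
    (fun _ hx => Ideal.mem_map_of_mem _ hx) (exists_spanning_base_change f _ _)

/-- `δ` divides all Fitting elements. -/
def DvdFitting (v : τ → MvPolynomial σ Λ) (J : Ideal (MvPolynomial σ Λ))
    (δ : MvPolynomial τ Λ) : Prop :=
  ∀ g, IsFittingElem (tupleHom v) J g → δ ∣ g

end Tuple

/-! ### Common divisors of Fitting elements under field extension -/

section Field

variable {k L : Type*} [Field k] [Field L] {σ τ : Type*}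

/-- Expanding each row in a `k`-basis of `L` and using multilinearity writes the determinant as an
`L`-combination of determinants over `k`, whose rows are again relations. This works only for a
spanning family defined over `k`. -/
lemma DvdFitting.det_dvd [Algebra k L] {v : τ → MvPolynomial σ k} {J : Ideal (MvPolynomial σ k)}
    {δ : MvPolynomial τ k} (h : DvdFitting v J δ) {b : ℕ} {t : Fin b → MvPolynomial σ k}
    (ht : SpansModulo (tupleHom v) J t) (M : Matrix (Fin b) (Fin b) (MvPolynomial τ L))
    (hM : ∀ i, ∑ j, tupleHom (extTuple (algebraMap k L) v) (M i j) * MvPolynomial.map (algebraMap k L) (t j) ∈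
      extIdeal (algebraMap k L) J) : MvPolynomial.map (algebraMap k L) δ ∣ M.det := by
  classical
  obtain ⟨n, e, ω, hp⟩ := exists_mapCoeff_decomposition (k := k)
    (fun x : Fin b × Fin b => M x.1 x.2)
  have hrow : M = fun r => ∑ i, (C (e i) : MvPolynomial τ L) •
      (fun j => MvPolynomial.map (algebraMap k L) (mapCoeff (ω i) (M r j))) := by
    funext r j
    simp only [Finset.sum_apply, Pi.smul_apply, smul_eq_mul]
    exact hp (r, j)
  have : M.det = ∑ r : Fin b → Fin n, (∏ i, (C (e (r i)) : MvPolynomial τ L)) •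
      MvPolynomial.map (algebraMap k L) (Matrix.det (Matrix.of fun i j => mapCoeff (ω (r i)) (M i j))) := by
    have h0 : M.det = (Matrix.detRowAlternating (R := MvPolynomial τ L)).toMultilinearMap
      (fun r => ∑ i, (C (e i) : MvPolynomial τ L) •
      (fun j => MvPolynomial.map (algebraMap k L) (mapCoeff (ω i) (M r j)))) := congrArg _ hrow
    rw [h0, MultilinearMap.map_sum]
    refine Finset.sum_congr rfl fun r _ => ?_
    rw [MultilinearMap.map_smul_univ]
    congr 1
    rw [RingHom.map_det]
    change Matrix.det _ = _
    congr 1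
  rw [this]
  refine Finset.dvd_sum fun r _ => Dvd.dvd.mul_left (map_dvd _ (h _ ?_)) _
  refine ⟨b, t, _, ht, fun i => ?_, rfl⟩
  have := mapCoeff_mem (ω (r i)) (hM i)
  rw [map_sum] at this
  convert this using 2 with j
  rw [mapCoeff_mul_map, tupleHom_apply, tupleHom_apply, mapCoeff_aeval]
  rfl

/-- Common divisors of Fitting elements remain common divisors after a field extension. -/
lemma DvdFitting.baseChange (f : k →+* L) {v : τ → MvPolynomial σ k}
    {J : Ideal (MvPolynomial σ k)} {δ : MvPolynomial τ k} (hfin : FiniteOn v J)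
    (h : DvdFitting v J δ) : DvdFitting (extTuple f v) (extIdeal f J) (MvPolynomial.map f δ) := by
  classical
  let _ := f.toAlgebra
  change DvdFitting (extTuple (algebraMap k L) v) (extIdeal (algebraMap k L) J)
    (MvPolynomial.map (algebraMap k L) δ)
  obtain ⟨b, t, ht⟩ := hfin
  rintro g ⟨a, t', N, ht', hN, rfl⟩
  set φ := tupleHom (extTuple (algebraMap k L) v)
  set J' := extIdeal (algebraMap k L) J
  set u : Fin b → MvPolynomial σ L := MvPolynomial.map (algebraMap k L) ∘ t
  have hu : SpansModulo φ J' u := ht.baseChange _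
  choose c hc using fun i => hu (t' i)
  choose e he using fun j => ht' (u j)
  let c' : Matrix (Fin a) (Fin b) (MvPolynomial τ L) := Matrix.of c
  let e' : Matrix (Fin b) (Fin a) (MvPolynomial τ L) := Matrix.of e
  -- An arbitrary spanning family `t'` over `L` is traded for the family `u`, which comes from `k`.
  -- The matrix `Y` has the determinant of `N`, and each row of its last `b` columns is a relation
  -- of `u` alone, since `c' u ≡ t'` and `e' t' ≡ u`. By Laplace expansion it is enough to treat the
  -- minors in these columns.
  let Y : Matrix (Fin a ⊕ Fin b) (Fin a ⊕ Fin b) (MvPolynomial τ L) :=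
    Matrix.fromBlocks N (N * c') (-e') (1 - e' * c')
  have hY : Y = Matrix.fromBlocks N 0 (-e') 1 * Matrix.fromBlocks 1 c' 0 1 := by
    rw [Matrix.fromBlocks_multiply]
    simp [Y, sub_eq_add_neg, add_comm]
  have hdet : Y.det = N.det := by
    rw [hY, Matrix.det_mul, Matrix.det_fromBlocks_zero₁₂, Matrix.det_fromBlocks_zero₂₁]
    simp
  have hcomb : ∀ d : Fin a → MvPolynomial τ L,
      ∑ j, φ ((Matrix.vecMul d c') j) * u j - ∑ i, φ (d i) * t' i ∈ J' := by
    intro d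
    rw [← neg_mem_iff]
    convert J'.sum_mem (t := Finset.univ) fun i _ => J'.mul_mem_left (φ (d i)) (hc i) using 1
    simp only [Matrix.vecMul, dotProduct, map_sum, map_mul, mul_sub, Finset.sum_sub_distrib,
      Finset.mul_sum, Finset.sum_mul, neg_sub, c', Matrix.of_apply]
    rw [Finset.sum_comm]
    simp only [mul_assoc]
  have hrel : ∀ r, ∑ j, φ (Y r (Sum.inr j)) * u j ∈ J' := by
    rintro (i | j)
    · have := J'.add_mem (hcomb (N i)) (hN i)
      rw [sub_add_cancel] at this
      exact this
    · have h0 : ∑ l, φ ((e' * c') j l) * u l - ∑ i, φ (e j i) * t' i ∈ J' := hcomb (e j)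
      have h1 := J'.sub_mem (he j) h0
      convert h1 using 1
      simp only [Y, Matrix.fromBlocks_apply₂₂, Matrix.sub_apply, map_sub, sub_mul,
        Finset.sum_sub_distrib, Matrix.one_apply, apply_ite φ, map_one, map_zero, ite_mul, one_mul,
        zero_mul, Finset.sum_ite_eq, Finset.mem_univ, if_true]
      ring
  rw [← hdet, ← Ideal.mem_span_singleton, ← Matrix.det_submatrix_equiv_self finSumFinEquiv.symm]
  refine Matrix.det_mem_of_minors _ _ fun r => ?_
  rw [Ideal.mem_span_singleton]
  refine h.det_dvd ht _ fun i => ?_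
  simpa [u, φ, J'] using hrel (finSumFinEquiv.symm (r i))

end Field

/-! ### The greatest common divisor of the Fitting elements -/

section Hull

/-- A set of elements of a Noetherian factorial ring has a greatest common divisor, and it is
already determined by finitely many of these elements. -/
lemma exists_gcd_of_set {S : Type*} [CommRing S] [IsDomain S] [UniqueFactorizationMonoid S]
    [IsNoetherianRing S] (F : Set S) : ∃ (g : S) (F' : Finset S), ↑F' ⊆ F ∧ (∀ a ∈ F, g ∣ a) ∧
      ∀ δ s, (∀ a ∈ F', δ ∣ s * a) → δ ∣ s * g := by
  classical
  let _ : StrongNormalizationMonoid S := Classical.choice inferInstance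
  let _ : StrongNormalizedGCDMonoid S := UniqueFactorizationMonoid.toStrongNormalizedGCDMonoid S
  obtain ⟨F', hF', hs⟩ := Submodule.fg_span_iff_fg_span_finset_subset F |>.1
    (IsNoetherian.noetherian (Ideal.span F))
  refine ⟨F'.gcd id, F', hF', fun a ha => ?_, fun δ s h => ?_⟩
  · have h1 : Ideal.span F ≤ Ideal.span {F'.gcd id} := by
      change Submodule.span S F ≤ _
      rw [hs]
      refine Submodule.span_le.2 fun b hb => ?_
      exact Ideal.mem_span_singleton.2 (Finset.gcd_dvd (f := id) hb)
    exact Ideal.mem_span_singleton.1 (h1 (Ideal.subset_span ha))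
  · have h2 := Finset.dvd_gcd (s := F') (f := fun a => s * a) h
    have h3 := Finset.gcd_mul_left (s := F') (f := id) (a := s)
    simp only [id] at h3
    rw [h3] at h2
    exact h2.trans (mul_dvd_mul_right (normalize_associated s).dvd _)

variable {Λ : Type*} [CommRing Λ] [IsDomain Λ] [UniqueFactorizationMonoid Λ] [IsNoetherianRing Λ]
  {σ τ : Type*} [Finite τ]

/-- The greatest common divisor of the Fitting elements. -/
def fittingGcd (v : τ → MvPolynomial σ Λ) (J : Ideal (MvPolynomial σ Λ)) : MvPolynomial τ Λ :=
  (exists_gcd_of_set {g | IsFittingElem (tupleHom v) J g}).choose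

/-- Finitely many elements suffice, so that the denominators occurring in `HasChowForm.specialize`
can be cleared simultaneously. -/
lemma fittingGcd_spec (v : τ → MvPolynomial σ Λ) (J : Ideal (MvPolynomial σ Λ)) :
    ∃ F' : Finset (MvPolynomial τ Λ), (∀ a ∈ F', IsFittingElem (tupleHom v) J a) ∧
      ∀ δ s, (∀ a ∈ F', δ ∣ s * a) → δ ∣ s * fittingGcd v J := by
  obtain ⟨F', h1, -, h2⟩ := (exists_gcd_of_set {g | IsFittingElem (tupleHom v) J g}).choose_spec
  exact ⟨F', h1, h2⟩

lemma dvdFitting_fittingGcd (v : τ → MvPolynomial σ Λ) (J : Ideal (MvPolynomial σ Λ)) :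
    DvdFitting v J (fittingGcd v J) := by
  obtain ⟨F', -, h1, -⟩ := (exists_gcd_of_set {g | IsFittingElem (tupleHom v) J g}).choose_spec
  exact h1

/-- The cofactor `s` makes it possible to replace the factors of a product by greatest common
divisors one after the other. -/
lemma dvd_mul_fittingGcd {v : τ → MvPolynomial σ Λ} {J : Ideal (MvPolynomial σ Λ)}
    {δ s : MvPolynomial τ Λ} (h : ∀ a, IsFittingElem (tupleHom v) J a → δ ∣ s * a) :
    δ ∣ s * fittingGcd v J := by
  obtain ⟨F', h1, h2⟩ := fittingGcd_spec v J
  exact h2 δ s fun a ha => h a (h1 a ha)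

end Hull

/-! ### Finite tuples and elimination of one member -/

section Finite

variable {L : Type*} [Field L] {σ τ κ : Type*}

lemma RingHom.finite_iff_exists_span {A B : Type*} [CommRing A] [CommRing B] (f : A →+* B) :
    f.Finite ↔ ∃ (n : ℕ) (t : Fin n → B), ∀ x, ∃ c : Fin n → A, x = ∑ i, f (c i) * t i := by
  let _ := f.toAlgebra
  change Module.Finite A B ↔ _
  constructor
  · intro h
    obtain ⟨n, t, ht⟩ := Module.Finite.exists_fin (R := A) (M := B)
    refine ⟨n, t, fun x => ?_⟩
    have hx : x ∈ Submodule.span A (Set.range t) := by rw [ht]; trivial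
    obtain ⟨c, hc⟩ := (Submodule.mem_span_range_iff_exists_fun _).1 hx
    exact ⟨c, by rw [← hc]; exact Finset.sum_congr rfl fun i _ => Algebra.smul_def _ _⟩
  · rintro ⟨n, t, ht⟩
    classical
    refine ⟨⟨Finset.univ.image t, eq_top_iff.2 fun x _ => ?_⟩⟩
    obtain ⟨c, hc⟩ := ht x
    rw [hc]
    refine Submodule.sum_mem _ fun i _ => ?_
    exact Submodule.smul_mem _ (c i) (Submodule.subset_span (by simp))

lemma finiteOn_iff_finite (v : τ → MvPolynomial σ L) (J : Ideal (MvPolynomial σ L)) :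
    FiniteOn v J ↔ ((Ideal.Quotient.mk J).comp (tupleHom v)).Finite := by
  rw [RingHom.finite_iff_exists_span]
  constructor
  · rintro ⟨n, t, ht⟩
    refine ⟨n, fun i => Ideal.Quotient.mk J (t i), fun x => ?_⟩
    obtain ⟨x, rfl⟩ := Ideal.Quotient.mk_surjective x
    obtain ⟨c, hc⟩ := ht x
    refine ⟨c, ?_⟩
    rw [← Ideal.Quotient.mk_eq_mk_iff_sub_mem] at hc
    simpa using hc
  · rintro ⟨n, s, hs⟩
    choose t ht using fun i => Ideal.Quotient.mk_surjective (s i)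
    refine ⟨n, t, fun x => ?_⟩
    obtain ⟨c, hc⟩ := hs (Ideal.Quotient.mk J x)
    refine ⟨c, ?_⟩
    rw [← Ideal.Quotient.mk_eq_mk_iff_sub_mem, hc]
    simp [ht]

lemma finiteOn_iff [Finite σ] (v : τ → MvPolynomial σ L) (J : Ideal (MvPolynomial σ L)) :
    FiniteOn v J ↔ ((Ideal.Quotient.mk J).comp (tupleHom v)).IsIntegral := by
  rw [finiteOn_iff_finite]
  refine ⟨RingHom.Finite.to_isIntegral, fun h => h.to_finite ?_⟩
  have h2 : ((Ideal.Quotient.mk J).comp (C : L →+* MvPolynomial σ L)).FiniteType := by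
    refine RingHom.FiniteType.comp_surjective ?_ Ideal.Quotient.mk_surjective
    have : Algebra.FiniteType L (MvPolynomial σ L) := inferInstance
    rw [← RingHom.finiteType_algebraMap] at this
    exact this
  refine RingHom.FiniteType.of_comp_finiteType (f := C) ?_
  convert h2 using 1
  ext a
  simp

/-- Integral ring homomorphisms can be tested on generators. -/
lemma RingHom.IsIntegral.of_generators {A B D : Type*} [CommRing A] [CommRing B]
    [CommRing D] {f : A →+* D} (g : B →+* D) (hf : f.IsIntegral)
    (h : ∀ a, g.IsIntegralElem (f a)) : g.IsIntegral := by
  let _ := g.toAlgebra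
  let f' : A →+* integralClosure B D := f.codRestrict _ h
  have hf' : ((integralClosure B D).val.toRingHom.comp f').IsIntegral := hf
  have h1 : (integralClosure B D).val.toRingHom.IsIntegral := RingHom.IsIntegral.tower_top _ _ hf'
  have h2 : Algebra.IsIntegral (integralClosure B D) D := ⟨h1⟩
  intro x
  exact isIntegral_trans (R := B) (A := integralClosure B D) x (h2.isIntegral x)

lemma FiniteOn.of_integral [Finite σ] {v : τ → MvPolynomial σ L} {w : κ → MvPolynomial σ L}
    {J : Ideal (MvPolynomial σ L)} (hv : FiniteOn v J)
    (h : ∀ i, ((Ideal.Quotient.mk J).comp (tupleHom w)).IsIntegralElem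
      (Ideal.Quotient.mk J (v i))) : FiniteOn w J := by
  rw [finiteOn_iff] at hv ⊢
  refine hv.of_generators _ fun a => ?_
  induction a using MvPolynomial.induction_on with
  | C a =>
    have := RingHom.isIntegralElem_map (f := (Ideal.Quotient.mk J).comp (tupleHom w)) (x := C a)
    rw [RingHom.comp_apply, tupleHom_C] at this ⊢
    exact this
  | add p q hp hq => rw [map_add]; exact RingHom.IsIntegralElem.add _ hp hq
  | mul_X p i hp =>
    rw [map_mul]
    refine RingHom.IsIntegralElem.mul _ hp ?_
    rw [RingHom.comp_apply, tupleHom_X]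
    exact h i

/-- A nonzero polynomial cannot vanish on all points with coordinates in an infinite subfield.
Applying this to the top form times `X i` makes `s i` nonzero as well. -/
lemma exists_homogeneous_eval_ne_zero {L0 : Type*} [Field L0] [Infinite L0]
    [Algebra L0 L] {E : MvPolynomial τ L} (hE : E ≠ 0) (i : τ) :
    ∃ s : τ → L0, s i ≠ 0 ∧
      eval (fun j => algebraMap L0 L (s j)) (homogeneousComponent E.totalDegree E) ≠ 0 := by
  have h0 : homogeneousComponent E.totalDegree E ≠ 0 := by
    intro h
    have hne : E.support.Nonempty := support_nonempty.2 hE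
    obtain ⟨m, hm, hmd⟩ := Finset.exists_mem_eq_sup E.support hne fun m => m.sum fun _ e => e
    have h2 := congrArg (coeff m) h
    rw [coeff_homogeneousComponent, if_pos, coeff_zero] at h2
    · exact mem_support_iff.1 hm h2
    · exact hmd.symm
  have h1 : homogeneousComponent E.totalDegree E * X i ≠ 0 := mul_ne_zero h0 (X_ne_zero i)
  obtain ⟨s, hs⟩ : ∃ s : τ → L0, eval (fun j => algebraMap L0 L (s j))
      (homogeneousComponent E.totalDegree E * X i) ≠ 0 := by
    by_contra! h
    refine h1 (funext_set (fun _ => Set.range (algebraMap L0 L))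
      (fun _ => Set.infinite_range_of_injective (algebraMap L0 L).injective) fun x hx => ?_)
    choose s hs using fun j => hx j (Set.mem_univ _)
    rw [map_zero, ← h s]
    congr 2
    exact (_root_.funext hs).symm
  rw [map_mul, eval_X] at hs
  exact ⟨s, fun h => hs (by simp [h]), left_ne_zero_of_mul hs⟩

/-- The substitution `y_j ↦ y_j + s_j t`. -/
def shiftHom (s : τ → L) : MvPolynomial τ L →+* Polynomial (MvPolynomial τ L) :=
  (aeval fun j => Polynomial.C (X j) + Polynomial.C (C (s j)) * Polynomial.X :
    MvPolynomial τ L →ₐ[L] Polynomial (MvPolynomial τ L)).toRingHom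

lemma shiftHom_X (s : τ → L) (j : τ) : shiftHom s (X j) =
    Polynomial.C (X j) + Polynomial.C (C (s j)) * Polynomial.X := aeval_X _ _

lemma shiftHom_C (s : τ → L) (a : L) : shiftHom s (C a) = Polynomial.C (C a) := aeval_C _ _

lemma shiftHom_monomial (s : τ → L) (m : τ →₀ ℕ) :
    (shiftHom s (monomial m 1)).natDegree ≤ m.degree ∧
      (shiftHom s (monomial m 1)).coeff m.degree = C (m.prod fun j a => s j ^ a) := by
  classical
  induction m using Finsupp.induction_linear with
  | zero => simp [← C_apply]
  | add m n hm hn =>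
    have h : (monomial (m + n) (1 : L)) = monomial m 1 * monomial n 1 := by simp [monomial_mul]
    rw [h, map_mul, map_add, Polynomial.coeff_mul_add_eq_of_natDegree_le hm.1 hn.1, hm.2, hn.2,
      Finsupp.prod_add_index' (by simp) (by simp [pow_add]), C_mul]
    exact ⟨Polynomial.natDegree_mul_le_of_le hm.1 hn.1, rfl⟩
  | single j a =>
    have h : (shiftHom s (X j)).natDegree ≤ 1 := by
      rw [shiftHom_X, add_comm]
      exact Polynomial.natDegree_linear_le
    rw [← X_pow_eq_monomial, map_pow]
    have h2 := Polynomial.coeff_pow_of_natDegree_le (m := a) h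
    rw [mul_one] at h2
    constructor
    · simpa using Polynomial.natDegree_pow_le_of_le a h
    · rw [Finsupp.degree_single, h2, shiftHom_X]
      simp

/-- In the direction `s` the polynomial has the value of its top form at `s` as its coefficient in
the maximal degree, so for general `s` it becomes monic up to a unit. -/
lemma shiftHom_coeff_totalDegree (s : τ → L) (E : MvPolynomial τ L) :
    (shiftHom s E).natDegree ≤ E.totalDegree ∧ (shiftHom s E).coeff E.totalDegree =
      C (eval s (homogeneousComponent E.totalDegree E)) := by
  classical
  have h1 : shiftHom s E = ∑ m ∈ E.support,
      Polynomial.C (C (coeff m E)) * shiftHom s (monomial m 1) := by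
    conv_lhs => rw [E.as_sum, map_sum]
    refine Finset.sum_congr rfl fun m _ => ?_
    rw [← shiftHom_C s, ← map_mul, C_mul_monomial, mul_one]
  have hle : ∀ m ∈ E.support, m.degree ≤ E.totalDegree := fun m hm => le_totalDegree hm
  constructor
  · rw [h1]
    refine Polynomial.natDegree_sum_le_of_forall_le _ _ fun m hm => ?_
    exact (Polynomial.natDegree_C_mul_le _ _).trans ((shiftHom_monomial s m).1.trans (hle m hm))
  · rw [h1, Polynomial.finsetSum_coeff, homogeneousComponent_apply, Finset.sum_filter,
      map_sum, map_sum]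
    refine Finset.sum_congr rfl fun m hm => ?_
    rw [Polynomial.coeff_C_mul]
    split_ifs with h
    · rw [← h, (shiftHom_monomial s m).2, eval_monomial, C_mul]
    · rw [Polynomial.coeff_eq_zero_of_natDegree_lt, mul_zero, map_zero, map_zero]
      exact (shiftHom_monomial s m).1.trans_lt (lt_of_le_of_ne (hle m hm) h)

/-- An algebraic relation allows to drop one element of a finite tuple after a general linear
change of coordinates. -/
lemma FiniteOn.exists_drop [Finite σ] {L0 : Type*} [Field L0] [Infinite L0] [Algebra L0 L]
    {v : τ → MvPolynomial σ L} {J : Ideal (MvPolynomial σ L)} (hv : FiniteOn v J)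
    {E : MvPolynomial τ L} (hE : E ≠ 0) (hEJ : tupleHom v E ∈ J) (i : τ) :
    ∃ c : τ → L0, c i = -1 ∧ FiniteOn (fun j => v j + C (algebraMap L0 L (c j)) * v i) J := by
  obtain ⟨s0, hi0, hs⟩ := exists_homogeneous_eval_ne_zero (L0 := L0) hE i
  set s : τ → L := fun j => algebraMap L0 L (s0 j) with hsdef
  have hi : s i ≠ 0 := by simpa [hsdef] using hi0
  -- With `t = v i / s i` and `w j = v j - s j * t`, the relation `E(w + s t) = 0` is monic in `t`
  -- up to a unit, so `t` is integral over the `w j`. The value `c i = -1` says that `w i = 0`: this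
  -- member is dropped. The constants lie in `L0`, which later preserves genericity over `L0`.
  refine ⟨fun j => - (s0 j * (s0 i)⁻¹), by simp [hi0], ?_⟩
  set w : τ → MvPolynomial σ L := fun j => v j + C (algebraMap L0 L (-(s0 j * (s0 i)⁻¹))) * v i
    with hw
  set t : MvPolynomial σ L := C (s i)⁻¹ * v i with ht
  have hvw : ∀ j, v j = w j + C (s j) * t := fun j => by
    simp only [hw, ht, hsdef, map_neg, map_mul, map_inv₀]
    ring
  set g := (Ideal.Quotient.mk J).comp (tupleHom w) with hg
  have hgC : ∀ a, g (C a) = Ideal.Quotient.mk J (C a) := fun a => by simp [hg]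
  have htint : g.IsIntegralElem (Ideal.Quotient.mk J t) := by
    obtain ⟨hd, hc⟩ := shiftHom_coeff_totalDegree s E
    set e := eval s (homogeneousComponent E.totalDegree E) with he
    refine ⟨Polynomial.C (C e⁻¹) * shiftHom s E,
      Polynomial.monic_of_natDegree_le_of_coeff_eq_one E.totalDegree
        ((Polynomial.natDegree_C_mul_le _ _).trans hd) ?_, ?_⟩
    · rw [Polynomial.coeff_C_mul, hc, ← C_mul, inv_mul_cancel₀ hs, C_1]
    · rw [Polynomial.eval₂_mul]
      have h1 : (Polynomial.eval₂RingHom g (Ideal.Quotient.mk J t)).comp (shiftHom s) =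
          (Ideal.Quotient.mk J).comp (tupleHom v) := by
        refine MvPolynomial.ringHom_ext (fun a => ?_) fun j => ?_
        · simp [shiftHom_C, hgC]
        · simp [shiftHom_X, hg, hvw j]
      have h2 := RingHom.congr_fun h1 E
      simp only [RingHom.comp_apply, Polynomial.coe_eval₂RingHom] at h2
      rw [h2, Ideal.Quotient.eq_zero_iff_mem.2 hEJ, mul_zero]
  refine hv.of_integral fun j => ?_
  rw [hvw j, map_add, map_mul, ← hgC]
  refine RingHom.IsIntegralElem.add _ ?_ (RingHom.IsIntegralElem.mul _
    (RingHom.isIntegralElem_map _) htint)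
  have : Ideal.Quotient.mk J (w j) = g (X j) := by simp [hg]
  rw [this]
  exact RingHom.isIntegralElem_map _

end Finite

/-! ### Dimension and algebraic relations -/

section Dimension

lemma ringKrullDim_le_of_isIntegral {A B : Type*} [CommRing A] [CommRing B] (f : A →+* B)
    (hf : f.IsIntegral) : ringKrullDim B ≤ ringKrullDim A := by
  let _ := f.toAlgebra
  have : Algebra.IsIntegral A B := ⟨hf⟩
  refine Order.krullDim_le_of_strictMono (PrimeSpectrum.comap (algebraMap A B)) fun P Q h => ?_
  exact Ideal.IsIntegral.comap_lt_comap (R := A) (I := P.asIdeal) (J := Q.asIdeal) h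

lemma ringKrullDim_eq_of_isIntegral {A B : Type*} [CommRing A] [CommRing B] (f : A →+* B)
    (hf : f.IsIntegral) (hinj : Function.Injective f) : ringKrullDim B = ringKrullDim A := by
  refine le_antisymm (ringKrullDim_le_of_isIntegral f hf) ?_
  let _ := f.toAlgebra
  have : Algebra.IsIntegral A B := ⟨hf⟩
  refine iSup_le fun l => ?_
  obtain ⟨P, -, hP, hPl⟩ := Ideal.exists_ideal_over_prime_of_isIntegral (S := B) l.head.asIdeal ⊥ (by
    rw [← RingHom.ker_eq_comap_bot]
    change RingHom.ker f ≤ _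
    rw [(RingHom.injective_iff_ker_eq_bot f).1 hinj]
    exact bot_le)
  have : P.LiesOver l.head.asIdeal := ⟨hPl.symm⟩
  obtain ⟨l', hl', -, -⟩ := Ideal.exists_ltSeries_of_hasGoingUp (S := B) l P
  rw [← hl']
  exact le_iSup (fun l : LTSeries (PrimeSpectrum B) => ((l.length : ℕ∞) : WithBot ℕ∞)) l'

variable {L : Type*} [Field L] {σ τ : Type*}

lemma FiniteOn.mono {v : τ → MvPolynomial σ L} {J J' : Ideal (MvPolynomial σ L)}
    (hv : FiniteOn v J) (h : J ≤ J') : FiniteOn v J' := by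
  obtain ⟨n, t, ht⟩ := hv
  refine ⟨n, t, fun x => ?_⟩
  obtain ⟨c, hc⟩ := ht x
  exact ⟨c, h hc⟩

lemma FiniteOn.isAlgebraic [Finite σ] {w : τ → MvPolynomial σ L} {J : Ideal (MvPolynomial σ L)}
    [Nontrivial (MvPolynomial σ L ⧸ J)] (hw : FiniteOn w J) : Algebra.IsAlgebraic
      (Algebra.adjoin L (Set.range fun i => Ideal.Quotient.mk J (w i))) (MvPolynomial σ L ⧸ J) := by
  rw [finiteOn_iff] at hw
  set A := Algebra.adjoin L (Set.range fun i => Ideal.Quotient.mk J (w i))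
  let f : MvPolynomial τ L →ₐ[L] A := aeval fun i => ⟨Ideal.Quotient.mk J (w i),
    Algebra.subset_adjoin ⟨i, rfl⟩⟩
  have h1 : (Ideal.Quotient.mk J).comp (tupleHom w) = (algebraMap A _).comp f.toRingHom := by
    refine MvPolynomial.ringHom_ext (fun a => ?_) fun i => ?_
    · simp [f]
      rfl
    · simp [f]
  rw [h1] at hw
  have h2 : (algebraMap A (MvPolynomial σ L ⧸ J)).IsIntegral := RingHom.IsIntegral.tower_top _ _ hw
  have : Nontrivial A := ⟨⟨0, 1, fun h => zero_ne_one (congrArg Subtype.val h)⟩⟩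
  refine ⟨fun x => ?_⟩
  have h3 : IsIntegral A x := h2 x
  exact h3.isAlgebraic

/-- A finite tuple of size `e` bounds the algebraic independence modulo an ideal. -/
lemma FiniteOn.exists_relation [Finite σ] [Finite τ] {e : ℕ} {w : Fin e → MvPolynomial σ L}
    {J : Ideal (MvPolynomial σ L)} (hw : FiniteOn w J) (he : e < Nat.card τ)
    (v : τ → MvPolynomial σ L) : ∃ E ≠ 0, tupleHom v E ∈ J := by
  by_contra! h
  -- Without a relation, some prime `p` containing `J` avoids all values `E(v)` with `E ≠ 0`. Then
  -- `v` is algebraically independent modulo `p`, against the bound `e` on the transcendence degree.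
  let M : Submonoid (MvPolynomial σ L) := (nonZeroDivisors (MvPolynomial τ L)).map (tupleHom v)
  have hdisj : Disjoint (J : Set (MvPolynomial σ L)) M := by
    rw [Set.disjoint_left]
    rintro _ hx ⟨E, hE, rfl⟩
    exact h E (nonZeroDivisors.ne_zero hE) hx
  obtain ⟨p, hp, hJp, hpM⟩ := Ideal.exists_le_prime_disjoint J M hdisj
  have hp' := hw.mono hJp
  have hind : AlgebraicIndependent L fun i => Ideal.Quotient.mk p (v i) := by
    rw [algebraicIndependent_iff]
    intro E hE
    by_contra h0
    have h1 : (aeval fun i => Ideal.Quotient.mk p (v i)) E = Ideal.Quotient.mk p (tupleHom v E) := by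
      have := (comp_aeval_apply v (Ideal.Quotient.mkₐ L p) E).symm
      exact this
    rw [h1, Ideal.Quotient.eq_zero_iff_mem] at hE
    exact Set.disjoint_left.1 hpM hE ⟨E, mem_nonZeroDivisors_of_ne_zero h0, rfl⟩
  have := hp'.isAlgebraic
  have h1 := Algebra.IsAlgebraic.trdeg_le_cardinalMk L (Set.range fun i => Ideal.Quotient.mk p (w i))
  have h2 := hind.lift_cardinalMk_le_trdeg
  have h3 : Cardinal.mk (Set.range fun i => Ideal.Quotient.mk p (w i)) ≤ e := by
    have := Cardinal.mk_range_le_lift (f := fun i => Ideal.Quotient.mk p (w i))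
    simpa using this
  have h4 := h2.trans (Cardinal.lift_le.2 (h1.trans h3))
  rw [← Nat.cast_card (α := τ)] at h4
  simp only [Cardinal.lift_natCast, Nat.cast_le] at h4
  omega

/-- Noether normalisation; the number of algebraically independent parameters is the dimension. -/
lemma exists_ringKrullDim_eq [Finite σ] (P : Ideal (MvPolynomial σ L)) [P.IsPrime] :
    ∃ d : ℕ, ringKrullDim (MvPolynomial σ L ⧸ P) = d ∧ ∃ w : Fin d → MvPolynomial σ L,
      FiniteOn w P ∧ ∀ E, tupleHom w E ∈ P → E = 0 := by
  obtain ⟨d, g, hinj, hfin⟩ := exists_finite_inj_algHom_of_fg L (MvPolynomial σ L ⧸ P)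
  choose w hw using fun i => Ideal.Quotient.mk_surjective (g (X i))
  have hg : (Ideal.Quotient.mk P).comp (tupleHom w) = g.toRingHom := by
    refine MvPolynomial.ringHom_ext (fun a => ?_) fun i => ?_
    · rw [RingHom.comp_apply, tupleHom_C]
      exact (g.commutes a).symm
    · rw [RingHom.comp_apply, tupleHom_X, hw]
      rfl
  refine ⟨d, ?_, w, ?_, fun E hE => ?_⟩
  · rw [ringKrullDim_eq_of_isIntegral g.toRingHom (RingHom.Finite.to_isIntegral hfin) hinj,
      MvPolynomial.ringKrullDim_of_isNoetherianRing]
    simp [ringKrullDim_eq_zero_of_field]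
  · rw [finiteOn_iff_finite, hg]
    exact hfin
  · apply hinj
    rw [map_zero]
    have := RingHom.congr_fun hg E
    rw [RingHom.comp_apply, Ideal.Quotient.eq_zero_iff_mem.2 hE] at this
    exact this.symm

lemma exists_parameters [Finite σ] {P : Ideal (MvPolynomial σ L)} [P.IsPrime] {d : ℕ}
    (hd : ringKrullDim (MvPolynomial σ L ⧸ P) = d) : ∃ w : Fin d → MvPolynomial σ L,
      FiniteOn w P ∧ ∀ E, tupleHom w E ∈ P → E = 0 := by
  obtain ⟨e, he, w, hw⟩ := exists_ringKrullDim_eq P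
  obtain rfl : e = d := by
    rw [he] at hd
    exact_mod_cast hd
  exact ⟨w, hw⟩

lemma ringKrullDim_quotient_succ_le_of_lt {A : Type*} [CommRing A] {P Q : Ideal A} [P.IsPrime]
    (h : P < Q) : ringKrullDim (A ⧸ Q) + 1 ≤ ringKrullDim (A ⧸ P) := by
  obtain ⟨x, hxQ, hxP⟩ := Set.exists_of_ssubset h
  exact ringKrullDim_succ_le_of_surjective (Ideal.Quotient.factor h.le)
    (Ideal.Quotient.factor_surjective h.le) (r := Ideal.Quotient.mk P x)
    (mem_nonZeroDivisors_of_ne_zero (by rwa [Ne, Ideal.Quotient.eq_zero_iff_mem]))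
    (by simpa [Ideal.Quotient.eq_zero_iff_mem] using hxQ)

lemma lt_of_ringKrullDim_eq {A : Type*} [CommRing A] {P Q : Ideal A} [P.IsPrime] (h : P < Q)
    {d e : ℕ} (hd : ringKrullDim (A ⧸ P) = d) (he : ringKrullDim (A ⧸ Q) = e) : e < d := by
  have h1 := ringKrullDim_quotient_succ_le_of_lt h
  rw [hd, he] at h1
  have : e + 1 ≤ d := by exact_mod_cast h1
  omega

lemma eq_zero_of_tupleHom_map_mem {K : Type*} [Field K] [Algebra K L] {w : τ → MvPolynomial σ K}
    {J : Ideal (MvPolynomial σ K)} (h : ∀ E, tupleHom w E ∈ J → E = 0) (E : MvPolynomial τ L)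
    (hE : tupleHom (extTuple (algebraMap K L) w) E ∈ extIdeal (algebraMap K L) J) : E = 0 := by
  have h1 : E ∈ (⊥ : Ideal (MvPolynomial τ K)).map (map (algebraMap K L)) := by
    rw [mem_map_iff_mapCoeff]
    intro ω
    rw [Ideal.mem_bot]
    apply h
    have := mapCoeff_mem ω hE
    rwa [tupleHom_apply, mapCoeff_aeval] at this
  simpa [Ideal.map_bot] using h1

end Dimension

/-! ### Affine-linear forms -/

section AffineForm

variable {R R' : Type*} [CommRing R] [CommRing R'] {σ : Type*} [Fintype σ]

/-- The polynomial of degree at most one with the given coefficients. -/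
def affineForm (a : Option σ → R) : MvPolynomial σ R := C (a none) + ∑ j, C (a (some j)) * X j

lemma map_affineForm (f : R →+* R') (a : Option σ → R) :
    map f (affineForm a) = affineForm fun h => f (a h) := by
  simp [affineForm]

lemma affineForm_add_mul (a b : Option σ → R) (c : R) :
    affineForm a + C c * affineForm b = affineForm fun h => a h + c * b h := by
  simp only [affineForm, mul_add, Finset.mul_sum, C_add, C_mul, add_mul, Finset.sum_add_distrib,
    mul_assoc]
  ring

lemma affineForm_single [DecidableEq σ] (j : σ) :
    affineForm (Pi.single (some j) (1 : R)) = X j := by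
  simp only [affineForm, ne_eq, reduceCtorEq, not_false_eq_true, Pi.single_eq_of_ne, C_0, zero_add]
  rw [Finset.sum_eq_single j]
  · simp
  · intro i _ hi
    rw [Pi.single_eq_of_ne (by simpa using hi)]
    simp
  · simp

end AffineForm

/-! ### Descent of finiteness -/

section FiniteOn

lemma FiniteOn.of_comp {Λ : Type*} [CommRing Λ] {σ τ κ : Type*} {v : τ → MvPolynomial σ Λ}
    {w : κ → MvPolynomial σ Λ} {J : Ideal (MvPolynomial σ Λ)} (hv : FiniteOn v J)
    (h : ∀ i, ∃ p, tupleHom w p = v i) : FiniteOn w J := by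
  obtain ⟨n, t, ht⟩ := hv
  choose p hp using h
  have hc : ∀ q, tupleHom v q = tupleHom w (tupleHom p q) := fun q => by
    induction q using MvPolynomial.induction_on with
    | C a => simp
    | add f g hf hg => simp only [map_add, hf, hg]
    | mul_X f i hf => simp only [map_mul, hf, tupleHom_X, hp]
  refine ⟨n, t, fun x => ?_⟩
  obtain ⟨c, hx⟩ := ht x
  exact ⟨fun i => tupleHom p (c i), by simpa only [hc] using hx⟩

lemma finiteOn_X {Λ : Type*} [CommRing Λ] {σ : Type*} (J : Ideal (MvPolynomial σ Λ)) :
    FiniteOn (fun j : σ => (X j : MvPolynomial σ Λ)) J := by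
  refine ⟨1, fun _ => 1, fun x => ⟨fun _ => x, ?_⟩⟩
  convert J.zero_mem
  simp [tupleHom_apply]

/-- Finiteness descends along extensions of the base field. -/
lemma FiniteOn.descend {k L : Type*} [Field k] [Field L] [Algebra k L] {σ τ : Type*}
    {v : τ → MvPolynomial σ k} {J : Ideal (MvPolynomial σ k)}
    (h : FiniteOn (extTuple (algebraMap k L) v) (extIdeal (algebraMap k L) J)) : FiniteOn v J := by
  classical
  obtain ⟨n, t, ht⟩ := h
  obtain ⟨ω, hω⟩ : ∃ ω : L →ₗ[k] k, ω 1 = 1 := by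
    obtain ⟨g, hg⟩ := LinearMap.exists_leftInverse_of_injective (Algebra.linearMap k L)
      (LinearMap.ker_eq_bot.2 (algebraMap k L).injective)
    exact ⟨g, by simpa using LinearMap.congr_fun hg 1⟩
  -- The spanning family is replaced by the monomials occurring in it, which are defined over `k`. A
  -- functional with value `1` at `1` then carries the coefficients down to `k`.
  let F := Finset.univ.biUnion fun i => (t i).support
  let e := F.equivFin.symm
  refine ⟨F.card, fun i => monomial (e i : σ →₀ ℕ) 1, fun x => ?_⟩
  obtain ⟨c, hc⟩ := ht (map (algebraMap k L) x)
  refine ⟨fun i => mapCoeff ω (∑ k, c k * C (coeff (e i) (t k))), ?_⟩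
  have h1 := mapCoeff_mem ω hc
  convert h1 using 1
  rw [map_sub, mapCoeff_map, hω, C_1, one_mul]
  congr 1
  have h2 : ∀ q, t q = ∑ i, C (coeff (e i) (t q)) * map (algebraMap k L) (monomial (e i : σ →₀ ℕ) 1) := by
    intro q
    simp only [map_monomial, map_one, C_mul_monomial, mul_one]
    rw [e.sum_comp (fun i : F => monomial (i : σ →₀ ℕ) (coeff i (t q))),
      Finset.sum_coe_sort F (fun i => monomial i (coeff i (t q)))]
    conv_lhs => rw [(t q).as_sum]
    refine Finset.sum_subset (Finset.subset_biUnion_of_mem (fun i => (t i).support)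
      (Finset.mem_univ q)) fun m _ hm => ?_
    rw [notMem_support_iff.1 hm, monomial_zero]
  have h3 : ∑ q, tupleHom (extTuple (algebraMap k L) v) (c q) * t q =
      ∑ i, tupleHom (extTuple (algebraMap k L) v) (∑ q, c q * C (coeff (e i) (t q))) *
        map (algebraMap k L) (monomial (e i : σ →₀ ℕ) 1) := by
    simp only [map_sum, map_mul, tupleHom_C, Finset.sum_mul]
    rw [Finset.sum_comm]
    refine Finset.sum_congr rfl fun q _ => ?_
    conv_lhs => rw [h2 q, Finset.mul_sum]
    simp only [mul_assoc]
  rw [h3, map_sum]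
  refine Finset.sum_congr rfl fun i _ => ?_
  rw [mapCoeff_mul_map, tupleHom_apply, tupleHom_apply, mapCoeff_aeval]

lemma extIdeal_extIdeal {K A B : Type*} [CommRing K] [CommRing A] [CommRing B] {σ : Type*}
    (f : K →+* A) (g : A →+* B) (J : Ideal (MvPolynomial σ K)) :
    extIdeal g (extIdeal f J) = extIdeal (g.comp f) J := by
  simp only [extIdeal]
  rw [Ideal.map_map]
  congr 1
  refine MvPolynomial.ringHom_ext (fun a => ?_) fun i => ?_ <;> simp

end FiniteOn

/-! ### Algebraically independent families -/

section AlgebraicIndependent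

variable {F L : Type*} [Field F] [CommRing L] [Algebra F L] {ι : Type*}

lemma AlgebraicIndependent.add_algebraMap {a : ι → L} (ha : AlgebraicIndependent F a) (s : ι → F) :
    AlgebraicIndependent F fun i => a i + algebraMap F L (s i) := by
  let f : MvPolynomial ι F →ₐ[F] MvPolynomial ι F := aeval fun i => X i + C (s i)
  let g : MvPolynomial ι F →ₐ[F] MvPolynomial ι F := aeval fun i => X i - C (s i)
  have hgf : g.comp f = AlgHom.id F _ := by
    ext i
    simp [f, g]
  have hf : Function.Injective f := fun p q h => by
    simpa using (DFunLike.congr_fun hgf p).symm.trans ((congrArg g h).trans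
      (DFunLike.congr_fun hgf q))
  have h1 : (aeval fun i => a i + algebraMap F L (s i)) = (aeval a).comp f := by
    ext i
    simp [f]
  change Function.Injective _
  rw [h1, AlgHom.coe_comp]
  exact Function.Injective.comp (show Function.Injective (aeval a) from ha) hf

/-- The field homomorphism from a field of rational functions defined by an algebraically
independent family. -/
lemma AlgebraicIndependent.exists_fieldHom {L : Type*} [Field L] [Algebra F L] {a : ι → L}
    (ha : AlgebraicIndependent F a) : ∃ f : FractionRing (MvPolynomial ι F) →ₐ[F] L,
      ∀ i, f (algebraMap (MvPolynomial ι F) _ (X i)) = a i := by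
  refine ⟨IsFractionRing.liftAlgHom (K := FractionRing (MvPolynomial ι F))
    (show Function.Injective (aeval a : MvPolynomial ι F →ₐ[F] L) from ha), fun i => ?_⟩
  simp

lemma algebraicIndependent_fraction (F : Type*) [Field F] (ι : Type*) :
    AlgebraicIndependent F fun i : ι =>
      algebraMap (MvPolynomial ι F) (FractionRing (MvPolynomial ι F)) (X i) := by
  have := (algebraicIndependent_X ι F).map' (f := IsScalarTower.toAlgHom F (MvPolynomial ι F)
    (FractionRing (MvPolynomial ι F))) (IsFractionRing.injective _ _)
  exact this

end AlgebraicIndependent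

/-! ### Generic affine-linear forms -/

section Generic

variable (K : Type*) [Field K] (e : ℕ) (σ : Type*) [Fintype σ]

/-- The field generated by the coefficients of `e` generic affine-linear forms. -/
abbrev GenericField := FractionRing (MvPolynomial (Fin e × Option σ) K)

/-- A tuple of `e` generic affine-linear forms. -/
def genericTuple : Fin e → MvPolynomial σ (GenericField K e σ) := fun i =>
  affineForm fun h => algebraMap (MvPolynomial (Fin e × Option σ) K) _ (X (i, h))

variable {K e σ}

/-- All coordinates together with the generic forms are certainly finite. As long as a
coordinate-type form is left, there are more than `d` members, hence a relation, and one of them can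
be dropped. Each drop shifts the coefficients of the generic forms by elements of `K` only. -/
lemma finiteOn_genericTuple_of_infinite [Infinite K] {P : Ideal (MvPolynomial σ K)} {d : ℕ}
    {w : Fin d → MvPolynomial σ K} (hw : FiniteOn w P) (hde : d ≤ e) :
    FiniteOn (genericTuple K e σ) (extIdeal (algebraMap K (GenericField K e σ)) P) := by
  classical
  set M := GenericField K e σ
  set z : Fin e → Option σ → M := fun i h =>
    algebraMap (MvPolynomial (Fin e × Option σ) K) M (X (i, h)) with hz
  have key : ∀ t N, N + t = Fintype.card σ → ∃ (s : Fin e → Option σ → K)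
      (u : Fin N → Option σ → K), FiniteOn (Sum.elim
        (fun i => affineForm fun h => z i h + algebraMap K M (s i h))
        (fun j => affineForm fun h => algebraMap K M (u j h))) (extIdeal (algebraMap K M) P) := by
    intro t
    induction t with
    | zero =>
      rintro N rfl
      let ε := Fintype.equivFin σ
      refine ⟨0, fun j => Pi.single (some (ε.symm j)) 1, (finiteOn_X _).of_comp fun j =>
        ⟨X (Sum.inr (ε j)), ?_⟩⟩
      rw [tupleHom_X, Sum.elim_inr, ← map_affineForm, affineForm_single]
      simp
    | succ t ih =>
      intro N hN
      obtain ⟨s, u, hfin⟩ := ih (N + 1) (by omega)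
      have hw' := hw.baseChange (algebraMap K M)
      obtain ⟨E, hE0, hE⟩ := hw'.exists_relation (τ := Fin e ⊕ Fin (N + 1))
        (by simp; omega) (Sum.elim
        (fun i => affineForm fun h => z i h + algebraMap K M (s i h))
        (fun j => affineForm fun h => algebraMap K M (u j h)))
      obtain ⟨c, hc, hfin'⟩ := hfin.exists_drop (L0 := K) hE0 hE (Sum.inr (Fin.last N))
      refine ⟨fun i h => s i h + c (Sum.inl i) * u (Fin.last N) h,
        fun j h => u j.castSucc h + c (Sum.inr j.castSucc) * u (Fin.last N) h,
        hfin'.of_comp ?_⟩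
      rintro (i | j)
      · refine ⟨X (Sum.inl i), ?_⟩
        simp only [tupleHom_X, Sum.elim_inl, Sum.elim_inr, affineForm_add_mul]
        congr 1
        funext h
        simp [add_assoc]
      · refine Fin.lastCases ⟨0, ?_⟩ (fun j => ⟨X (Sum.inr j), ?_⟩) j
        · simp [hc]
        · simp only [tupleHom_X, Sum.elim_inr, affineForm_add_mul]
          congr 1
          funext h
          simp
  -- No auxiliary form is left. The accumulated shifts `s` are undone by the `K`-embedding of the
  -- generic field that subtracts them from the variables.
  obtain ⟨s, u, hfin⟩ := key (Fintype.card σ) 0 (by simp)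
  obtain ⟨f, hf⟩ := ((algebraicIndependent_fraction K (Fin e × Option σ)).add_algebraMap
    (fun i => - s i.1 i.2)).exists_fieldHom
  have h2 := hfin.baseChange f.toRingHom
  rw [extIdeal_extIdeal] at h2
  have h3 : f.toRingHom.comp (algebraMap K M) = algebraMap K M := f.comp_algebraMap
  rw [h3] at h2
  refine h2.of_comp ?_
  rintro (i | j)
  · refine ⟨X i, ?_⟩
    simp only [tupleHom_X, extTuple, Sum.elim_inl, map_affineForm, genericTuple]
    congr 1
    funext h
    have := hf (i, h)
    have hs : f (algebraMap K M (s i h)) = algebraMap K M (s i h) := f.commutes _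
    simp only [AlgHom.toRingHom_eq_coe, RingHom.coe_coe, map_add, hz]
    rw [this, hs, map_neg]
    exact (neg_add_cancel_right _ _).symm
  · exact j.elim0

/-- Generic affine-linear forms are finite on a variety if there are enough of them. -/
lemma finiteOn_genericTuple {P : Ideal (MvPolynomial σ K)} {d : ℕ}
    {w : Fin d → MvPolynomial σ K} (hw : FiniteOn w P) (hde : d ≤ e) :
    FiniteOn (genericTuple K e σ) (extIdeal (algebraMap K (GenericField K e σ)) P) := by
  -- A finite `K` is first enlarged to the infinite field `K(t)`; finiteness of the generic tuple
  -- descends afterwards.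
  let F := FractionRing (MvPolynomial Unit K)
  have : Infinite F := Infinite.of_injective _ (IsFractionRing.injective (MvPolynomial Unit K) F)
  have h1 := finiteOn_genericTuple_of_infinite (hw.baseChange (algebraMap K F)) hde
  have h2 := (algebraicIndependent_fraction F (Fin e × Option σ)).restrictScalars
    (R := K) (algebraMap K F).injective
  obtain ⟨f, hf⟩ := h2.exists_fieldHom
  let _ := f.toRingHom.toAlgebra
  refine FiniteOn.descend (L := GenericField F e σ) ?_
  rw [extIdeal_extIdeal] at h1 ⊢
  have h3 : (algebraMap (GenericField K e σ) (GenericField F e σ)).comp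
      (algebraMap K (GenericField K e σ)) = (algebraMap F (GenericField F e σ)).comp
      (algebraMap K F) := by
    rw [← IsScalarTower.algebraMap_eq K F]
    exact f.comp_algebraMap
  rw [h3]
  have h4 : extTuple (algebraMap (GenericField K e σ) (GenericField F e σ)) (genericTuple K e σ) =
      genericTuple F e σ := by
    funext i
    simp only [extTuple, genericTuple, map_affineForm]
    congr 1
    funext h
    exact hf (i, h)
  rw [h4]
  exact h1

end Generic

/-! ### The coefficient ideal of the generic Chow form -/

section ChowContent

variable {K : Type*} [Field K] {σ : Type*} [Fintype σ]

/-- The ideal generated by the coefficients, with respect to the coefficients of `e` generic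
affine-linear forms `U`, of the greatest common divisor of the Fitting elements of `V(P)`
over `U`, evaluated at `U`. -/
def chowContent (e : ℕ) (P : Ideal (MvPolynomial σ K)) : Ideal (MvPolynomial σ K) :=
  Ideal.span (Set.range fun ω : GenericField K e σ →ₗ[K] K =>
    mapCoeff ω (tupleHom (genericTuple K e σ) (fittingGcd (genericTuple K e σ)
      (extIdeal (algebraMap K (GenericField K e σ)) P))))

lemma chowContent_le_iff {e : ℕ} {P I : Ideal (MvPolynomial σ K)} : chowContent e P ≤ I ↔
    tupleHom (genericTuple K e σ) (fittingGcd (genericTuple K e σ)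
      (extIdeal (algebraMap K (GenericField K e σ)) P)) ∈
        extIdeal (algebraMap K (GenericField K e σ)) I := by
  rw [chowContent, Ideal.span_le, Set.range_subset_iff, extIdeal, mem_map_iff_mapCoeff]
  rfl

end ChowContent

/-! ### Chow forms under base change, coordinate change and specialisation -/

section Projection

variable {K : Type*} [Field K] {σ τ : Type*}

/-- There is a common divisor of the Fitting elements of `V(J)` over the tuple `v` whose value at
`v` lies in the extension of `I`. -/
def HasChowForm {L : Type*} [CommRing L] [Algebra K L] (J I : Ideal (MvPolynomial σ K))
    (v : τ → MvPolynomial σ L) : Prop :=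
  ∃ δ, DvdFitting v (extIdeal (algebraMap K L) J) δ ∧
    tupleHom v δ ∈ extIdeal (algebraMap K L) I

lemma HasChowForm.baseChange {k L : Type*} [Field k] [Field L] [Algebra K k] [Algebra K L]
    {J I : Ideal (MvPolynomial σ K)} {v : τ → MvPolynomial σ k} (h : HasChowForm J I v)
    (hfin : FiniteOn v (extIdeal (algebraMap K k) J)) (f : k →ₐ[K] L) :
    HasChowForm J I (extTuple f.toRingHom v) := by
  obtain ⟨δ, h1, h2⟩ := h
  have h3 := h1.baseChange f.toRingHom hfin
  have h4 := Ideal.mem_map_of_mem (map f.toRingHom) h2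
  rw [← tupleHom_map] at h4
  change _ ∈ extIdeal _ (extIdeal _ _) at h4
  rw [extIdeal_extIdeal] at h3 h4
  have h5 : f.toRingHom.comp (algebraMap K k) = algebraMap K L := f.comp_algebraMap
  rw [h5] at h3 h4
  exact ⟨_, h3, h4⟩

/-- A change of coordinates on the target. -/
lemma HasChowForm.of_add_mul {L : Type*} [CommRing L] [Algebra K L]
    {J I : Ideal (MvPolynomial σ K)} {v : τ → MvPolynomial σ L} (i : τ) (c : τ → L) (hc : c i = 0)
    (h : HasChowForm J I fun j => v j + C (c j) * v i) : HasChowForm J I v := by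
  set v' : τ → MvPolynomial σ L := fun j => v j + C (c j) * v i with hv'
  let θ : MvPolynomial τ L →+* MvPolynomial τ L := tupleHom fun j => X j + C (c j) * X i
  let θ' : MvPolynomial τ L →+* MvPolynomial τ L := tupleHom fun j => X j - C (c j) * X i
  have h1 : (tupleHom v).comp θ = tupleHom v' :=
    MvPolynomial.ringHom_ext (by simp [θ]) (by simp [θ, hv'])
  have h2 : θ.comp θ' = RingHom.id _ :=
    MvPolynomial.ringHom_ext (by simp [θ, θ']) (by simp [θ, θ', hc])
  have h1' : ∀ p, tupleHom v (θ p) = tupleHom v' p := RingHom.congr_fun h1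
  have h2' : ∀ p, θ (θ' p) = p := RingHom.congr_fun h2
  obtain ⟨δ, hδ, hδI⟩ := h
  refine ⟨θ δ, fun g hg => ?_, by rwa [h1']⟩
  have h3 : IsFittingElem (tupleHom v') (extIdeal (algebraMap K L) J) (θ' g) :=
    hg.map θ' (RingHom.id _) (fun s => by rw [← h1', h2']; rfl) (fun x hx => hx) fun x =>
      ⟨1, fun _ => 1, fun _ => x, by simp⟩
  simpa only [h2'] using map_dvd θ (hδ _ h3)

lemma exists_clear_denominators {Λ : Type*} [CommRing Λ] [IsDomain Λ] {L : Type*} [Field L]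
    [Algebra Λ L] [IsFractionRing Λ L] (q : MvPolynomial τ L) : ∃ (q₀ : MvPolynomial τ Λ) (c : Λ),
      c ≠ 0 ∧ map (algebraMap Λ L) q₀ = q * C (algebraMap Λ L c) := by
  let _ : Algebra (MvPolynomial τ Λ) (MvPolynomial τ L) := algebraMvPolynomial
  obtain ⟨⟨q₀, ⟨_, c, hc, rfl⟩⟩, hq₀⟩ := IsLocalization.surj
    ((nonZeroDivisors Λ).map (C (σ := τ))) q
  refine ⟨q₀, c, nonZeroDivisors.ne_zero hc, ?_⟩
  have h : ∀ p : MvPolynomial τ Λ, algebraMap _ (MvPolynomial τ L) p = map (algebraMap Λ L) p :=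
    fun p => by rw [algebraMap_def]
  rw [← map_C, ← h, ← h]
  exact hq₀.symm

lemma dvd_C_mul_of_dvd_map {Λ : Type*} [CommRing Λ] [IsDomain Λ] {L : Type*} [Field L] [Algebra Λ L]
    [IsFractionRing Λ L] {δ₀ a : MvPolynomial τ Λ} {δ : MvPolynomial τ L} {c : Λ} (hc : c ≠ 0)
    (hδ₀ : map (algebraMap Λ L) δ₀ = δ * C (algebraMap Λ L c))
    (h : δ ∣ map (algebraMap Λ L) a) : ∃ s : Λ, s ≠ 0 ∧ δ₀ ∣ C s * a := by
  obtain ⟨q, hq⟩ := h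
  obtain ⟨q₀, b, hb, hq₀⟩ := exists_clear_denominators (Λ := Λ) q
  refine ⟨b * c, mul_ne_zero hb hc, q₀, ?_⟩
  apply map_injective _ (IsFractionRing.injective Λ L)
  rw [map_mul, map_C, hq, map_mul (map (algebraMap Λ L)), hδ₀, hq₀, map_mul, C_mul]
  ring

/-- Specialisation of auxiliary variables to zero. -/
lemma HasChowForm.specialize [Finite τ] {L : Type*} [Field L] [Algebra K L] {ι : Type*} [Finite ι]
    {J I : Ideal (MvPolynomial σ K)} {v : τ → MvPolynomial σ (MvPolynomial ι L)}
    (hfin : FiniteOn v (extIdeal (algebraMap K (MvPolynomial ι L)) J))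
    (h : HasChowForm J I (extTuple (algebraMap (MvPolynomial ι L)
      (FractionRing (MvPolynomial ι L))) v)) :
    HasChowForm J I (extTuple (constantCoeff : MvPolynomial ι L →+* L) v) := by
  set Λ := MvPolynomial ι L
  set L' := FractionRing Λ
  obtain ⟨δ, hδ, hδI⟩ := h
  have hext : ∀ J : Ideal (MvPolynomial σ K), extIdeal (algebraMap Λ L')
      (extIdeal (algebraMap K Λ) J) = extIdeal (algebraMap K L') J := fun J => by
    rw [extIdeal_extIdeal, ← IsScalarTower.algebraMap_eq]
  set g := fittingGcd v (extIdeal (algebraMap K Λ) J) with hg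
  -- The divisor over the fraction field is compared with the greatest common divisor `g` over the
  -- factorial ring `Λ`. Divisibility of each Fitting element over `L'` costs a nonzero constant of
  -- `Λ`, and finitely many elements determine `g`, so one common constant suffices.
  have hδg : δ ∣ map (algebraMap Λ L') g := by
    obtain ⟨δ₀, c, hc0, hδ₀'⟩ := exists_clear_denominators (Λ := Λ) δ
    obtain ⟨F, hF1, hF2⟩ := fittingGcd_spec v (extIdeal (algebraMap K Λ) J)
    have hs : ∀ a ∈ F, ∃ s : Λ, s ≠ 0 ∧ δ₀ ∣ C s * a := fun a ha => by
      refine dvd_C_mul_of_dvd_map hc0 hδ₀' (hδ _ ?_)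
      have := (hF1 a ha).baseChange (algebraMap Λ L')
      rwa [hext] at this
    choose! s hs0 hs using hs
    have h1 : δ₀ ∣ C (∏ a ∈ F, s a) * g := hF2 _ _ fun a ha => by
      refine (hs a ha).trans (mul_dvd_mul_right (map_dvd _ (Finset.dvd_prod_of_mem _ ha)) _)
    have h2 := map_dvd (map (algebraMap Λ L')) h1
    rw [hδ₀', map_mul, map_C] at h2
    refine (Dvd.intro _ rfl).trans (h2.trans ?_)
    have hu : IsUnit (C (algebraMap Λ L' (∏ a ∈ F, s a)) : MvPolynomial τ L') := by
      refine (IsUnit.mk0 _ ?_).map C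
      rw [Ne, IsFractionRing.to_map_eq_zero_iff]
      exact Finset.prod_ne_zero_iff.2 hs0
    exact (hu.mul_left_dvd).2 dvd_rfl
  have hgI : tupleHom v g ∈ extIdeal (algebraMap K Λ) I := by
    refine mem_map_of_map_mem_map (IsScalarTower.toAlgHom K Λ L') (IsFractionRing.injective Λ L') ?_
    change map (algebraMap Λ L') (tupleHom v g) ∈ _
    rw [← tupleHom_map]
    obtain ⟨q, hq⟩ := hδg
    rw [hq, map_mul]
    exact Ideal.mul_mem_right _ _ hδI
  have hcc : (constantCoeff : Λ →+* L).comp (algebraMap K Λ) = algebraMap K L := by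
    ext a
    rw [RingHom.comp_apply, IsScalarTower.algebraMap_apply K L Λ]
    exact constantCoeff_C _ _
  refine ⟨map constantCoeff g, fun a ha => ?_, ?_⟩
  · obtain ⟨n, t, ht⟩ := hfin
    have hsurj : Function.Surjective (constantCoeff : Λ →+* L) := fun x => ⟨C x, by simp⟩
    have hk : ∀ x : MvPolynomial σ Λ, map (constantCoeff : Λ →+* L) x ∈ extIdeal (algebraMap K L) J →
        x ∈ extIdeal (algebraMap K Λ) J ⊔ (RingHom.ker (map (constantCoeff : Λ →+* L) :
          MvPolynomial τ Λ →+* _)).map (tupleHom v) := by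
      intro x hx
      have h1 : map C (map (constantCoeff : Λ →+* L) x) ∈ extIdeal (algebraMap K Λ) J := by
        have := Ideal.mem_map_of_mem (map (C : L →+* Λ)) hx
        change _ ∈ extIdeal _ (extIdeal _ _) at this
        rw [extIdeal_extIdeal] at this
        rwa [IsScalarTower.algebraMap_eq K L Λ]
      have h2 : x - map C (map (constantCoeff : Λ →+* L) x) ∈
          RingHom.ker (map (constantCoeff : Λ →+* L) : MvPolynomial σ Λ →+* _) := by
        rw [RingHom.mem_ker, map_sub, map_map]
        have : (constantCoeff : Λ →+* L).comp C = RingHom.id L := by ext; simp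
        rw [this, map_id, sub_self]
      rw [ker_map] at h2
      have h3 : (RingHom.ker (constantCoeff : Λ →+* L)).map (C : Λ →+* MvPolynomial σ Λ) ≤
          (RingHom.ker (map (constantCoeff : Λ →+* L) : MvPolynomial τ Λ →+* _)).map
            (tupleHom v) := by
        rw [Ideal.map_le_iff_le_comap]
        intro s hs
        rw [Ideal.mem_comap, ← tupleHom_C v]
        refine Ideal.mem_map_of_mem _ ?_
        rw [RingHom.mem_ker] at hs ⊢
        rw [map_C, hs, C_0]
      have := Submodule.add_mem_sup h1 (h3 h2)
      simpa using this
    -- Fitting elements at the special point lift to Fitting elements over `Λ`, where `g` divides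
    -- them. This is where finiteness over `Λ`, and not only over its fraction field, enters.
    obtain ⟨b, hb, rfl⟩ := IsFittingElem.exists_lift (map (constantCoeff : Λ →+* L))
      (map (constantCoeff : Λ →+* L)) (map_surjective _ hsurj) (map_surjective _ hsurj)
      (fun p => by rw [tupleHom_map, sub_self]; exact Ideal.zero_mem _) hk t ht ha
    exact map_dvd _ (dvdFitting_fittingGcd _ _ _ hb)
  · rw [tupleHom_map]
    have := Ideal.mem_map_of_mem (map (constantCoeff : Λ →+* L)) hgI
    change _ ∈ extIdeal _ (extIdeal _ _) at this
    rwa [extIdeal_extIdeal, hcc] at this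

end Projection

/-! ### From the generic tuple to arbitrary finite tuples -/

section Chain

universe u

variable {K : Type u} [Field K] {σ : Type} [Fintype σ]

lemma hasChowForm_genericTuple (e : ℕ) (P : Ideal (MvPolynomial σ K)) :
    HasChowForm P (chowContent e P) (genericTuple K e σ) :=
  ⟨_, dvdFitting_fittingGcd _ _, chowContent_le_iff.1 le_rfl⟩

/-- Chow forms exist for tuples of affine-linear forms some of which are generic. -/
lemma hasChowForm_of_partially_generic {P : Ideal (MvPolynomial σ K)} {d e : ℕ}
    {w : Fin d → MvPolynomial σ K} (hw : FiniteOn w P) (hde : d < e) (N : ℕ) :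
    ∀ (L L0 : Type u) [Field L] [Field L0] [Infinite L0] [Algebra K L0] [Algebra K L]
      [Algebra L0 L] [IsScalarTower K L0 L] (a : Fin e → Option σ → L) (G : Finset (Fin e)),
      Gᶜ.card = N →
      AlgebraicIndependent L0 (fun p : {p : Fin e × Option σ // p.1 ∈ G} => a p.1.1 p.1.2) →
      (∀ i ∉ G, ∀ h, a i h ∈ Set.range (algebraMap L0 L)) →
      FiniteOn (fun i => affineForm (a i)) (extIdeal (algebraMap K L) P) →
      HasChowForm P (chowContent e P) (fun i => affineForm (a i)) := by
  classical
  induction N with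
  | zero =>
    intro L L0 _ _ _ _ _ _ _ a G hG ha _ _
    have hG' : ∀ i, i ∈ G := fun i => by
      rw [Finset.card_eq_zero] at hG
      simpa using Finset.ext_iff.1 hG i
    have h1 := (ha.restrictScalars (R := K) (algebraMap K L0).injective).comp
      (fun p : Fin e × Option σ => (⟨p, hG' p.1⟩ : {p : Fin e × Option σ // p.1 ∈ G}))
      (fun p q h => by simpa using h)
    obtain ⟨f, hf⟩ := h1.exists_fieldHom
    have h2 := (hasChowForm_genericTuple e P).baseChange (finiteOn_genericTuple hw hde.le) f
    convert h2 using 1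
    funext i
    simp only [extTuple, genericTuple, map_affineForm]
    congr 1
    funext h
    exact (hf (i, h)).symm
  | succ N ih =>
    intro L L0 _ _ _ _ _ _ _ a G hG ha haG hfin
    obtain ⟨i, hi⟩ : Gᶜ.Nonempty := Finset.card_pos.1 (by omega)
    have hiG : i ∉ G := by simpa using hi
    -- The `e > d` forms are related, so after a coordinate change the forms other than the `i`-th
    -- are already finite. Therefore the `i`-th one may be deformed to a generic form without losing
    -- finiteness, and the original tuple is recovered by specialisation.
    obtain ⟨E, hE0, hE⟩ := (hw.baseChange (algebraMap K L)).exists_relation (τ := Fin e)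
      (by simpa using hde) (fun i => affineForm (a i))
    obtain ⟨c, hc, hfin'⟩ := hfin.exists_drop (L0 := L0) hE0 hE i
    -- Dropping would use `c i = -1`; the value `0` keeps the `i`-th form in place, so that the
    -- coordinate change is invertible.
    let c' : Fin e → L0 := Function.update c i 0
    let a' : Fin e → Option σ → L := fun j h => a j h + algebraMap L0 L (c' j) * a i h
    refine HasChowForm.of_add_mul i (fun j => algebraMap L0 L (c' j)) (by simp [c']) ?_
    simp only [affineForm_add_mul]
    change HasChowForm P _ fun j => affineForm (a' j)
    choose b hb using haG i hiG
    let Λ := MvPolynomial (Option σ) L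
    let L' := FractionRing Λ
    let aΛ : Fin e → Option σ → Λ := fun j h => C (a' j h) + if j = i then X h else 0
    have hspec : (extTuple (constantCoeff : Λ →+* L) fun j => affineForm (aΛ j)) =
        fun j => affineForm (a' j) := by
      funext j
      simp only [extTuple, map_affineForm]
      congr 1
      funext h
      by_cases hj : j = i <;> simp [aΛ, hj]
    rw [← hspec]
    refine HasChowForm.specialize ?_ ?_
    · have h1 := hfin'.baseChange (C : L →+* Λ)
      rw [extIdeal_extIdeal] at h1
      refine FiniteOn.of_comp (v := extTuple (C : L →+* Λ) (fun j => affineForm (a j) +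
        C (algebraMap L0 L (c j)) * affineForm (a i))) (by
          rw [IsScalarTower.algebraMap_eq K L Λ]; exact h1) fun j => ?_
      by_cases hj : j = i
      · subst hj
        exact ⟨0, by simp [hc]⟩
      · refine ⟨X j, ?_⟩
        simp only [tupleHom_X, extTuple, affineForm_add_mul, map_affineForm]
        congr 1
        funext h
        simp [aΛ, a', c', hj]
    · have h2 : (extTuple (algebraMap Λ L') fun j => affineForm (aΛ j)) =
          fun j => affineForm fun h => algebraMap Λ L' (aΛ j h) := by
        funext j
        simp only [extTuple, map_affineForm]
      change HasChowForm P _ (extTuple (algebraMap Λ L') fun j => affineForm (aΛ j))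
      rw [h2]
      refine ih L' L0 _ (insert i G) ?_ ?_ ?_ ?_
      · rw [Finset.compl_insert, Finset.card_erase_of_mem hi, hG]
        rfl
      -- The new coefficients differ from independent ones only by elements of `L0`, because the
      -- `i`-th form and the constants `c'` have their coefficients there.
      · have h3 := (ha.add_algebraMap fun p => c' p.1.1 * b p.1.2).sumElim_comp
          (algebraicIndependent_fraction L (Option σ))
        have h4 := h3.add_algebraMap (Sum.elim b 0)
        let g : {p : Fin e × Option σ // p.1 ∈ insert i G} →
            Option σ ⊕ {p : Fin e × Option σ // p.1 ∈ G} := fun p =>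
          if h : p.1.1 = i then Sum.inl p.1.2 else
            Sum.inr ⟨p.1, (Finset.mem_insert.1 p.2).resolve_left h⟩
        have hg : Function.Injective g := by
          rintro ⟨⟨j, h⟩, hp⟩ ⟨⟨j', h'⟩, hp'⟩ hpp
          by_cases h1 : j = i <;> by_cases h2 : j' = i <;> simp [g, h1, h2] at hpp ⊢
          · exact hpp
          · exact hpp
        have h5 := h4.comp g hg
        have hL0 : ∀ x : L0, algebraMap L0 L' x = algebraMap Λ L' (C (algebraMap L0 L x)) :=
          fun x => by
            rw [IsScalarTower.algebraMap_apply L0 Λ L', IsScalarTower.algebraMap_apply L0 L Λ]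
            rfl
        have h6 : (fun p : {p : Fin e × Option σ // p.1 ∈ insert i G} =>
            algebraMap Λ L' (aΛ p.1.1 p.1.2)) = fun p => Sum.elim (fun h => algebraMap Λ L' (X h))
              (fun q : {p : Fin e × Option σ // p.1 ∈ G} => algebraMap L L' (a q.1.1 q.1.2 +
                algebraMap L0 L (c' q.1.1 * b q.1.2))) (g p) +
            algebraMap L0 L' (Sum.elim b 0 (g p)) := by
          funext ⟨⟨j, h⟩, hp⟩
          by_cases hj : j = i
          · subst hj
            simp only [aΛ, a', c', g, dif_pos, Sum.elim_inl, hL0, hb,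
              Function.update_self, map_zero, zero_mul, add_zero, if_true, map_add]
            exact add_comm _ _
          · simp only [aΛ, a', g, hj, if_false, dif_neg, not_false_iff,
              Sum.elim_inr, Pi.zero_apply, map_zero, add_zero, map_mul, hb]
            rfl
        rw [h6]
        exact h5
      · intro j hj h
        rw [Finset.mem_insert, not_or] at hj
        obtain ⟨x, hx⟩ := haG j hj.2 h
        refine ⟨x + c' j * b h, ?_⟩
        rw [IsScalarTower.algebraMap_apply L0 Λ L', IsScalarTower.algebraMap_apply L0 L Λ, map_add,
          map_mul, hx, hb]
        simp only [aΛ, a', hj.1, if_false, add_zero]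
        rfl
      · have h1 := hfin'.baseChange (algebraMap L L')
        rw [extIdeal_extIdeal, ← IsScalarTower.algebraMap_eq] at h1
        refine FiniteOn.of_comp h1 fun j => ?_
        by_cases hj : j = i
        · subst hj
          exact ⟨0, by simp [hc]⟩
        · refine ⟨X j, ?_⟩
          simp only [tupleHom_X, extTuple, affineForm_add_mul, map_affineForm]
          congr 1
          funext h
          simp [aΛ, a', c', hj]
          rfl

/-- Chow forms exist for every finite tuple of affine-linear forms. -/
theorem hasChowForm_affineForm {P : Ideal (MvPolynomial σ K)} {d e : ℕ}
    {w : Fin d → MvPolynomial σ K} (hw : FiniteOn w P) (hde : d < e) {L : Type u} [Field L]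
    [Algebra K L] (a : Fin e → Option σ → L)
    (hfin : FiniteOn (fun i => affineForm (a i)) (extIdeal (algebraMap K L) P)) :
    HasChowForm P (chowContent e P) (fun i => affineForm (a i)) := by
  -- An auxiliary variable, later specialised to zero, provides an infinite field. The induction
  -- starts over it with no generic form at all and with `L0` equal to the whole field.
  let Λ := MvPolynomial Unit L
  let L' := FractionRing Λ
  have : Infinite L' := Infinite.of_injective _ (IsFractionRing.injective Λ L')
  have h0 : (extTuple (constantCoeff : Λ →+* L) (extTuple C fun i => affineForm (a i))) =
      fun i => affineForm (a i) := by
    funext j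
    simp only [extTuple, map_affineForm, constantCoeff_C]
  rw [← h0]
  refine HasChowForm.specialize ?_ ?_
  · have h1 := hfin.baseChange (C : L →+* Λ)
    rw [extIdeal_extIdeal] at h1
    rw [IsScalarTower.algebraMap_eq K L Λ]
    exact h1
  · have h2 : (extTuple (algebraMap Λ L') (extTuple C fun i => affineForm (a i))) =
        fun i => affineForm fun h => algebraMap L L' (a i h) := by
      funext j
      simp only [extTuple, map_affineForm]
      rfl
    change HasChowForm P _ (extTuple (algebraMap Λ L') (extTuple C fun i => affineForm (a i)))
    rw [h2]
    refine hasChowForm_of_partially_generic hw hde _ L' L' _ ∅ rfl ?_ (fun i _ h => ⟨_, rfl⟩) ?_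
    · have : IsEmpty {p : Fin e × Option σ // p.1 ∈ (∅ : Finset (Fin e))} := ⟨fun p => by simpa using p.2⟩
      exact algebraicIndependent_empty_type
    · have h1 := hfin.baseChange (algebraMap L L')
      rw [extIdeal_extIdeal, ← IsScalarTower.algebraMap_eq] at h1
      have h3 : (extTuple (algebraMap L L') fun i => affineForm (a i)) =
          fun i => affineForm fun h => algebraMap L L' (a i h) := by
        funext j
        simp only [extTuple, map_affineForm]
      rw [h3] at h1
      exact h1

end Chain

/-! ### Prime ideals under purely transcendental extensions -/

section Prime

variable {K : Type*} [Field K] {σ ι : Type*}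

lemma commAlgEquiv_map_C (p : MvPolynomial σ K) :
    commAlgEquiv K σ ι (map C p) = C p := by
  induction p using MvPolynomial.induction_on with
  | C a => rw [map_C, commAlgEquiv_C, map_C]
  | add p q hp hq => simp only [map_add, hp, hq]
  | mul_X p i hp => simp only [map_mul, hp, map_X, commAlgEquiv_X]

lemma exists_commRingEquiv (K : Type*) [Field K] (σ ι : Type*) :
    ∃ e : MvPolynomial σ (MvPolynomial ι K) ≃+* MvPolynomial ι (MvPolynomial σ K),
      (∀ p, e (map C p) = C p) ∧ ∀ p, e (C p) = map C p :=
  ⟨(commAlgEquiv K σ ι).toRingEquiv, commAlgEquiv_map_C, commAlgEquiv_C⟩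

lemma Ideal.comap_map_eq_map {A B D : Type*} [CommRing A] [CommRing B] [CommRing D] (e : B ≃+* D)
    {f : A →+* B} {g : A →+* D} (h : ∀ a, e (f a) = g a) (P : Ideal A) :
    (P.map g).comap e = P.map f := by
  have h1 : (e : B →+* D).comp f = g := RingHom.ext h
  rw [← h1, ← Ideal.map_map]
  exact Ideal.comap_map_of_bijective _ e.bijective

lemma mem_extIdeal_mvPolynomial_iff {e : MvPolynomial σ (MvPolynomial ι K) ≃+*
      MvPolynomial ι (MvPolynomial σ K)} (he : ∀ p, e (map C p) = C p)
    {P : Ideal (MvPolynomial σ K)} {x : MvPolynomial σ (MvPolynomial ι K)} :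
    x ∈ extIdeal (algebraMap K (MvPolynomial ι K)) P ↔
      e x ∈ P.map (C : _ →+* MvPolynomial ι (MvPolynomial σ K)) := by
  have h := Ideal.comap_map_eq_map e he P
  exact (SetLike.ext_iff.1 h x).symm

instance isPrime_extIdeal_mvPolynomial (P : Ideal (MvPolynomial σ K)) [hP : P.IsPrime] :
    (extIdeal (algebraMap K (MvPolynomial ι K)) P).IsPrime := by
  have : (P.map (C : _ →+* MvPolynomial ι (MvPolynomial σ K))).IsPrime := by
    have h1 : P.map (C : _ →+* MvPolynomial ι (MvPolynomial σ K)) =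
        RingHom.ker (map (σ := ι) (Ideal.Quotient.mk P)) := by
      rw [ker_map, Ideal.mk_ker]
    rw [h1]
    exact RingHom.ker_isPrime _
  obtain ⟨e, he, -⟩ := exists_commRingEquiv K σ ι
  have h := Ideal.comap_map_eq_map e he P
  change (P.map (map (C : K →+* MvPolynomial ι K))).IsPrime
  rw [← h]
  exact Ideal.comap_isPrime _ _

/-- Prime ideals remain prime in purely transcendental extensions of the base field. -/
lemma isPrime_extIdeal_of_isFractionRing {L : Type*} [Field L] [Algebra K L]
    [Algebra (MvPolynomial ι K) L] [IsScalarTower K (MvPolynomial ι K) L]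
    [IsFractionRing (MvPolynomial ι K) L] (P : Ideal (MvPolynomial σ K)) [hP : P.IsPrime] :
    (extIdeal (algebraMap K L) P).IsPrime := by
  set Λ := MvPolynomial ι K
  have hΛ : ∀ p : MvPolynomial σ Λ, map (algebraMap Λ L) p ∈ extIdeal (algebraMap K L) P →
      p ∈ extIdeal (algebraMap K Λ) P := fun p hp =>
    mem_map_of_map_mem_map (IsScalarTower.toAlgHom K Λ L) (IsFractionRing.injective Λ L) hp
  have hext : extIdeal (algebraMap Λ L) (extIdeal (algebraMap K Λ) P) =
      extIdeal (algebraMap K L) P := by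
    rw [extIdeal_extIdeal, ← IsScalarTower.algebraMap_eq]
  have hunit : ∀ c : Λ, c ≠ 0 → IsUnit (C (algebraMap Λ L c) : MvPolynomial σ L) := fun c hc =>
    (IsUnit.mk0 _ (by rwa [Ne, IsFractionRing.to_map_eq_zero_iff])).map C
  refine ⟨fun h => hP.ne_top ?_, fun {f g} hfg => ?_⟩
  · rw [Ideal.eq_top_iff_one, ← map_mem_map_iff (L := L), map_one]
    exact (Ideal.eq_top_iff_one _).1 h
  · obtain ⟨f₀, b, hb, hf⟩ := exists_clear_denominators (Λ := Λ) f
    obtain ⟨g₀, c, hc, hg⟩ := exists_clear_denominators (Λ := Λ) g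
    have h1 : f₀ * g₀ ∈ extIdeal (algebraMap K Λ) P := by
      apply hΛ
      rw [map_mul, hf, hg, mul_mul_mul_comm]
      exact Ideal.mul_mem_right _ _ hfg
    have key : ∀ (f : MvPolynomial σ L) (f₀ : MvPolynomial σ Λ) (b : Λ), b ≠ 0 →
        map (algebraMap Λ L) f₀ = f * C (algebraMap Λ L b) → f₀ ∈ extIdeal (algebraMap K Λ) P →
        f ∈ extIdeal (algebraMap K L) P := fun f f₀ b hb hf hf₀ => by
      rw [← Ideal.mul_unit_mem_iff_mem _ (hunit b hb), ← hf, ← hext]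
      exact Ideal.mem_map_of_mem _ hf₀
    exact (Ideal.IsPrime.mem_or_mem inferInstance h1).imp (key f f₀ b hb hf) (key g g₀ c hc hg)

end Prime

/-! ### Bounds for the Chow content -/

section Bounds

universe u

variable {K : Type u} [Field K] {σ : Type} [Fintype σ]

lemma ringKrullDim_eq_quotient_ker {A B : Type*} [CommRing A] [CommRing B] (φ : A →+* B)
    (h : φ.IsIntegral) : ringKrullDim B = ringKrullDim (A ⧸ RingHom.ker φ) := by
  refine ringKrullDim_eq_of_isIntegral (Ideal.Quotient.lift (RingHom.ker φ) φ fun _ h => h) ?_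
    (RingHom.lift_injective_of_ker_le_ideal _ _ le_rfl)
  refine RingHom.IsIntegral.tower_top (Ideal.Quotient.mk (RingHom.ker φ)) _ ?_
  exact h

lemma ringKrullDim_extIdeal {L : Type*} [Field L] [Algebra K L] {P : Ideal (MvPolynomial σ K)}
    [P.IsPrime] {d : ℕ} (hd : ringKrullDim (MvPolynomial σ K ⧸ P) = d) :
    ringKrullDim (MvPolynomial σ L ⧸ extIdeal (algebraMap K L) P) = d := by
  obtain ⟨w, hw, hw0⟩ := exists_parameters hd
  have h : ringKrullDim (MvPolynomial σ L ⧸ extIdeal (algebraMap K L) P) =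
      ringKrullDim (MvPolynomial (Fin d) L) := by
    refine ringKrullDim_eq_of_isIntegral _
      ((finiteOn_iff _ _).1 (hw.baseChange (algebraMap K L))) ?_
    rw [injective_iff_map_eq_zero]
    intro p hp
    rw [RingHom.comp_apply, Ideal.Quotient.eq_zero_iff_mem] at hp
    exact eq_zero_of_tupleHom_map_mem hw0 p hp
  rw [h, MvPolynomial.ringKrullDim_of_isNoetherianRing, ringKrullDim_eq_zero_of_field]
  simp

/-- The image of a variety under a finite morphism to an affine space of one dimension more is a
hypersurface. -/
lemma FiniteOn.exists_prime_dvd_iff {P : Ideal (MvPolynomial σ K)} [P.IsPrime] {d : ℕ}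
    (hd : ringKrullDim (MvPolynomial σ K ⧸ P) = d) {v : Fin (d + 1) → MvPolynomial σ K}
    (hv : FiniteOn v P) : ∃ E, Prime E ∧ ∀ p, tupleHom v p ∈ P ↔ E ∣ p := by
  obtain ⟨w, hw, -⟩ := exists_parameters hd
  let φ : MvPolynomial (Fin (d + 1)) K →+* MvPolynomial σ K ⧸ P :=
    (Ideal.Quotient.mk P).comp (tupleHom v)
  let q := RingHom.ker φ
  have hmem : ∀ p, p ∈ q ↔ tupleHom v p ∈ P := fun p => by
    rw [RingHom.mem_ker, RingHom.comp_apply, Ideal.Quotient.eq_zero_iff_mem]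
  have hq : q.IsPrime := RingHom.ker_isPrime _
  obtain ⟨E₀, hE₀, hE₀m⟩ := hw.exists_relation (τ := Fin (d + 1)) (by simp) v
  obtain ⟨E, hEq, hE⟩ := hq.exists_mem_prime_of_ne_bot
    (fun h => hE₀ (by simpa [h] using (hmem E₀).2 hE₀m))
  refine ⟨E, hE, fun p => ⟨fun hp => ?_, ?_⟩⟩
  -- Otherwise `0 < (E) < q` is a chain of primes in a ring of dimension `d + 1`, although its
  -- quotient by `q` has dimension `d`.
  · by_contra hpE
    have hEp : (Ideal.span {E}).IsPrime := (Ideal.span_singleton_prime hE.ne_zero).2 hE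
    have hle : Ideal.span {E} ≤ q := (Ideal.span_singleton_le_iff_mem _).2 hEq
    have h1 := ringKrullDim_quotient_succ_le_of_nonZeroDivisor
      (mem_nonZeroDivisors_of_ne_zero hE.ne_zero)
    have h2 := ringKrullDim_quotient_succ_le_of_lt (hle.lt_of_not_ge fun h =>
      hpE (Ideal.mem_span_singleton.1 (h ((hmem p).2 hp))))
    have h3 : ringKrullDim (MvPolynomial σ K ⧸ P) =
        ringKrullDim (MvPolynomial (Fin (d + 1)) K ⧸ q) :=
      ringKrullDim_eq_quotient_ker φ ((finiteOn_iff _ _).1 hv)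
    rw [MvPolynomial.ringKrullDim_of_isNoetherianRing, ringKrullDim_eq_zero_of_field] at h1
    rw [← h3, hd] at h2
    have h5 := (add_le_add_left h2 1).trans h1
    simp only [Nat.card_fin, zero_add] at h5
    have : d + 1 + 1 ≤ d + 1 := by exact_mod_cast h5
    omega
  · rintro ⟨c, rfl⟩
    rw [map_mul]
    exact P.mul_mem_right _ ((hmem E).1 hEq)

/-- The generic Chow form vanishes on the variety. -/
lemma chowContent_le {P : Ideal (MvPolynomial σ K)} [P.IsPrime] {d : ℕ}
    (hd : ringKrullDim (MvPolynomial σ K ⧸ P) = d) : chowContent (d + 1) P ≤ P := by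
  obtain ⟨w, hw, -⟩ := exists_parameters hd
  rw [chowContent_le_iff]
  have := isPrime_extIdeal_of_isFractionRing (L := GenericField K (d + 1) σ)
    (ι := Fin (d + 1) × Option σ) P
  obtain ⟨E, -, hE⟩ := (finiteOn_genericTuple hw (Nat.le_succ d)).exists_prime_dvd_iff
    (ringKrullDim_extIdeal hd)
  -- Fitting elements annihilate the coordinate ring, so they vanish on the image hypersurface and
  -- are divisible by its equation `E`.
  have h : E ∣ 1 * fittingGcd (genericTuple K (d + 1) σ)
      (extIdeal (algebraMap K (GenericField K (d + 1) σ)) P) := dvd_mul_fittingGcd fun a ha => by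
    rw [one_mul, ← hE]
    simpa using ha.mul_mem 1
  rwa [one_mul, ← hE] at h

lemma not_dvd_of_degreeOf {R τ : Type*} [CommRing R] [IsDomain R] {p h : MvPolynomial τ R} {i : τ}
    (hp : i ∈ p.vars) (hh : i ∉ h.vars) (h0 : h ≠ 0) : ¬ p ∣ h := by
  classical
  rintro ⟨q, rfl⟩
  have hp0 := left_ne_zero_of_mul h0
  have hq0 := right_ne_zero_of_mul h0
  rw [mem_vars_iff_degreeOf_ne_zero] at hp hh
  rw [degreeOf_mul_eq hp0 hq0] at hh
  omega

/-- The variety of a prime ideal of too small dimension has no Chow form. -/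
lemma chowContent_eq_top {P : Ideal (MvPolynomial σ K)} {d e : ℕ}
    {w : Fin d → MvPolynomial σ K} (hw : FiniteOn w P) (hde : d + 1 < e) :
    chowContent e P = ⊤ := by
  classical
  set G := GenericField K e σ with hG
  set U := genericTuple K e σ with hUdef
  set PG := extIdeal (algebraMap K G) P with hPG
  have hwG := hw.baseChange (algebraMap K G)
  obtain ⟨b, t, ht⟩ : FiniteOn U PG := finiteOn_genericTuple hw (by omega)
  -- Omitting any one form leaves `e - 1 > d` of them, which still satisfy a relation. A power of it
  -- is a Fitting element free of the variable `i`. A divisor of such elements for all `i` involves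
  -- no variable, so the greatest common divisor is a unit.
  have key : ∀ i : Fin e, ∃ h : MvPolynomial (Fin e) G, h ≠ 0 ∧ i ∉ h.vars ∧ fittingGcd U PG ∣ h ^ b := by
    intro i
    obtain ⟨E, hE0, hE⟩ := hwG.exists_relation (τ := {j : Fin e // j ≠ i})
      (by simp; omega) (fun j => U j)
    refine ⟨rename Subtype.val E, ?_, ?_, ?_⟩
    · rw [Ne, ← map_zero (rename Subtype.val), (rename_injective _ Subtype.val_injective).eq_iff]
      exact hE0
    · intro hi
      have := vars_rename Subtype.val E hi
      simp at this
    · refine dvdFitting_fittingGcd _ _ _ ?_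
      have h1 : tupleHom U (rename Subtype.val E) ∈ PG := by
        rw [tupleHom_apply, aeval_rename]
        exact hE
      simpa using ht.isFittingElem_pow h1
  have hunit : IsUnit (fittingGcd U PG) := by
    by_contra hu
    obtain ⟨h, h0, -, hh⟩ := key ⟨0, by omega⟩
    have hg0 : fittingGcd U PG ≠ 0 := fun h' => by
      rw [h', zero_dvd_iff] at hh
      exact pow_ne_zero _ h0 hh
    obtain ⟨p, hp, hpg⟩ := WfDvdMonoid.exists_irreducible_factor hu hg0
    have hp' := UniqueFactorizationMonoid.irreducible_iff_prime.1 hp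
    by_cases hv : p.vars.Nonempty
    · obtain ⟨i, hi⟩ := hv
      obtain ⟨h, h0, hih, hh⟩ := key i
      exact not_dvd_of_degreeOf hi hih h0 (hp'.dvd_of_dvd_pow (hpg.trans hh))
    · rw [Finset.not_nonempty_iff_eq_empty, vars_eq_empty_iff_eq_C] at hv
      refine hp.not_isUnit ?_
      rw [hv]
      refine (IsUnit.mk0 _ fun h => hp.ne_zero ?_).map C
      rw [hv, h, C_0]
  have h1 := chowContent_le_iff.1 (le_refl (chowContent e P))
  have h2 := Ideal.eq_top_of_isUnit_mem _ h1 (hunit.map _)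
  rw [Ideal.eq_top_iff_one] at h2 ⊢
  rw [← map_mem_map_iff (L := G), map_one]
  exact h2

end Bounds

/-! ### Prime filtrations and multiplicities -/

section PrimeFiltration

variable {A : Type*} [CommRing A]

/-- A filtration of `A ⧸ J` with successive quotients `A ⧸ Q`, where `Q` runs through a list of
prime ideals. -/
inductive IsPrimeFiltration : Ideal A → List (PrimeSpectrum A) → Prop
  | nil : IsPrimeFiltration ⊤ []
  | cons {J : Ideal A} {a : A} {Q : PrimeSpectrum A} {l : List (PrimeSpectrum A)}
      (h : ∀ x, x ∈ Q.asIdeal ↔ a * x ∈ J) (hl : IsPrimeFiltration (J ⊔ Ideal.span {a}) l) :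
      IsPrimeFiltration J (Q :: l)

lemma exists_isPrimeFiltration [IsNoetherianRing A] (J : Ideal A) :
    ∃ l, IsPrimeFiltration J l := by
  induction J using IsNoetherian.induction with
  | hgt J ih =>
    by_cases hJ : J = ⊤
    · exact ⟨[], hJ ▸ .nil⟩
    have : Nontrivial (A ⧸ J) := Ideal.Quotient.nontrivial_iff.2 hJ
    obtain ⟨Q, hQ⟩ := associatedPrimes.nonempty A (A ⧸ J)
    obtain ⟨hQp, x, hx⟩ := isAssociatedPrime_iff.1 hQ
    obtain ⟨a, rfl⟩ := Ideal.Quotient.mk_surjective x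
    have h : ∀ x, x ∈ Q ↔ a * x ∈ J := fun x => by
      rw [hx, Submodule.mem_colon_singleton, Submodule.mem_bot, mul_comm a x,
        ← Ideal.Quotient.eq_zero_iff_mem, map_mul]
      rfl
    have ha : a ∉ J := fun ha => hQp.ne_top ((Ideal.eq_top_iff_one _).2
      ((h 1).2 (by rwa [mul_one])))
    obtain ⟨l, hl⟩ := ih (J ⊔ Ideal.span {a}) (lt_of_le_of_ne le_sup_left fun h' => ha (by
      rw [h']
      exact Ideal.mem_sup_right (Ideal.mem_span_singleton_self a)))
    exact ⟨_, .cons (Q := ⟨Q, hQp⟩) h hl⟩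

lemma IsPrimeFiltration.le {J : Ideal A} {l : List (PrimeSpectrum A)} (h : IsPrimeFiltration J l) :
    ∀ Q ∈ l, J ≤ Q.asIdeal := by
  induction h with
  | nil => simp
  | cons h hl ih =>
    intro Q hQ
    rcases List.mem_cons.1 hQ with rfl | hQ
    · exact fun x hx => (h x).2 (Ideal.mul_mem_left _ _ hx)
    · exact le_sup_left.trans (ih Q hQ)

open Classical in
-- Each occurrence of `P` is a strict step in the chain of ideals localised at `P`; the other steps
-- may be ignored.
lemma IsPrimeFiltration.count_le_coheight {J : Ideal A} {l : List (PrimeSpectrum A)}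
    (h : IsPrimeFiltration J l) (P : PrimeSpectrum A) : (l.count P : ℕ∞) ≤
      Order.coheight (J.map (algebraMap A (Localization.AtPrime P.asIdeal))) := by
  induction h with
  | nil => simp
  | @cons J a Q l h hl ih =>
    have hle : J.map (algebraMap A (Localization.AtPrime P.asIdeal)) ≤
        (J ⊔ Ideal.span {a}).map (algebraMap A (Localization.AtPrime P.asIdeal)) :=
      Ideal.map_mono le_sup_left
    by_cases hQ : Q = P
    · subst hQ
      rw [List.count_cons_self]
      push_cast
      refine (add_le_add_left ih 1).trans (Order.coheight_add_one_le (lt_of_le_not_ge hle ?_))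
      intro hge
      have h1 : algebraMap A (Localization.AtPrime Q.asIdeal) a ∈
          J.map (algebraMap A (Localization.AtPrime Q.asIdeal)) :=
        hge (Ideal.mem_map_of_mem _ (Ideal.mem_sup_right (Ideal.mem_span_singleton_self a)))
      rw [IsLocalization.algebraMap_mem_map_algebraMap_iff Q.asIdeal.primeCompl] at h1
      obtain ⟨s, hs, hsa⟩ := h1
      exact hs ((h s).2 (by rwa [mul_comm]))
    · rw [List.count_cons_of_ne hQ]
      exact ih.trans (Order.coheight_anti hle)

lemma Ideal.isMaximal_of_comap_isMaximal {B : Type*} [CommRing B] {f : A →+* B}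
    (hf : Function.Surjective f) {I : Ideal B} (h : (I.comap f).IsMaximal) : I.IsMaximal := by
  have h1 : I ≠ ⊤ := fun h' => h.ne_top (by rw [h', Ideal.comap_top])
  have := Ideal.map_eq_top_or_isMaximal_of_surjective f hf h
  rw [Ideal.map_comap_of_surjective f hf] at this
  exact this.resolve_left h1

/-- At a minimal prime the local quotient ring is Artinian, so its length is finite and `toNat`
loses nothing. -/
lemma EffCycle.coe_lengthAt [IsNoetherianRing A] {J : Ideal A} {P : PrimeSpectrum A}
    (hP : P.asIdeal ∈ J.minimalPrimes) : (EffCycle.lengthAt J P : ℕ∞) =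
      Order.coheight (J.map (algebraMap A (Localization.AtPrime P.asIdeal))) := by
  set B := Localization.AtPrime P.asIdeal
  set I := J.map (algebraMap A B) with hI
  have h0 : Ring.KrullDimLE 0 (B ⧸ I) := by
    refine Ring.KrullDimLE.mk₀ fun p hp => ?_
    refine Ideal.isMaximal_of_comap_isMaximal (Ideal.Quotient.mk_surjective (I := I)) ?_
    set p' := p.comap (Ideal.Quotient.mk I) with hp'
    have hIp : I ≤ p' := fun x hx => by
      rw [hp', Ideal.mem_comap, Ideal.Quotient.eq_zero_iff_mem.2 hx]
      exact p.zero_mem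
    have h1 : J ≤ p'.comap (algebraMap A B) := Ideal.map_le_iff_le_comap.1 hIp
    have h2 : p'.comap (algebraMap A B) ≤ P.asIdeal := by
      have := Ideal.comap_mono (f := algebraMap A B)
        (IsLocalRing.le_maximalIdeal (Ideal.IsPrime.ne_top (I := p') inferInstance))
      exact this.trans_eq (IsLocalization.AtPrime.under_maximalIdeal B P.asIdeal)
    have h3 := le_antisymm h2 (hP.2 ⟨inferInstance, h1⟩ h2)
    have h4 : (p'.comap (algebraMap A B)).map (algebraMap A B) = p' :=
      IsLocalization.map_under P.asIdeal.primeCompl B p'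
    rw [h3, Localization.AtPrime.map_eq_maximalIdeal] at h4
    rw [← h4]
    exact IsLocalRing.maximalIdeal.isMaximal B
  have h1 : IsArtinianRing (B ⧸ I) :=
    isArtinianRing_iff_isNoetherianRing_krullDimLE_zero.2 ⟨inferInstance, h0⟩
  have h2 : Module.length B (B ⧸ I) ≠ ⊤ := by
    rw [Module.length_eq_of_surjective (R := B ⧸ I) Ideal.Quotient.mk_surjective]
    exact Module.length_ne_top
  rw [EffCycle.lengthAt, ENat.natCast_toNat h2, Module.length_quotient]

open Classical in
lemma IsPrimeFiltration.count_le_lengthAt [IsNoetherianRing A] {J : Ideal A}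
    {l : List (PrimeSpectrum A)} (h : IsPrimeFiltration J l) {P : PrimeSpectrum A}
    (hP : P.asIdeal ∈ J.minimalPrimes) : l.count P ≤ EffCycle.lengthAt J P := by
  have := h.count_le_coheight P
  rw [← EffCycle.coe_lengthAt hP] at this
  exact_mod_cast this

end PrimeFiltration

/-! ### Greatest common divisors along a prime filtration -/

section Fitting

variable {K : Type*} [Field K] {σ τ : Type*} [Finite τ]

/-- By multiplicativity, products of Fitting elements of the quotients are Fitting elements of the
filtered module. They are replaced by greatest common divisors one factor at a time, the remaining
factors being collected in `s`. -/
lemma IsPrimeFiltration.dvd_prod_fittingGcd {L : Type*} [Field L] [Algebra K L]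
    {J : Ideal (MvPolynomial σ K)} {l : List (PrimeSpectrum (MvPolynomial σ K))}
    (h : IsPrimeFiltration J l) (u : τ → MvPolynomial σ L) :
    ∀ {δ s : MvPolynomial τ L},
      (∀ b, IsFittingElem (tupleHom u) (extIdeal (algebraMap K L) J) b → δ ∣ s * b) →
      δ ∣ s * (l.map fun Q => fittingGcd u (extIdeal (algebraMap K L) Q.asIdeal)).prod := by
  induction h with
  | nil =>
    intro δ s h
    refine h _ ⟨0, Fin.elim0, 0, fun x => ⟨Fin.elim0, ?_⟩, fun i => i.elim0, by simp⟩
    rw [extIdeal, Ideal.map_top]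
    trivial
  | @cons J a Q l h hl ih =>
    intro δ s hδ
    rw [List.map_cons, List.prod_cons, mul_left_comm, mul_comm (fittingGcd _ _)]
    refine dvd_mul_fittingGcd fun g hg => ?_
    rw [mul_right_comm]
    refine ih fun b hb => ?_
    rw [mul_assoc]
    refine hδ _ (hg.mul (a := map (algebraMap K L) a) (fun q hq => ?_) ?_)
    · have h1 : Ideal.span {map (algebraMap K L) a} * extIdeal (algebraMap K L) Q.asIdeal ≤
          extIdeal (algebraMap K L) J := by
        rw [extIdeal, extIdeal, ← Set.image_singleton, ← Ideal.map_span, ← Ideal.map_mul]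
        refine Ideal.map_mono ?_
        rw [Ideal.span_singleton_mul_le_iff]
        exact fun x hx => (h x).1 hx
      exact h1 (Ideal.mul_mem_mul (Ideal.mem_span_singleton_self _) hq)
    · rw [extIdeal, Ideal.map_sup, Ideal.map_span, Set.image_singleton] at hb
      exact hb

end Fitting

/-! ### Hyperplane sections -/

section Hyperplane

universe u

variable {K : Type u} [Field K] {σ : Type}

/-- Setting the last coordinate to zero turns `δ` into a common divisor of the Fitting elements of
`P + (ℓ)` over `u`, since these lift to Fitting elements of `P`. So it divides the product along the
filtration, and modulo `ℓ` its value at `u` is the value of `δ`, which lies in the extension of `I`.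
-/
lemma HasChowForm.prod_fittingGcd_mem {L : Type*} [Field L] [Algebra K L] {d : ℕ}
    {u : Fin d → MvPolynomial σ L} {ℓ : MvPolynomial σ K} {P I : Ideal (MvPolynomial σ K)}
    (hfin : FiniteOn (Fin.snoc u (map (algebraMap K L) ℓ) : Fin (d + 1) → MvPolynomial σ L)
      (extIdeal (algebraMap K L) P))
    (h : HasChowForm P I (Fin.snoc u (map (algebraMap K L) ℓ) : Fin (d + 1) → MvPolynomial σ L))
    {l : List (PrimeSpectrum (MvPolynomial σ K))}
    (hl : IsPrimeFiltration (P ⊔ Ideal.span {ℓ}) l) :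
    (l.map fun Q => tupleHom u (fittingGcd u (extIdeal (algebraMap K L) Q.asIdeal))).prod ∈
      extIdeal (algebraMap K L) (I ⊔ Ideal.span {ℓ}) := by
  obtain ⟨δ, hδ, hδI⟩ := h
  obtain ⟨n, t, ht⟩ := hfin
  set ℓL := map (algebraMap K L) ℓ with hℓL
  set v : Fin (d + 1) → MvPolynomial σ L := Fin.snoc u ℓL with hv
  have hext : ∀ J : Ideal (MvPolynomial σ K), extIdeal (algebraMap K L) (J ⊔ Ideal.span {ℓ}) =
      extIdeal (algebraMap K L) J ⊔ Ideal.span {ℓL} := fun J => by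
    rw [extIdeal, Ideal.map_sup, Ideal.map_span, Set.image_singleton]
  let ρ : MvPolynomial (Fin (d + 1)) L →+* MvPolynomial (Fin d) L :=
    tupleHom (Fin.snoc (fun i => X i) 0 : Fin (d + 1) → MvPolynomial (Fin d) L)
  have hρ : ∀ p, ρ (rename Fin.castSucc p) = p := fun p => by
    change aeval _ (rename _ p) = p
    rw [aeval_rename]
    have : (Fin.snoc (fun i => X i) 0 : Fin (d + 1) → MvPolynomial (Fin d) L) ∘ Fin.castSucc =
        X := by
      funext i
      simp
    rw [this, aeval_X_left_apply]
  have hc : ∀ J : Ideal (MvPolynomial σ K), ∀ s, tupleHom u (ρ s) - RingHom.id _ (tupleHom v s) ∈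
      extIdeal (algebraMap K L) (J ⊔ Ideal.span {ℓ}) := by
    intro J s
    rw [← Ideal.Quotient.eq]
    have h1 : (Ideal.Quotient.mk (extIdeal (algebraMap K L) (J ⊔ Ideal.span {ℓ}))).comp
        ((tupleHom u).comp ρ) = (Ideal.Quotient.mk _).comp ((RingHom.id _).comp (tupleHom v)) := by
      refine MvPolynomial.ringHom_ext (by simp [ρ]) fun i => ?_
      refine Fin.lastCases ?_ (fun i => ?_) i
      · simp only [RingHom.comp_apply, ρ, tupleHom_X, Fin.snoc_last, map_zero, hv, RingHom.id_apply]
        rw [eq_comm, Ideal.Quotient.eq_zero_iff_mem, hext]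
        exact Ideal.mem_sup_right (Ideal.mem_span_singleton_self _)
      · simp [ρ, hv]
    exact RingHom.congr_fun h1 s
  have hdvd : ρ δ ∣ (l.map fun Q =>
      fittingGcd u (extIdeal (algebraMap K L) Q.asIdeal)).prod := by
    rw [← one_mul (List.prod _)]
    refine hl.dvd_prod_fittingGcd u fun b hb => ?_
    obtain ⟨g, hg, rfl⟩ := IsFittingElem.exists_lift (J := extIdeal (algebraMap K L) P)
      ρ (RingHom.id _) (fun p => ⟨_, hρ p⟩) Function.surjective_id (hc P) (fun x hx => by
        rw [RingHom.id_apply, hext] at hx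
        refine sup_le_sup (le_refl (extIdeal (algebraMap K L) P)) ?_ hx
        rw [Ideal.span_singleton_le_iff_mem]
        have : tupleHom v (X (Fin.last d)) = ℓL := by simp [hv]
        rw [← this]
        refine Ideal.mem_map_of_mem _ ?_
        rw [RingHom.mem_ker]
        simp [ρ]) t ht hb
    rw [one_mul]
    exact map_dvd _ (hδ _ hg)
  obtain ⟨q, hq⟩ := hdvd
  have h2 : (l.map fun Q => tupleHom u (fittingGcd u (extIdeal (algebraMap K L) Q.asIdeal))).prod =
      tupleHom u (l.map fun Q => fittingGcd u (extIdeal (algebraMap K L) Q.asIdeal)).prod := by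
    rw [map_list_prod, List.map_map]
    rfl
  rw [h2, hq, map_mul]
  refine Ideal.mul_mem_right _ _ ?_
  have h3 := hc I δ
  rw [RingHom.id_apply] at h3
  rw [← sub_add_cancel (tupleHom u (ρ δ)) (tupleHom v δ)]
  exact Ideal.add_mem _ h3 (Ideal.map_mono le_sup_left hδI)

variable [Fintype σ]

/-- The `d` generic forms are already finite on `V(P)`, so adding the given form keeps the tuple
finite and a Chow form exists for it. -/
lemma prod_fittingGcd_genericTuple_mem {P : Ideal (MvPolynomial σ K)} {d : ℕ}
    {w : Fin d → MvPolynomial σ K} (hw : FiniteOn w P) (a : Option σ → K)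
    {l : List (PrimeSpectrum (MvPolynomial σ K))}
    (hl : IsPrimeFiltration (P ⊔ Ideal.span {affineForm a}) l) :
    (l.map fun Q => tupleHom (genericTuple K d σ) (fittingGcd (genericTuple K d σ)
      (extIdeal (algebraMap K (GenericField K d σ)) Q.asIdeal))).prod ∈
      extIdeal (algebraMap K (GenericField K d σ))
        (chowContent (d + 1) P ⊔ Ideal.span {affineForm a}) := by
  set L := GenericField K d σ
  let b : Fin (d + 1) → Option σ → L := Fin.snoc (fun i h =>
    algebraMap (MvPolynomial (Fin d × Option σ) K) L (X (i, h))) fun h => algebraMap K L (a h)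
  have hb : (Fin.snoc (genericTuple K d σ) (map (algebraMap K L) (affineForm a)) :
      Fin (d + 1) → MvPolynomial σ L) = fun i => affineForm (b i) := by
    funext i
    refine Fin.lastCases ?_ (fun i => ?_) i
    · simp [b, map_affineForm]
    · simp only [Fin.snoc_castSucc, b]
      rfl
  have hfin : FiniteOn (Fin.snoc (genericTuple K d σ) (map (algebraMap K L) (affineForm a)) :
      Fin (d + 1) → MvPolynomial σ L) (extIdeal (algebraMap K L) P) :=
    (finiteOn_genericTuple hw le_rfl).of_comp fun i => ⟨X i.castSucc, by simp⟩
  refine HasChowForm.prod_fittingGcd_mem hfin ?_ hl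
  rw [hb] at hfin ⊢
  exact hasChowForm_affineForm hw (Nat.lt_succ_self d) b hfin

end Hyperplane

/-! ### Contents of polynomials over valuation rings -/

section Gauss

variable {V : Type*} [CommRing V] [IsDomain V] [ValuationRing V]

lemma ValuationRing.exists_forall_dvd {ι : Type*} {s : Finset ι} (hs : s.Nonempty) (f : ι → V) :
    ∃ i ∈ s, ∀ j ∈ s, f i ∣ f j := by
  classical
  induction hs using Finset.Nonempty.cons_induction with
  | singleton a => exact ⟨a, by simp⟩
  | cons a s ha hs ih =>
    obtain ⟨i, hi, h⟩ := ih
    rcases ValuationRing.dvd_total (f i) (f a) with h1 | h1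
    · refine ⟨i, Finset.mem_cons_of_mem hi, fun j hj => ?_⟩
      rcases Finset.mem_cons.1 hj with rfl | hj
      exacts [h1, h j hj]
    · refine ⟨a, Finset.mem_cons_self a s, fun j hj => ?_⟩
      rcases Finset.mem_cons.1 hj with rfl | hj
      exacts [dvd_rfl, h1.trans (h j hj)]

/-- Some coefficient divides all others; after dividing by it, one coefficient equals `1`. Primitive
polynomials in this sense are closed under products, as the residue ring is a field. -/
lemma ValuationRing.exists_eq_C_mul {ι : Type*} (p : MvPolynomial ι V) :
    ∃ (c : V) (q : MvPolynomial ι V), p = C c * q ∧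
      map (IsLocalRing.residue V) q ≠ 0 := by
  classical
  by_cases hp : p = 0
  · exact ⟨0, 1, by simp [hp], by simp⟩
  obtain ⟨m, hm, h⟩ := ValuationRing.exists_forall_dvd
    (Finset.nonempty_of_ne_empty (mt support_eq_empty.1 hp)) (fun m => p.coeff m)
  obtain ⟨q, hq⟩ := (C_dvd_iff_dvd_coeff (p.coeff m) p).2 fun j => by
    by_cases hj : j ∈ p.support
    · exact h j hj
    · rw [notMem_support_iff.1 hj]
      exact dvd_zero _
  refine ⟨_, q, hq, fun h0 => ?_⟩
  have h1 : q.coeff m = 1 := by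
    have := congrArg (coeff m) hq
    rw [coeff_C_mul] at this
    exact (mul_right_eq_self₀.1 this.symm).resolve_right (mem_support_iff.1 hm)
  have := congrArg (coeff m) h0
  rw [coeff_map, h1] at this
  simp at this

/-- The lemma of Gauss for valuation rings. -/
lemma ValuationRing.prod_span_coeff_le {ι : Type*} (l : List (MvPolynomial ι V)) {I : Ideal V}
    (h : ∀ m, l.prod.coeff m ∈ I) :
    (l.map fun p => Ideal.span (Set.range fun m => p.coeff m)).prod ≤ I := by
  obtain ⟨c, q, hl, hq, hc⟩ : ∃ (c : V) (q : MvPolynomial ι V), l.prod = C c * q ∧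
      map (IsLocalRing.residue V) q ≠ 0 ∧
      (l.map fun p => Ideal.span (Set.range fun m => p.coeff m)).prod ≤ Ideal.span {c} := by
    clear h
    induction l with
    | nil => exact ⟨1, 1, by simp, by simp, by simp⟩
    | cons p l ih =>
      obtain ⟨c, q, hl, hq, hc⟩ := ih
      obtain ⟨b, r, rfl, hr⟩ := ValuationRing.exists_eq_C_mul p
      refine ⟨b * c, r * q, by rw [List.prod_cons, hl, C_mul]; ring, ?_, ?_⟩
      · rw [map_mul]
        exact mul_ne_zero hr hq
      · rw [List.map_cons, List.prod_cons, ← Ideal.span_singleton_mul_span_singleton]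
        refine Ideal.mul_mono ?_ hc
        rw [Ideal.span_le]
        rintro _ ⟨m, rfl⟩
        simp only [coeff_C_mul]
        exact Ideal.mem_span_singleton.2 (dvd_mul_right _ _)
  refine hc.trans ?_
  rw [Ideal.span_singleton_le_iff_mem]
  obtain ⟨m, hm⟩ := ne_zero_iff.1 hq
  have h1 := h m
  rw [hl, coeff_C_mul] at h1
  rw [coeff_map, Ne, IsLocalRing.residue_eq_zero_iff, IsLocalRing.mem_maximalIdeal,
    mem_nonunits_iff, not_not] at hm
  exact (Ideal.mul_unit_mem_iff_mem I hm).1 h1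

end Gauss

/-! ### Products of coefficient ideals -/

section Content

variable {K : Type*} [Field K] {σ ι : Type*} {L : Type*} [Field L] [Algebra K L]

/-- The smallest ideal over `K` whose extension to `L` contains `p`. -/
def coeffContent (K : Type*) [Field K] {L : Type*} [Field L] [Algebra K L] {σ : Type*}
    (p : MvPolynomial σ L) : Ideal (MvPolynomial σ K) :=
  Ideal.span (Set.range fun ω : L →ₗ[K] K => mapCoeff ω p)

lemma coeffContent_le_iff {p : MvPolynomial σ L} {I : Ideal (MvPolynomial σ K)} :
    coeffContent K p ≤ I ↔ p ∈ extIdeal (algebraMap K L) I := by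
  rw [coeffContent, Ideal.span_le, Set.range_subset_iff, extIdeal, mem_map_iff_mapCoeff]
  rfl

/-- After clearing denominators and exchanging the two sets of variables, the factors are
polynomials in `ι` with coefficients in `MvPolynomial σ K`, and their ordinary contents contain the
coefficient ideals. The lemma of Gauss applies once these coefficients are mapped to `V`. -/
lemma prod_coeffContent_le [Algebra (MvPolynomial ι K) L] [IsScalarTower K (MvPolynomial ι K) L]
    [IsFractionRing (MvPolynomial ι K) L] {l : List (MvPolynomial σ L)}
    {I : Ideal (MvPolynomial σ K)} (h : l.prod ∈ extIdeal (algebraMap K L) I)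
    {V : Type*} [CommRing V] [IsDomain V] [ValuationRing V] (f : MvPolynomial σ K →+* V) :
    (l.map (coeffContent K)).prod.map f ≤ I.map f := by
  set Λ := MvPolynomial ι K
  obtain ⟨e, he, -⟩ := exists_commRingEquiv K σ ι
  choose q c hc hq using fun p : MvPolynomial σ L => exists_clear_denominators (Λ := Λ) p
  have hunit : ∀ p, IsUnit (C (algebraMap Λ L (c p)) : MvPolynomial σ L) := fun p =>
    (IsUnit.mk0 _ (by rw [Ne, IsFractionRing.to_map_eq_zero_iff]; exact hc p)).map C
  have h1 : ∀ p, coeffContent K p ≤ Ideal.span (Set.range fun m => (e (q p)).coeff m) := fun p => by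
    rw [coeffContent_le_iff, ← Ideal.mul_unit_mem_iff_mem _ (hunit p), ← hq]
    have : q p ∈ extIdeal (algebraMap K Λ)
        (Ideal.span (Set.range fun m => (e (q p)).coeff m)) := by
      rw [mem_extIdeal_mvPolynomial_iff he, mem_map_C_iff]
      exact fun m => Ideal.subset_span ⟨m, rfl⟩
    have := Ideal.mem_map_of_mem (map (algebraMap Λ L)) this
    change _ ∈ extIdeal _ (extIdeal _ _) at this
    rwa [extIdeal_extIdeal, ← IsScalarTower.algebraMap_eq] at this
  have h2 : ((l.map q).map e).prod ∈ I.map C := by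
    rw [← map_list_prod, ← mem_extIdeal_mvPolynomial_iff he]
    refine mem_map_of_map_mem_map (IsScalarTower.toAlgHom K Λ L) (IsFractionRing.injective Λ L) ?_
    change map (algebraMap Λ L) _ ∈ _
    have h3 : ∃ s, map (algebraMap Λ L) (l.map q).prod = l.prod * s := by
      clear h
      induction l with
      | nil => exact ⟨1, by simp⟩
      | cons p l ih =>
        obtain ⟨s, hs⟩ := ih
        refine ⟨C (algebraMap Λ L (c p)) * s, ?_⟩
        rw [List.map_cons, List.prod_cons, map_mul, hs, hq, List.prod_cons]
        ring
    obtain ⟨s, hs⟩ := h3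
    rw [hs]
    exact Ideal.mul_mem_right _ _ h
  have h3 : (l.map (coeffContent K)).prod.map f ≤
      (((l.map q).map e).map fun p => Ideal.span (Set.range fun m => (map f p).coeff m)).prod := by
    clear h h2
    induction l with
    | nil => simp [Ideal.one_eq_top]
    | cons p l ih =>
      simp only [List.map_cons, List.prod_cons, Ideal.map_mul]
      refine Ideal.mul_mono ((Ideal.map_mono (h1 p)).trans ?_) ih
      rw [Ideal.map_span, ← Set.range_comp]
      simp only [coeff_map]
      rfl
  refine h3.trans ?_
  have h4 := ValuationRing.prod_span_coeff_le (((l.map q).map e).map (map f)) (I := I.map f)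
    fun m => by
      rw [← map_list_prod, coeff_map]
      exact Ideal.mem_map_of_mem f (mem_map_C_iff.1 h2 m)
  rwa [List.map_map] at h4

end Content

/-! ### Comparison of ideals in valuation rings and integral closure -/

section Valuative

universe u

variable {A : Type u} [CommRing A]

/-- `I` is contained in `J` after extension to every valuation ring; for noetherian rings this
means that `I` is contained in the integral closure of `J`. -/
def ValuativeLE (I J : Ideal A) : Prop :=
  ∀ (V : Type u) [CommRing V] [IsDomain V] [ValuationRing V] (f : A →+* V), I.map f ≤ J.map f

lemma ValuativeLE.of_le {I J : Ideal A} (h : I ≤ J) : ValuativeLE I J :=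
  fun _ _ _ _ _ => Ideal.map_mono h

lemma ValuativeLE.trans {I J N : Ideal A} (h : ValuativeLE I J) (h' : ValuativeLE J N) :
    ValuativeLE I N :=
  fun V _ _ _ f => (h V f).trans (h' V f)

lemma ValuativeLE.mul {I J I' J' : Ideal A} (h : ValuativeLE I J) (h' : ValuativeLE I' J') :
    ValuativeLE (I * I') (J * J') := fun V _ _ _ f => by
  rw [Ideal.map_mul, Ideal.map_mul]
  exact Ideal.mul_mono (h V f) (h' V f)

lemma ValuativeLE.pow {I J : Ideal A} (h : ValuativeLE I J) (n : ℕ) :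
    ValuativeLE (I ^ n) (J ^ n) := fun V _ _ _ f => by
  rw [Ideal.map_pow, Ideal.map_pow]
  exact Ideal.pow_right_mono (h V f) n

lemma ValuativeLE.sup_right {I J : Ideal A} (h : ValuativeLE I J) (N : Ideal A) :
    ValuativeLE (I ⊔ N) (J ⊔ N) := fun V _ _ _ f => by
  rw [Ideal.map_sup, Ideal.map_sup]
  exact sup_le_sup_right (h V f) _

lemma ValuativeLE.prod {ι : Type*} {s : Finset ι} {I J : ι → Ideal A}
    (h : ∀ i ∈ s, ValuativeLE (I i) (J i)) : ValuativeLE (∏ i ∈ s, I i) (∏ i ∈ s, J i) := by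
  classical
  induction s using Finset.induction_on with
  | empty => exact .of_le le_rfl
  | insert a s ha ih =>
    rw [Finset.prod_insert ha, Finset.prod_insert ha]
    exact (h a (Finset.mem_insert_self a s)).mul
      (ih fun i hi => h i (Finset.mem_insert_of_mem hi))

lemma Ideal.prod_le_prod_of_le {ι : Type*} {s : Finset ι} {I J : ι → Ideal A}
    (h : ∀ i ∈ s, I i ≤ J i) : ∏ i ∈ s, I i ≤ ∏ i ∈ s, J i := by
  classical
  induction s using Finset.induction_on with
  | empty => exact le_rfl
  | insert a s ha ih =>
    rw [Finset.prod_insert ha, Finset.prod_insert ha]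
    exact Ideal.mul_mono (h a (Finset.mem_insert_self a s))
      (ih fun i hi => h i (Finset.mem_insert_of_mem hi))

lemma Ideal.sup_mul_sup_le_mul_sup (I J N : Ideal A) : (I ⊔ N) * (J ⊔ N) ≤ I * J ⊔ N := by
  rw [Ideal.mul_le]
  intro x hx y hy
  obtain ⟨i, hi, n, hn, rfl⟩ := Submodule.mem_sup.1 hx
  obtain ⟨j, hj, n', hn', rfl⟩ := Submodule.mem_sup.1 hy
  rw [mul_add, add_mul, add_assoc]
  exact Submodule.add_mem_sup (Ideal.mul_mem_mul hi hj)
    (N.add_mem (N.mul_mem_right _ hn) (N.mul_mem_left _ hn'))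

lemma Ideal.prod_sup_pow_le {ι : Type*} (s : Finset ι) (I : ι → Ideal A) (a : ι → ℕ) (N : Ideal A) :
    ∏ i ∈ s, (I i ⊔ N) ^ a i ≤ (∏ i ∈ s, I i ^ a i) ⊔ N := by
  classical
  have hpow : ∀ (I : Ideal A) (n : ℕ), (I ⊔ N) ^ n ≤ I ^ n ⊔ N := fun I n => by
    induction n with
    | zero => simp
    | succ n ih =>
      rw [pow_succ, pow_succ]
      exact (Ideal.mul_mono_left ih).trans (Ideal.sup_mul_sup_le_mul_sup _ _ _)
  induction s using Finset.induction_on with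
  | empty => simp
  | insert i s hi ih =>
    rw [Finset.prod_insert hi, Finset.prod_insert hi]
    exact (Ideal.mul_mono (hpow _ _) ih).trans (Ideal.sup_mul_sup_le_mul_sup _ _ _)

/-- The valuative criterion for integrality over an ideal. -/
theorem Ideal.isIntegralElem_of_valuationSubring [IsDomain A] {I : Ideal A} {r : A}
    (h : ∀ (V : ValuationSubring (FractionRing A)) (f : A →+* V), f r ∈ I.map f) :
    I.IsIntegralElem r := by
  by_cases hr : r = 0
  · exact ⟨1, 0, le_rfl, fun j _ => Ideal.zero_mem _, by simp [hr]⟩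
  set F := FractionRing A
  set x := algebraMap A F r with hx
  have hx0 : x ≠ 0 := by rwa [hx, Ne, IsFractionRing.to_map_eq_zero_iff]
  -- `B` is the ring `A[I / r]`, and `J` is its ideal generated by `I / r`, the image of the
  -- elements of the Rees algebra without constant term.
  let φ : reesAlgebra I →ₐ[A] F := (Polynomial.aeval x⁻¹).comp (reesAlgebra I).val
  let J₀ : Ideal (reesAlgebra I) := RingHom.ker
    (Polynomial.constantCoeff.comp (reesAlgebra I).val.toRingHom)
  let B : Subring F := φ.toRingHom.range
  let J : Ideal B := J₀.map φ.toRingHom.rangeRestrict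
  -- If `J` is the unit ideal, `1` is a sum of terms `c_j r⁻ʲ` with `c_j ∈ I ^ j`, and
  -- multiplication by a power of `r` gives the integral equation. Otherwise a valuation ring `V`
  -- contains `B` with `I / r` in its maximal ideal, so that `r` cannot lie in `I V`.
  by_cases hJ : J = ⊤
  · have h1 : (1 : B) ∈ J := hJ ▸ Submodule.mem_top
    obtain ⟨⟨p, hp⟩, hp0, hp1⟩ := (Ideal.mem_map_iff_of_surjective _
      (RingHom.rangeRestrict_surjective φ.toRingHom)).1 h1
    have hp0 : p.coeff 0 = 0 := hp0
    have hp1 : Polynomial.aeval x⁻¹ p = 1 := congrArg Subtype.val hp1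
    have hpn : p.natDegree ≠ 0 := fun hn => by
      rw [Polynomial.eq_C_of_natDegree_eq_zero hn, hp0] at hp1
      simp at hp1
    refine ⟨p.natDegree, fun j => - p.coeff j, Nat.one_le_iff_ne_zero.2 hpn, fun j _ =>
      neg_mem (hp j), ?_⟩
    apply IsFractionRing.injective A F
    rw [Polynomial.aeval_eq_sum_range, Finset.sum_range_succ', hp0, zero_smul, add_zero] at hp1
    have h2 : ∑ j ∈ Finset.Icc 1 p.natDegree, algebraMap A F (p.coeff j) * x⁻¹ ^ j = 1 := by
      rw [← hp1, ← Finset.sum_image (s := Finset.range p.natDegree) (g := fun j => j + 1)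
        (f := fun j => p.coeff j • x⁻¹ ^ j) (fun _ _ _ _ h => Nat.succ_injective h)]
      refine Finset.sum_congr ?_ fun j _ => (Algebra.smul_def _ _).symm
      ext j
      simp only [Finset.mem_Icc, Finset.mem_image, Finset.mem_range]
      exact ⟨fun hj => ⟨j - 1, by omega, by omega⟩, by rintro ⟨i, hi, rfl⟩; omega⟩
    rw [map_add, map_sum, map_zero, map_pow, ← hx, ← mul_one (x ^ _), ← h2, Finset.mul_sum,
      ← Finset.sum_add_distrib]
    refine Finset.sum_eq_zero fun j hj => ?_
    rw [map_mul, map_neg, map_pow, ← hx, pow_sub₀ _ hx0 (Finset.mem_Icc.1 hj).2, inv_pow]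
    ring
  · exfalso
    obtain ⟨V, hBV, hV⟩ := Ideal.image_subset_nonunits_valuationSubring J hJ
    have hA : ∀ a, algebraMap A F a ∈ V := fun a =>
      hBV ⟨algebraMap A _ a, φ.commutes a⟩
    have h1 := h V ((algebraMap A F).codRestrict V hA)
    have h2 : ∀ a ∈ I, ∃ m ∈ IsLocalRing.maximalIdeal V, algebraMap A F a = x * m := by
      intro a ha
      have h3 : (⟨Polynomial.monomial 1 a, reesAlgebra.monomial_mem.2 (by simpa using ha)⟩ :
          reesAlgebra I) ∈ J₀ := by
        simp [J₀, RingHom.mem_ker, Polynomial.coeff_monomial]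
      have h4 := hV ⟨_, Ideal.mem_map_of_mem φ.toRingHom.rangeRestrict h3, rfl⟩
      rw [← V.image_maximalIdeal] at h4
      obtain ⟨m, hm, hm'⟩ := h4
      refine ⟨m, hm, ?_⟩
      rw [hm']
      have h5 : (Polynomial.aeval x⁻¹ (Polynomial.monomial 1 a) : F) =
          algebraMap A F a * x⁻¹ := by simp
      change _ = x * (Polynomial.aeval x⁻¹ (Polynomial.monomial 1 a) : F)
      rw [h5, mul_comm, mul_assoc, inv_mul_cancel₀ hx0, mul_one]
    have h3 : I.map ((algebraMap A F).codRestrict V hA) ≤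
        Ideal.span {⟨x, hA r⟩} * IsLocalRing.maximalIdeal V := by
      rw [Ideal.map_le_iff_le_comap]
      intro a ha
      obtain ⟨m, hm, hm'⟩ := h2 a ha
      rw [Ideal.mem_comap, Ideal.mem_span_singleton_mul]
      exact ⟨m, hm, Subtype.ext hm'.symm⟩
    obtain ⟨m, hm, hm'⟩ := Ideal.mem_span_singleton_mul.1 (h3 h1)
    have h4 : x * m = x := congrArg Subtype.val hm'
    have h5 : m = 1 := Subtype.ext (mul_left_cancel₀ hx0 (h4.trans (mul_one x).symm))
    exact (IsLocalRing.mem_maximalIdeal _).1 hm (h5 ▸ isUnit_one)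

end Valuative

/-! ### The content of a cycle and its behaviour under hyperplane sections -/

section CycleContent

universe u

variable {K : Type u} [Field K] {σ : Type} [Fintype σ]

/-- The dimension of a variety in affine space. -/
def varietyDim (P : PrimeSpectrum (MvPolynomial σ K)) : ℕ :=
  (exists_ringKrullDim_eq P.asIdeal).choose

lemma ringKrullDim_eq_varietyDim (P : PrimeSpectrum (MvPolynomial σ K)) :
    ringKrullDim (MvPolynomial σ K ⧸ P.asIdeal) = varietyDim P :=
  (exists_ringKrullDim_eq P.asIdeal).choose_spec.1

/-- The ideal of the coefficients of the equations of generic projections of a variety. -/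
def varietyContent (P : PrimeSpectrum (MvPolynomial σ K)) : Ideal (MvPolynomial σ K) :=
  chowContent (varietyDim P + 1) P.asIdeal

/-- The multiplicative extension of `varietyContent` to cycles. -/
def cycleContent (Z : EffCycle (MvPolynomial σ K)) : Ideal (MvPolynomial σ K) :=
  Z.prod fun P a => varietyContent P ^ a

lemma cycleContent_add (Z W : EffCycle (MvPolynomial σ K)) :
    cycleContent (Z + W) = cycleContent Z * cycleContent W :=
  Finsupp.prod_add_index' (fun _ => pow_zero _) fun _ _ _ => pow_add _ _ _

@[simp] lemma cycleContent_zero : cycleContent (0 : EffCycle (MvPolynomial σ K)) = 1 :=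
  Finsupp.prod_zero_index

lemma cycleContent_single (P : PrimeSpectrum (MvPolynomial σ K)) (a : ℕ) :
    cycleContent (Finsupp.single P a) = varietyContent P ^ a :=
  Finsupp.prod_single_index (pow_zero _)

lemma cycleContent_smul (a : ℕ) (Z : EffCycle (MvPolynomial σ K)) :
    cycleContent (a • Z) = cycleContent Z ^ a := by
  induction a with
  | zero => rw [zero_smul, pow_zero, cycleContent_zero]
  | succ a ih => rw [succ_nsmul, cycleContent_add, ih, pow_succ]

lemma cycleContent_sum {ι : Type*} (s : Finset ι) (Z : ι → EffCycle (MvPolynomial σ K)) :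
    cycleContent (∑ i ∈ s, Z i) = ∏ i ∈ s, cycleContent (Z i) := by
  classical
  induction s using Finset.induction_on with
  | empty => simp
  | insert a s ha ih => rw [Finset.sum_insert ha, Finset.prod_insert ha, cycleContent_add, ih]

lemma varietyContent_le (P : PrimeSpectrum (MvPolynomial σ K)) : varietyContent P ≤ P.asIdeal :=
  chowContent_le (ringKrullDim_eq_varietyDim P)

lemma cycleContent_le_ideal (Z : EffCycle (MvPolynomial σ K)) : cycleContent Z ≤ Z.ideal :=
  Ideal.prod_le_prod_of_le fun P _ => Ideal.pow_right_mono (varietyContent_le P) _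

lemma EffCycle.ofIdeal_apply {A : Type*} [CommRing A] [IsNoetherianRing A] {J : Ideal A}
    {P : PrimeSpectrum A} (hP : P.asIdeal ∈ J.minimalPrimes) :
    EffCycle.ofIdeal J P = EffCycle.lengthAt J P := by
  rw [EffCycle.ofIdeal, Finsupp.onFinset_apply, if_pos hP]

/-- Intersection with a hyperplane. -/
lemma valuativeLE_cycleContent_ofIdeal {P : PrimeSpectrum (MvPolynomial σ K)} {a : Option σ → K}
    (ha : affineForm a ∉ P.asIdeal) :
    ValuativeLE (cycleContent (EffCycle.ofIdeal (P.asIdeal ⊔ Ideal.span {affineForm a})))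
      (varietyContent P ⊔ Ideal.span {affineForm a}) := by
  classical
  set d := varietyDim P with hd
  have hdim := ringKrullDim_eq_varietyDim P
  rw [← hd] at hdim
  set J := P.asIdeal ⊔ Ideal.span {affineForm a} with hJ
  obtain ⟨w, hw, -⟩ := exists_parameters hdim
  obtain ⟨l, hl⟩ := exists_isPrimeFiltration J
  -- The Chow forms of the filtration factors have their product in the extension of the right-hand
  -- side. Only the passage to the product of their contents requires a valuation ring.
  refine .trans (.of_le ?_) fun V _ _ _ f => prod_coeffContent_le (ι := Fin d × Option σ)
    (prod_fittingGcd_genericTuple_mem hw a hl) f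
  rw [List.map_map]
  change _ ≤ (l.map fun Q => chowContent d Q.asIdeal).prod
  set S := (EffCycle.ofIdeal J).support ∪ l.toFinset
  have h1 : cycleContent (EffCycle.ofIdeal J) =
      ∏ Q ∈ S, varietyContent Q ^ EffCycle.ofIdeal J Q :=
    Finsupp.prod_of_support_subset _ Finset.subset_union_left _ fun _ _ => pow_zero _
  have h2 : (l.map fun Q => chowContent d Q.asIdeal).prod =
      ∏ Q ∈ S, chowContent d Q.asIdeal ^ l.count Q := by
    rw [Finset.prod_list_map_count]
    refine Finset.prod_subset Finset.subset_union_right fun Q _ hQ => ?_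
    rw [List.count_eq_zero_of_not_mem (by simpa using hQ), pow_zero]
  rw [h1, h2]
  refine Ideal.prod_le_prod_of_le fun Q _ => ?_
  by_cases hQ : Q ∈ l
  swap
  · rw [List.count_eq_zero_of_not_mem hQ, pow_zero, Ideal.one_eq_top]
    exact le_top
  have hlt : ∀ Q : PrimeSpectrum (MvPolynomial σ K), J ≤ Q.asIdeal → varietyDim Q < d :=
    fun Q hQ => lt_of_ringKrullDim_eq (lt_of_le_of_ne (le_sup_left.trans hQ) fun h => ha (by
      rw [h]
      exact hQ (Ideal.mem_sup_right (Ideal.mem_span_singleton_self _)))) hdim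
      (ringKrullDim_eq_varietyDim Q)
  have hJQ := hl.le Q hQ
  -- Primes of dimension below `d - 1` have trivial content with respect to `d` generic forms. Those
  -- of dimension `d - 1` are minimal over `J`, and their number of occurrences is bounded by the
  -- multiplicity.
  rcases lt_or_eq_of_le (Nat.succ_le_of_lt (hlt Q hJQ)) with h | h
  · obtain ⟨w', hw', -⟩ := exists_parameters (ringKrullDim_eq_varietyDim Q)
    rw [chowContent_eq_top hw' h, Ideal.top_pow]
    exact le_top
  · have hmin : Q.asIdeal ∈ J.minimalPrimes := by
      refine ⟨⟨Q.isPrime, hJQ⟩, fun Q' hQ' hle => ?_⟩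
      by_contra hn
      have := hQ'.1
      have h1 := lt_of_ringKrullDim_eq (P := Q') (lt_of_le_not_ge hle hn)
        (ringKrullDim_eq_varietyDim ⟨Q', hQ'.1⟩) (ringKrullDim_eq_varietyDim Q)
      have h2 := hlt ⟨Q', hQ'.1⟩ hQ'.2
      omega
    rw [varietyContent, Nat.succ_eq_add_one] at *
    rw [h, EffCycle.ofIdeal_apply hmin]
    exact Ideal.pow_le_pow_right (hl.count_le_lengthAt hmin)

/-- Components inside the hyperplane do not change, the others obey the estimate for varieties; all
mixed terms of the resulting product are absorbed by the equation of the hyperplane. -/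
lemma valuativeLE_cycleContent_capDivisor (Z : EffCycle (MvPolynomial σ K)) (a : Option σ → K) :
    ValuativeLE (cycleContent (Z.capDivisor (affineForm a)))
      (cycleContent Z ⊔ Ideal.span {affineForm a}) := by
  classical
  rw [EffCycle.capDivisor, Finsupp.sum, cycleContent_sum]
  refine .trans (J := ∏ P ∈ Z.support, (varietyContent P ⊔ Ideal.span {affineForm a}) ^ Z P)
    (.prod fun P _ => ?_) (.of_le (Ideal.prod_sup_pow_le _ _ _ _))
  rw [cycleContent_smul]
  refine ValuativeLE.pow ?_ _
  split_ifs with h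
  · rw [cycleContent_single, pow_one]
    exact .of_le le_sup_left
  · exact valuativeLE_cycleContent_ofIdeal h

lemma exists_eq_affineForm {R : Type*} [CommRing R] {p : MvPolynomial σ R}
    (hp : p.totalDegree ≤ 1) : ∃ a : Option σ → R, p = affineForm a := by
  classical
  refine ⟨fun h => h.elim (p.coeff 0) fun j => p.coeff (Finsupp.single j 1), ?_⟩
  ext m
  simp only [affineForm, coeff_add, coeff_C, coeff_sum, coeff_C_mul, coeff_X, Option.elim]
  by_cases h0 : m = 0
  · subst h0
    simp
  rw [if_neg (Ne.symm h0), zero_add]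
  by_cases h1 : ∃ j, Finsupp.single j 1 = m
  · obtain ⟨j, rfl⟩ := h1
    simp [Finsupp.single_left_inj]
  · rw [Finset.sum_eq_zero fun j _ => by rw [if_neg fun h => h1 ⟨j, h⟩, mul_zero]]
    by_contra hm
    have h2 := (le_totalDegree (mem_support_iff.2 hm)).trans hp
    obtain ⟨j, hj⟩ := Finsupp.ne_iff.1 h0
    have h3 : Finsupp.single j 1 ≤ m := Finsupp.single_le_iff.2 (Nat.one_le_iff_ne_zero.2 hj)
    obtain ⟨q, rfl⟩ := exists_add_of_le h3
    have h4 : (Finsupp.single j 1 + q).degree ≤ 1 := h2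
    rw [map_add, Finsupp.degree_single] at h4
    have h5 : q = 0 := (Finsupp.degree_eq_zero_iff q).1 (by omega)
    exact h1 ⟨j, by rw [h5, add_zero]⟩

lemma valuativeLE_cycleContent_foldl (l : List (MvPolynomial σ K)) :
    ∀ Z : EffCycle (MvPolynomial σ K), (∀ p ∈ l, p.totalDegree ≤ 1) →
      ValuativeLE (cycleContent (l.foldl EffCycle.capDivisor Z))
        (cycleContent Z ⊔ Ideal.span {p | p ∈ l}) := by
  induction l with
  | nil => exact fun Z _ => .of_le le_sup_left
  | cons p l ih =>
    intro Z h
    obtain ⟨a, rfl⟩ := exists_eq_affineForm (h p List.mem_cons_self)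
    refine .trans (ih _ fun q hq => h q (List.mem_cons_of_mem _ hq)) ?_
    refine .trans ((valuativeLE_cycleContent_capDivisor Z a).sup_right _) (.of_le ?_)
    rw [sup_assoc]
    refine sup_le_sup_left (sup_le ?_ ?_) _
    · rw [Ideal.span_singleton_le_iff_mem]
      exact Ideal.subset_span List.mem_cons_self
    · exact Ideal.span_mono fun q hq => List.mem_cons_of_mem _ hq

end CycleContent

/-! ### Degrees of finite morphisms onto hypersurfaces -/

section Basis

variable {S T : Type*} [CommRing S] [CommRing T]

/-- The span is a finite-dimensional space containing the image of `T` and stable under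
multiplication by it. Multiplication by a nonzero `β y` is injective, hence surjective, so the span
also contains the inverse of `β y`. -/
lemma SpansModulo.span_range_eq_top {φ : S →+* T} {P : Ideal T} {κ : Type*} [Fintype κ]
    {u : κ → T} (hu : SpansModulo φ P u) {F₁ F₂ : Type*} [Field F₁] [Field F₂] [Algebra F₁ F₂]
    (α : S →+* F₁) (β : T →+* F₂) (hαβ : ∀ s, algebraMap F₁ F₂ (α s) = β (φ s))
    (hP : ∀ x ∈ P, β x = 0) (hβ : ∀ z, ∃ x y, β y ≠ 0 ∧ z = β x / β y) :
    Submodule.span F₁ (Set.range (β ∘ u)) = ⊤ := by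
  set W := Submodule.span F₁ (Set.range (β ∘ u)) with hW
  have hTW : ∀ x, β x ∈ W := fun x => by
    obtain ⟨c, hc⟩ := hu x
    have h1 := hP _ hc
    rw [map_sub, sub_eq_zero, map_sum] at h1
    rw [h1]
    refine Submodule.sum_mem _ fun i _ => ?_
    rw [map_mul, ← hαβ, ← Algebra.smul_def]
    exact Submodule.smul_mem _ _ (Submodule.subset_span ⟨i, rfl⟩)
  have hmul : ∀ x, ∀ w ∈ W, β x * w ∈ W := fun x w hw => by
    refine Submodule.span_induction (p := fun w _ => β x * w ∈ W) ?_ ?_ ?_ ?_ hw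
    · rintro _ ⟨i, rfl⟩
      rw [Function.comp, ← map_mul]
      exact hTW _
    · rw [mul_zero]
      exact W.zero_mem
    · intro a b _ _ ha hb
      rw [mul_add]
      exact W.add_mem ha hb
    · intro a b _ hb
      rw [mul_smul_comm]
      exact W.smul_mem _ hb
  have hfin : FiniteDimensional F₁ W := FiniteDimensional.span_of_finite F₁ (Set.finite_range _)
  rw [eq_top_iff]
  rintro z -
  obtain ⟨x, y, hy, rfl⟩ := hβ z
  let f : W →ₗ[F₁] W := ((LinearMap.mulLeft F₁ (β y)).domRestrict W).codRestrict W
    fun w => hmul y w w.2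
  have hf : Function.Injective f := fun a b h => by
    have h1 : β y * a = β y * b := congrArg Subtype.val h
    exact Subtype.ext (mul_left_cancel₀ hy h1)
  obtain ⟨w, hw⟩ := LinearMap.injective_iff_surjective.1 hf ⟨β 1, hTW 1⟩
  have h1 : β y * w = β 1 := congrArg Subtype.val hw
  rw [map_one] at h1
  rw [div_eq_mul_inv, inv_eq_of_mul_eq_one_right h1]
  exact hmul _ _ w.2

lemma exists_common_denominator {F : Type*} [Field F] (α : S →+* F)
    (hα : ∀ z, ∃ x y, α y ≠ 0 ∧ z = α x / α y) {κ : Type*} [Fintype κ] (z : κ → F) :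
    ∃ s : S, α s ≠ 0 ∧ ∀ k, ∃ c, α s * z k = α c := by
  classical
  choose x y hy hz using fun k => hα (z k)
  refine ⟨∏ k, y k, ?_, fun k => ⟨x k * ∏ j ∈ Finset.univ.erase k, y j, ?_⟩⟩
  · rw [map_prod]
    exact Finset.prod_ne_zero_iff.2 fun k _ => hy k
  · rw [← Finset.mul_prod_erase _ _ (Finset.mem_univ k), map_mul, map_mul, hz k]
    field_simp [hy k]

/-- A basis of `F₂` over `F₁` is selected among the images of the generators, and `s` is a common
denominator of the coordinates of all generators. -/
lemma SpansModulo.exists_basis {φ : S →+* T} {P : Ideal T} {κ : Type*} [Fintype κ]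
    {u : κ → T} (hu : SpansModulo φ P u) {F₁ F₂ : Type*} [Field F₁] [Field F₂] [Algebra F₁ F₂]
    (α : S →+* F₁) (β : T →+* F₂) (hαβ : ∀ s, algebraMap F₁ F₂ (α s) = β (φ s))
    (hP : ∀ x, β x = 0 ↔ x ∈ P) (hα : ∀ z, ∃ x y, α y ≠ 0 ∧ z = α x / α y)
    (hβ : ∀ z, ∃ x y, β y ≠ 0 ∧ z = β x / β y) :
    ∃ (t : Fin (Module.finrank F₁ F₂) → T) (s : S), φ s ∉ P ∧
      (∀ c : Fin _ → S, ∑ i, φ (c i) * t i ∈ P → ∀ i, φ (c i) ∈ P) ∧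
      ∀ x, ∃ c : Fin _ → S, φ s * x - ∑ i, φ (c i) * t i ∈ P := by
  classical
  have htop := hu.span_range_eq_top α β hαβ (fun x => (hP x).2) hβ
  obtain ⟨ι, a, ha, hspan, hli⟩ := exists_linearIndependent' F₁ (β ∘ u)
  have : Finite ι := Finite.of_injective a ha
  have : Fintype ι := Fintype.ofFinite ι
  let B := Module.Basis.mk hli (hspan.trans htop).ge
  let e : ι ≃ Fin (Module.finrank F₁ F₂) :=
    Fintype.equivFinOfCardEq (Module.finrank_eq_card_basis B).symm
  let B' := B.reindex e
  set t : Fin (Module.finrank F₁ F₂) → T := fun i => u (a (e.symm i)) with ht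
  have hB' : ∀ i, B' i = β (t i) := fun i => by simp [B', B, ht]
  have hα0 : ∀ s, α s = 0 ↔ φ s ∈ P := fun s => by
    rw [← hP, ← hαβ, FaithfulSMul.algebraMap_eq_zero_iff F₁ F₂]
  have hsum : ∀ c : Fin (Module.finrank F₁ F₂) → S,
      β (∑ i, φ (c i) * t i) = ∑ i, α (c i) • B' i := fun c => by
    simp only [map_sum, map_mul, hB', Algebra.smul_def, hαβ]
  obtain ⟨s, hs, hsc⟩ := exists_common_denominator α hα
    fun p : κ × Fin (Module.finrank F₁ F₂) => B'.repr (β (u p.1)) p.2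
  choose c hc using hsc
  refine ⟨t, s, fun h => hs ((hα0 s).2 h), fun c hc i => ?_, fun x => ?_⟩
  · rw [← hα0]
    rw [← hP, hsum] at hc
    exact Fintype.linearIndependent_iff.1 B'.linearIndependent _ hc i
  · obtain ⟨d, hd⟩ := hu x
    refine ⟨fun i => ∑ k, d k * c (k, i), ?_⟩
    rw [← hP] at hd ⊢
    rw [map_sub, sub_eq_zero] at hd ⊢
    rw [map_mul, hd, hsum, map_sum, Finset.mul_sum]
    have h1 : ∀ k, β (φ s * u k) = ∑ i, α (c (k, i)) • B' i := fun k => by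
      rw [map_mul, ← hαβ, ← Algebra.smul_def]
      conv_lhs => rw [← B'.sum_repr (β (u k)), Finset.smul_sum]
      exact Finset.sum_congr rfl fun i _ => by rw [smul_smul, hc (k, i)]
    have h2 : ∀ k, β (φ s) * β (φ (d k) * u k) = ∑ i, α (d k * c (k, i)) • B' i := fun k => by
      rw [map_mul, mul_left_comm, ← map_mul β, h1, Finset.mul_sum]
      refine Finset.sum_congr rfl fun i _ => ?_
      rw [map_mul, mul_smul, Algebra.smul_def (α (d k)), hαβ]
    simp only [h2]
    rw [Finset.sum_comm]
    refine Finset.sum_congr rfl fun i _ => ?_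
    rw [map_sum, Finset.sum_smul]

lemma Ideal.exists_eq_div_residueField {A : Type*} [CommRing A] (P : Ideal A) [P.IsPrime]
    (z : P.ResidueField) : ∃ x y, algebraMap A P.ResidueField y ≠ 0 ∧
      z = algebraMap A P.ResidueField x / algebraMap A P.ResidueField y := by
  obtain ⟨x, y, hy, rfl⟩ := IsFractionRing.div_surjective (A ⧸ P) z
  obtain ⟨x, rfl⟩ := Ideal.Quotient.mk_surjective x
  obtain ⟨y, rfl⟩ := Ideal.Quotient.mk_surjective y
  refine ⟨x, y, ?_, ?_⟩
  · rw [Ne, Ideal.algebraMap_residueField_eq_zero, ← Ideal.Quotient.eq_zero_iff_mem]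
    exact nonZeroDivisors.ne_zero hy
  · rw [Ideal.algebraMap_quotient_residueField_mk, Ideal.algebraMap_quotient_residueField_mk]

/-- A finite extension of domains contains a free module of full rank, whose rank is the degree of
the extension of the fraction fields. -/
lemma SpansModulo.exists_basis_mapDegree {φ : S →+* T} {P : PrimeSpectrum T} {κ : Type*}
    [Fintype κ] {u : κ → T} (hu : SpansModulo φ P.asIdeal u) :
    ∃ (t : Fin (EffCycle.mapDegree φ P) → T) (s : S), φ s ∉ P.asIdeal ∧
      (∀ c : Fin _ → S, ∑ i, φ (c i) * t i ∈ P.asIdeal → ∀ i, φ (c i) ∈ P.asIdeal) ∧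
      ∀ x, ∃ c : Fin _ → S, φ s * x - ∑ i, φ (c i) * t i ∈ P.asIdeal := by
  let := (Ideal.ResidueField.map (PrimeSpectrum.comap φ P).asIdeal P.asIdeal φ rfl).toAlgebra
  exact hu.exists_basis (algebraMap S (PrimeSpectrum.comap φ P).asIdeal.ResidueField)
    (algebraMap T P.asIdeal.ResidueField)
    (fun s => Ideal.ResidueField.map_algebraMap _ _ φ rfl s)
    (fun x => P.asIdeal.algebraMap_residueField_eq_zero)
    (Ideal.exists_eq_div_residueField _) (Ideal.exists_eq_div_residueField _)

/-- A common divisor of the Fitting elements of a variety that is finite over a hypersurface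
`E = 0` divides the power of `E` whose exponent is the degree of the morphism. -/
lemma DvdFitting.dvd_pow_mapDegree {L σ τ : Type*} [Field L] {v : τ → MvPolynomial σ L}
    {P : PrimeSpectrum (MvPolynomial σ L)} (hv : FiniteOn v P.asIdeal) {E δ : MvPolynomial τ L}
    (hE : Prime E) (hE' : ∀ p, tupleHom v p ∈ P.asIdeal ↔ E ∣ p)
    (hδ : DvdFitting v P.asIdeal δ) : δ ∣ E ^ EffCycle.mapDegree (tupleHom v) P := by
  classical
  obtain ⟨b, u, hu⟩ := hv
  have hbasis := hu.exists_basis_mapDegree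
  generalize EffCycle.mapDegree (tupleHom v) P = N at hbasis ⊢
  obtain ⟨t, s, hs, -, hx⟩ := hbasis
  choose c hc using hx
  have hEP := (hE' E).2 dvd_rfl
  -- The relations `E t_i = 0` and `s u_k = ∑ c t_i` give the Fitting element `E ^ N * s ^ b`.
  have h1 := hδ _ (IsFittingElem.of_fintype (Sum.elim t u)
    (Matrix.fromBlocks (Matrix.diagonal fun _ : Fin N => E) 0
      (Matrix.of fun k i => - c (u k) i) (Matrix.diagonal fun _ : Fin b => s))
    (SpansModulo.sumElim_right t hu) (by
      rintro (i | k)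
      · rw [Fintype.sum_sum_type]
        simp only [Matrix.fromBlocks_apply₁₁, Matrix.fromBlocks_apply₁₂, Matrix.diagonal_apply,
          Matrix.zero_apply, map_zero, zero_mul, Finset.sum_const_zero, add_zero, apply_ite (tupleHom v),
          ite_mul, Finset.sum_ite_eq, Finset.mem_univ, if_true]
        exact Ideal.mul_mem_right _ _ hEP
      · rw [Fintype.sum_sum_type]
        convert hc (u k) using 1
        simp only [Matrix.fromBlocks_apply₂₁, Matrix.fromBlocks_apply₂₂, Matrix.diagonal_apply,
          Matrix.of_apply, map_neg, neg_mul, map_zero, zero_mul, apply_ite (tupleHom v),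
          ite_mul, Finset.sum_ite_eq, Finset.mem_univ, if_true, Sum.elim_inl, Sum.elim_inr,
          Finset.sum_neg_distrib, neg_add_eq_sub]))
  rw [Matrix.det_fromBlocks_zero₁₂, Matrix.det_diagonal, Matrix.det_diagonal] at h1
  simp only [Finset.prod_const, Finset.card_univ, Fintype.card_fin] at h1
  -- Since `E` annihilates the module, `δ` is also a power of `E` up to a unit. Comparison with the
  -- first element bounds the exponent by `N`, as `E` does not divide `s`.
  have h2 := hδ _ (hu.isFittingElem_pow hEP)
  obtain ⟨j, -, hj⟩ := (dvd_prime_pow hE _).1 h2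
  refine hj.dvd.trans (pow_dvd_pow E ?_)
  by_contra hlt
  rw [not_le] at hlt
  have h3 : E ^ (N + 1) ∣ E ^ N * s ^ b := (pow_dvd_pow E hlt).trans (hj.symm.dvd.trans h1)
  rw [pow_succ, mul_dvd_mul_iff_left (pow_ne_zero _ hE.ne_zero)] at h3
  exact hs ((hE' s).2 (hE.dvd_of_dvd_pow h3))

end Basis

/-! ### Chow equations lie in the content -/

section ChowEquations

universe u

variable {K : Type u} [Field K] {n : ℕ}

lemma EffCycle.linComorphism_eq_tupleHom {d : ℕ} (M : Matrix (Fin (d + 1)) (Fin n) K) :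
    EffCycle.linComorphism M =
      tupleHom fun i => affineForm fun h : Option (Fin n) => h.elim 0 (M i) := by
  refine MvPolynomial.ringHom_ext (fun a => ?_) fun i => ?_
  · simp [EffCycle.linComorphism]
  · simp [EffCycle.linComorphism, affineForm]

/-- The pull-back of the equation of a projection of a variety lies in its content. -/
lemma EffCycle.map_linComorphism_le {k : Type u} [Field k] [Algebra K k]
    {P : PrimeSpectrum (MvPolynomial (Fin n) K)} {P' : PrimeSpectrum (MvPolynomial (Fin n) k)}
    (hP : P'.asIdeal = extIdeal (algebraMap K k) P.asIdeal) {d : ℕ}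
    (hd : ringKrullDim (MvPolynomial (Fin n) k ⧸ P'.asIdeal) = d)
    {M : Matrix (Fin (d + 1)) (Fin n) k}
    (hM : ((Ideal.Quotient.mk P'.asIdeal).comp (EffCycle.linComorphism M)).Finite) :
    ((PrimeSpectrum.comap (EffCycle.linComorphism M) P').asIdeal ^
      EffCycle.mapDegree (EffCycle.linComorphism M) P').map (EffCycle.linComorphism M) ≤
        extIdeal (algebraMap K k) (varietyContent P) := by
  have hdim := ringKrullDim_eq_varietyDim P
  obtain rfl : varietyDim P = d := by
    have := P'.isPrime
    rw [hP, ringKrullDim_extIdeal hdim] at hd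
    exact_mod_cast hd
  rw [EffCycle.linComorphism_eq_tupleHom] at hM ⊢
  set b : Fin (varietyDim P + 1) → Option (Fin n) → k := fun i h => h.elim 0 (M i)
  have hfin : FiniteOn (fun i => affineForm (b i)) P'.asIdeal := (finiteOn_iff_finite _ _).2 hM
  obtain ⟨E, hE, hE'⟩ := hfin.exists_prime_dvd_iff hd
  obtain ⟨w, hw, -⟩ := exists_parameters hdim
  -- The divisor `δ` obtained by specialising the generic Chow form divides `E` to the degree of the
  -- projection, the equation of the push-forward, so the pull-back of the latter is a multiple of a
  -- member of the content.
  obtain ⟨δ, hδ, hδI⟩ := hasChowForm_affineForm hw (Nat.lt_succ_self _) b (hP ▸ hfin)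
  rw [← hP] at hδ
  have h1 : (PrimeSpectrum.comap (tupleHom fun i => affineForm (b i)) P').asIdeal =
      Ideal.span {E} := by
    ext p
    rw [Ideal.mem_span_singleton, ← hE']
    rfl
  rw [h1, Ideal.span_singleton_pow, Ideal.map_span, Set.image_singleton,
    Ideal.span_singleton_le_iff_mem]
  obtain ⟨q, hq⟩ := hδ.dvd_pow_mapDegree hfin hE hE'
  rw [hq, map_mul]
  exact Ideal.mul_mem_right _ _ hδI

/-- The ideal of the push-forward is the product of the ideals of the pushed-forward components, so
the bound can be checked component by component. The bounding ideals `c P` are left free in order to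
cover both the field `K` and `K(t)`. -/
lemma EffCycle.chowIdealPure_le {d : ℕ} {Z : EffCycle (MvPolynomial (Fin n) K)}
    {c : PrimeSpectrum (MvPolynomial (Fin n) K) → Ideal (MvPolynomial (Fin n) K)}
    (hc : ∀ P ∈ Z.support, ∀ M : Matrix (Fin (d + 1)) (Fin n) K,
      ((Ideal.Quotient.mk P.asIdeal).comp (EffCycle.linComorphism M)).Finite →
      ((PrimeSpectrum.comap (EffCycle.linComorphism M) P).asIdeal ^
        EffCycle.mapDegree (EffCycle.linComorphism M) P).map (EffCycle.linComorphism M) ≤ c P) :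
    EffCycle.chowIdealPure d Z ≤ Z.prod fun P a => c P ^ a := by
  rw [EffCycle.chowIdealPure, Ideal.span_le]
  rintro _ ⟨M, hM, g, hg, rfl⟩
  have h1 : EffCycle.linComorphism M g ∈
      (Ideal.span {g}).map (EffCycle.linComorphism M) :=
    Ideal.mem_map_of_mem _ (Ideal.mem_span_singleton_self g)
  have h2 : (EffCycle.pushforward (EffCycle.linComorphism M) Z).ideal = ∏ P ∈ Z.support,
      ((PrimeSpectrum.comap (EffCycle.linComorphism M) P).asIdeal ^
        EffCycle.mapDegree (EffCycle.linComorphism M) P) ^ Z P := by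
    rw [EffCycle.pushforward, Finsupp.sum, EffCycle.ideal, ← Finsupp.prod_finsetSum_index
      (fun _ => pow_zero _) (fun _ _ _ => pow_add _ _ _)]
    refine Finset.prod_congr rfl fun P _ => ?_
    refine (Finsupp.prod_single_index ?_).trans ?_
    · exact pow_zero _
    rw [← pow_mul, mul_comm]
  rw [hg, h2] at h1
  change _ ∈ Ideal.mapHom (EffCycle.linComorphism M) _ at h1
  rw [map_prod] at h1
  refine Ideal.prod_le_prod_of_le (fun P hP => ?_) h1
  rw [map_pow]
  exact Ideal.pow_right_mono (hc P hP M (hM.2 P hP)) _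

lemma EffCycle.chowIdealOfInfinite_le {Z : EffCycle (MvPolynomial (Fin n) K)}
    {c : PrimeSpectrum (MvPolynomial (Fin n) K) → Ideal (MvPolynomial (Fin n) K)}
    (hc : ∀ P ∈ Z.support, ∀ (d : ℕ) (M : Matrix (Fin (d + 1)) (Fin n) K),
      ringKrullDim (MvPolynomial (Fin n) K ⧸ P.asIdeal) = d →
      ((Ideal.Quotient.mk P.asIdeal).comp (EffCycle.linComorphism M)).Finite →
      ((PrimeSpectrum.comap (EffCycle.linComorphism M) P).asIdeal ^
        EffCycle.mapDegree (EffCycle.linComorphism M) P).map (EffCycle.linComorphism M) ≤ c P) :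
    EffCycle.chowIdealOfInfinite Z ≤ Z.prod fun P a => c P ^ a := by
  classical
  have h1 : Z = ∑ d ∈ (Finset.range (n + 1)).filter (fun d => EffCycle.purePart d Z ≠ 0),
      EffCycle.purePart d Z := by
    rw [Finset.sum_filter_ne_zero]
    ext P
    rw [Finsupp.finsetSum_apply, Finset.sum_eq_single (varietyDim P)]
    · rw [EffCycle.purePart, Finsupp.filter_apply, if_pos (ringKrullDim_eq_varietyDim P)]
    · intro d _ hd
      rw [EffCycle.purePart, Finsupp.filter_apply, if_neg]
      rw [ringKrullDim_eq_varietyDim P]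
      exact_mod_cast hd.symm
    · intro h
      refine absurd ?_ h
      have h2 := ringKrullDim_quotient_le P.asIdeal
      rw [ringKrullDim_eq_varietyDim, MvPolynomial.ringKrullDim_of_isNoetherianRing,
        ringKrullDim_eq_zero_of_field, zero_add, Nat.card_fin] at h2
      have h3 : varietyDim P ≤ n := by exact_mod_cast h2
      exact Finset.mem_range.2 (by omega)
  conv_rhs => rw [h1]
  rw [← Finsupp.prod_finsetSum_index (fun _ => pow_zero _) (fun _ _ _ => pow_add _ _ _)]
  refine Ideal.prod_le_prod_of_le fun d _ => EffCycle.chowIdealPure_le fun P hP M hM => ?_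
  rw [EffCycle.purePart, Finsupp.support_filter, Finset.mem_filter] at hP
  exact hc P hP.1 d M hP.2 hM

lemma EffCycle.ofIdeal_isPrime {A : Type*} [CommRing A] [IsNoetherianRing A]
    (P : PrimeSpectrum A) : EffCycle.ofIdeal P.asIdeal = Finsupp.single P 1 := by
  classical
  have hmin : P.asIdeal.minimalPrimes = {P.asIdeal} := Ideal.minimalPrimes_eq_subsingleton_self
  ext Q
  by_cases hQ : Q = P
  · subst hQ
    rw [Finsupp.single_eq_same, EffCycle.ofIdeal_apply (by rw [hmin]; rfl), EffCycle.lengthAt,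
      Localization.AtPrime.map_eq_maximalIdeal]
    have : IsSimpleModule (Localization.AtPrime Q.asIdeal) (Localization.AtPrime Q.asIdeal ⧸
        IsLocalRing.maximalIdeal (Localization.AtPrime Q.asIdeal)) :=
      isSimpleModule_iff_isCoatom.2 (IsLocalRing.maximalIdeal.isMaximal _).out
    rw [Module.length_eq_one, ENat.toNat_one]
  · rw [Finsupp.single_eq_of_ne hQ, EffCycle.ofIdeal, Finsupp.onFinset_apply, if_neg]
    rw [hmin]
    exact fun h => hQ (PrimeSpectrum.ext h)

lemma isPrime_extIdeal_of_isFractionRing_polynomial {L : Type*} [Field L] [Algebra K L]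
    [Algebra (Polynomial K) L] [IsScalarTower K (Polynomial K) L] [IsFractionRing (Polynomial K) L]
    (P : Ideal (MvPolynomial (Fin n) K)) [P.IsPrime] : (extIdeal (algebraMap K L) P).IsPrime := by
  let e := MvPolynomial.uniqueAlgEquiv K Unit
  let _ : Algebra (MvPolynomial Unit K) L :=
    ((algebraMap (Polynomial K) L).comp (e : MvPolynomial Unit K →+* Polynomial K)).toAlgebra
  have : IsScalarTower K (MvPolynomial Unit K) L := .of_algebraMap_eq fun x => by
    rw [IsScalarTower.algebraMap_apply K (Polynomial K) L, ← e.commutes x]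
    rfl
  have : IsFractionRing (MvPolynomial Unit K) L := by
    have h := IsLocalization.isLocalization_of_base_ringEquiv (nonZeroDivisors (Polynomial K))
      L e.toRingEquiv.symm
    have h2 : (nonZeroDivisors (Polynomial K)).map e.toRingEquiv.symm =
        nonZeroDivisors (MvPolynomial Unit K) :=
      MulEquivClass.map_nonZeroDivisors e.toRingEquiv.symm
    rw [h2] at h
    exact h
  exact isPrime_extIdeal_of_isFractionRing (ι := Unit) P

lemma extIdeal_self {R σ : Type*} [CommRing R] (I : Ideal (MvPolynomial σ R)) :
    extIdeal (algebraMap R R) I = I := by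
  have h : MvPolynomial.map (algebraMap R R) = RingHom.id (MvPolynomial σ R) :=
    RingHom.ext fun p => MvPolynomial.map_id p
  rw [extIdeal, h, Ideal.map_id]

/-- The ideal of Chow equations is contained in the content. -/
lemma EffCycle.chowIdeal_le_cycleContent (Z : EffCycle (MvPolynomial (Fin n) K)) :
    EffCycle.chowIdeal Z ≤ cycleContent Z := by
  classical
  rw [EffCycle.chowIdeal]
  split_ifs with hK
  · refine EffCycle.chowIdealOfInfinite_le fun P _ d M hd hM => ?_
    exact (EffCycle.map_linComorphism_le (extIdeal_self P.asIdeal).symm hd hM).trans_eq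
      (extIdeal_self _)
  -- Primes stay prime over `K(t)`, so the extended cycle has the same coefficients. Each component
  -- over `K(t)` is bounded by the extension of the content of its contraction, and membership
  -- descends to `K`.
  · set k := RatFunc K
    let ext : PrimeSpectrum (MvPolynomial (Fin n) K) → PrimeSpectrum (MvPolynomial (Fin n) k) :=
      fun P => ⟨extIdeal (algebraMap K k) P.asIdeal, isPrime_extIdeal_of_isFractionRing_polynomial P.asIdeal⟩
    have hcomap : ∀ P, PrimeSpectrum.comap (MvPolynomial.map (algebraMap K k)) (ext P) = P := by
      intro P
      ext p
      exact map_mem_map_iff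
    have hZ : EffCycle.baseChange k Z = Z.sum fun P a => Finsupp.single (ext P) a := by
      rw [EffCycle.baseChange]
      refine Finset.sum_congr rfl fun P _ => ?_
      change Z P • EffCycle.ofIdeal (ext P).asIdeal = _
      rw [EffCycle.ofIdeal_isPrime, Finsupp.smul_single, smul_eq_mul, mul_one]
    intro f hf
    rw [Ideal.mem_comap] at hf
    have h1 := EffCycle.chowIdealOfInfinite_le (Z := EffCycle.baseChange k Z)
      (c := fun P' => extIdeal (algebraMap K k) (varietyContent
        (PrimeSpectrum.comap (MvPolynomial.map (algebraMap K k)) P'))) (by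
          intro P' hP' d M hd hM
          rw [hZ] at hP'
          obtain ⟨P, -, hP⟩ := Finset.mem_biUnion.1 (Finsupp.support_sum hP')
          have := Finset.mem_singleton.1 (Finsupp.support_single_subset hP)
          subst this
          rw [hcomap]
          exact EffCycle.map_linComorphism_le rfl hd hM) hf
    rw [hZ, Finsupp.sum, ← Finsupp.prod_finsetSum_index (fun _ => pow_zero _)
      (fun _ _ _ => pow_add _ _ _)] at h1
    have h2 : ∏ P ∈ Z.support, ((Finsupp.single (ext P) (Z P)).prod fun P' a =>
        extIdeal (algebraMap K k) (varietyContent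
        (PrimeSpectrum.comap (MvPolynomial.map (algebraMap K k)) P')) ^ a) =
        extIdeal (algebraMap K k) (cycleContent Z) := by
      change _ = Ideal.mapHom (MvPolynomial.map (algebraMap K k)) _
      rw [cycleContent, Finsupp.prod, map_prod]
      refine Finset.prod_congr rfl fun P _ => ?_
      refine (Finsupp.prod_single_index ?_).trans ?_
      · exact pow_zero _
      rw [hcomap, map_pow]
      rfl
    rw [h2] at h1
    exact map_mem_map_iff.1 h1

end ChowEquations

/-! ### Contents of varieties in a linear subspace -/

section LinearSubspace

universe u

lemma totalDegree_affineForm_le {R σ : Type*} [CommRing R] [Nontrivial R] [Fintype σ]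
    (a : Option σ → R) : (affineForm a).totalDegree ≤ 1 := by
  refine (totalDegree_add _ _).trans (max_le (by simp) ?_)
  refine totalDegree_finsetSum_le fun j _ => (totalDegree_mul _ _).trans ?_
  simp

lemma tupleHom_rename {R σ σ' τ : Type*} [CommRing R] (t : σ → σ') (v : τ → MvPolynomial σ R)
    (p : MvPolynomial τ R) : tupleHom (fun i => rename t (v i)) p = rename t (tupleHom v p) := by
  induction p using MvPolynomial.induction_on with
  | C a => rw [tupleHom_C, tupleHom_C, rename_C]
  | add f g hf hg => simp only [map_add, hf, hg]
  | mul_X f i hf => simp only [map_mul, hf, tupleHom_X]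

lemma rename_mem_extIdeal {R R' σ σ' : Type*} [CommRing R] [CommRing R'] {f : R →+* R'}
    {t : σ → σ'} {I : Ideal (MvPolynomial σ R)} {I' : Ideal (MvPolynomial σ' R)}
    (h : ∀ p ∈ I, rename t p ∈ I') {x : MvPolynomial σ R'} (hx : x ∈ extIdeal f I) :
    rename t x ∈ extIdeal f I' := by
  have h1 : extIdeal f I ≤ (extIdeal f I').comap
      (rename t : MvPolynomial σ R' →ₐ[R'] MvPolynomial σ' R') := by
    rw [extIdeal, Ideal.map_le_iff_le_comap]
    intro p hp
    rw [Ideal.mem_comap, Ideal.mem_comap]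
    change rename t (map f p) ∈ _
    rw [← map_rename]
    exact Ideal.mem_map_of_mem _ (h p hp)
  exact h1 hx

variable {K : Type u} [Field K] {σ σ' : Type} {s : σ' → σ} {t : σ → σ'}

/-- The kernel of `rename s` contains every `X i - X (t (s i))`. Hence modulo `P'` every polynomial
comes from the smaller set of variables. -/
lemma sub_rename_mem_extIdeal (hst : ∀ j, s (t j) = j) {L : Type*} [Field L] [Algebra K L]
    {P' : Ideal (MvPolynomial σ' K)}
    (h : RingHom.ker (rename s : MvPolynomial σ' K →ₐ[K] MvPolynomial σ K) ≤ P')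
    (y : MvPolynomial σ' L) : y - rename t (rename s y) ∈ extIdeal (algebraMap K L) P' := by
  rw [← Ideal.Quotient.eq]
  induction y using MvPolynomial.induction_on with
  | C a => rw [rename_C, rename_C]
  | add p q hp hq => simp only [map_add, hp, hq]
  | mul_X p i hp =>
    rw [map_mul (rename s), map_mul (rename t), map_mul, map_mul, ← hp]
    congr 1
    rw [rename_X, rename_X, Ideal.Quotient.eq]
    have h1 : X i - X (t (s i)) ∈ P' := h (by simp [RingHom.mem_ker, hst])
    simpa using Ideal.mem_map_of_mem (map (algebraMap K L)) h1

variable [Fintype σ] [Fintype σ']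

lemma varietyDim_comap_rename (hst : ∀ j, s (t j) = j) {P' : PrimeSpectrum (MvPolynomial σ' K)}
    (h : RingHom.ker (rename s : MvPolynomial σ' K →ₐ[K] MvPolynomial σ K) ≤ P'.asIdeal) :
    varietyDim (PrimeSpectrum.comap (rename t : MvPolynomial σ K →ₐ[K] _).toRingHom P') =
      varietyDim P' := by
  have h1 := ringKrullDim_eq_varietyDim P'
  rw [ringKrullDim_eq_of_isIntegral (Ideal.quotientMap P'.asIdeal
    (rename t : MvPolynomial σ K →ₐ[K] _).toRingHom le_rfl) ?_
    (Ideal.quotientMap_injective (I := P'.asIdeal))] at h1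
  · have h2 := ringKrullDim_eq_varietyDim
      (PrimeSpectrum.comap (rename t : MvPolynomial σ K →ₐ[K] _).toRingHom P')
    exact_mod_cast h2.symm.trans h1
  · refine RingHom.isIntegral_of_surjective _ fun x => ?_
    obtain ⟨y, rfl⟩ := Ideal.Quotient.mk_surjective x
    refine ⟨Ideal.Quotient.mk _ (rename s y), ?_⟩
    rw [Ideal.quotientMap_mk, eq_comm, Ideal.Quotient.eq]
    have h2 := sub_rename_mem_extIdeal hst (L := K) h y
    rwa [extIdeal_self] at h2

/-- Comparison of the contents of a variety as a subvariety of an affine space and of a linear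
subspace. -/
lemma varietyContent_comap_rename_le (hst : ∀ j, s (t j) = j)
    {P' : PrimeSpectrum (MvPolynomial σ' K)}
    (h : RingHom.ker (rename s : MvPolynomial σ' K →ₐ[K] MvPolynomial σ K) ≤ P'.asIdeal) :
    varietyContent (PrimeSpectrum.comap (rename t : MvPolynomial σ K →ₐ[K] _).toRingHom P') ≤
      (varietyContent P').map (rename s) := by
  set P := PrimeSpectrum.comap (rename t : MvPolynomial σ K →ₐ[K] _).toRingHom P' with hP
  obtain ⟨w, hw, -⟩ := exists_parameters (ringKrullDim_eq_varietyDim P)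
  have hd' := ringKrullDim_eq_varietyDim P'
  rw [varietyContent, varietyContent]
  rw [← varietyDim_comap_rename hst h, ← hP] at hd' ⊢
  obtain ⟨w', hw', -⟩ := exists_parameters hd'
  clear hd'
  generalize varietyDim P = d at w hw w' hw' ⊢
  set L := GenericField K (d + 1) σ
  rw [chowContent_le_iff]
  set U := genericTuple K (d + 1) σ with hU
  -- The generic forms of the subspace are pulled back by a linear projection of the ambient space.
  -- They are finite on the variety there, so a Chow form `δ` with value in the ambient content
  -- exists; Fitting elements on the subspace remain Fitting elements, so `δ` divides the generic
  -- Chow form.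
  let v : Fin (d + 1) → MvPolynomial σ' L := fun i => rename t (U i)
  have hv : ∀ q, tupleHom v q = rename t (tupleHom U q) := tupleHom_rename t U
  have hJ : ∀ x ∈ extIdeal (algebraMap K L) P.asIdeal,
      (rename t : MvPolynomial σ L →ₐ[L] _).toRingHom x ∈ extIdeal (algebraMap K L) P'.asIdeal :=
    fun x hx => rename_mem_extIdeal (fun p hp => hp) hx
  have hspan : ∀ x : MvPolynomial σ' L, ∃ (n : ℕ) (c : Fin n → MvPolynomial (Fin (d + 1)) L)
      (y : Fin n → MvPolynomial σ L), x - ∑ k, tupleHom v (c k) *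
        (rename t : MvPolynomial σ L →ₐ[L] _).toRingHom (y k) ∈
          extIdeal (algebraMap K L) P'.asIdeal := fun x =>
    ⟨1, fun _ => 1, fun _ => rename s x, by
      simpa using sub_rename_mem_extIdeal hst (L := L) h x⟩
  choose b hb using fun i => exists_eq_affineForm (p := v i)
    ((totalDegree_rename_le _ _).trans (totalDegree_affineForm_le _))
  have hvb : v = fun i => affineForm (b i) := funext hb
  have hfin : FiniteOn v (extIdeal (algebraMap K L) P'.asIdeal) := by
    obtain ⟨n, x, hx⟩ : FiniteOn U (extIdeal (algebraMap K L) P.asIdeal) :=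
      finiteOn_genericTuple hw (Nat.le_succ d)
    exact ⟨n, _, hx.map (RingHom.id _) _ hv hJ hspan⟩
  obtain ⟨δ, hδ, hδI⟩ : HasChowForm P'.asIdeal (chowContent (d + 1) P'.asIdeal) v := by
    rw [hvb] at hfin ⊢
    exact hasChowForm_affineForm hw' (Nat.lt_succ_self d) b hfin
  have h1 : δ ∣ 1 * fittingGcd U (extIdeal (algebraMap K L) P.asIdeal) :=
    dvd_mul_fittingGcd fun g hg => by
      rw [one_mul]
      exact hδ g (hg.map (RingHom.id _) _ hv hJ hspan)
  obtain ⟨q, hq⟩ := h1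
  rw [one_mul] at hq
  rw [hq, map_mul]
  refine Ideal.mul_mem_right _ _ ?_
  have hs : ∀ y : MvPolynomial σ L, rename s (rename t y) = y := fun y => by
    rw [rename_rename, show s ∘ t = id from funext hst, rename_id_apply]
  have h2 := rename_mem_extIdeal (t := s) (I' := (chowContent (d + 1) P'.asIdeal).map
    (rename s : MvPolynomial σ' K →ₐ[K] MvPolynomial σ K))
    (fun p hp => Ideal.mem_map_of_mem _ hp) hδI
  rwa [hv, hs] at h2

end LinearSubspace

/-! ### The intersection cycle on the diagonal -/

section IntersectionCycle

universe u

lemma EffCycle.exists_le_of_mem_support_capDivisor {A : Type*} [CommRing A] [IsNoetherianRing A]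
    {Z : EffCycle A} {f : A} {P : PrimeSpectrum A} (hP : P ∈ (Z.capDivisor f).support) :
    f ∈ P.asIdeal ∧ ∃ Q ∈ Z.support, Q.asIdeal ≤ P.asIdeal := by
  classical
  obtain ⟨Q, hQ, hPQ⟩ := Finset.mem_biUnion.1 (Finsupp.support_sum hP)
  have h := Finsupp.support_smul hPQ
  split_ifs at h with hf
  · obtain rfl := Finset.mem_singleton.1 (Finsupp.support_single_subset h)
    exact ⟨hf, P, hQ, le_rfl⟩
  · have h1 : P.asIdeal ∈ (Q.asIdeal ⊔ Ideal.span {f}).minimalPrimes := by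
      by_contra hn
      rw [EffCycle.ofIdeal, Finsupp.mem_support_iff, Finsupp.onFinset_apply, if_neg hn] at h
      exact h rfl
    exact ⟨h1.1.2 (Ideal.mem_sup_right (Ideal.mem_span_singleton_self f)), Q, hQ,
      le_sup_left.trans h1.1.2⟩

lemma EffCycle.mem_of_mem_support_foldl {A : Type*} [CommRing A] [IsNoetherianRing A]
    {l : List A} : ∀ {Z : EffCycle A} {P : PrimeSpectrum A},
      P ∈ (l.foldl EffCycle.capDivisor Z).support →
      (∀ f ∈ l, f ∈ P.asIdeal) ∧ ∃ Q ∈ Z.support, Q.asIdeal ≤ P.asIdeal := by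
  induction l with
  | nil => exact fun {Z P} hP => ⟨by simp, P, hP, le_rfl⟩
  | cons f l ih =>
    intro Z P hP
    obtain ⟨h1, Q, hQ, hQP⟩ := ih hP
    obtain ⟨h2, R, hR, hRQ⟩ := EffCycle.exists_le_of_mem_support_capDivisor hQ
    refine ⟨fun g hg => ?_, R, hR, hRQ.trans hQP⟩
    rcases List.mem_cons.1 hg with rfl | hg
    exacts [hQP h2, h1 g hg]

variable {K : Type u} [Field K] {n m : ℕ}

/-- Every component of the final cycle contains all `ℓ k` in its ideal, hence lies on the diagonal,
and the comparison for linear subspaces applies to it. -/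
lemma EffCycle.cycleContent_vtCycle_le (Z : Fin m → EffCycle (MvPolynomial (Fin n) K))
    {ℓ : Fin (n * (m - 1)) → MvPolynomial (Fin m × Fin n) K}
    (hℓ : EffCycle.IsDiagonalSystem ℓ) (r : Fin m) :
    cycleContent (EffCycle.vtCycle Z ℓ r) ≤
      (cycleContent ((List.ofFn ℓ).foldl EffCycle.capDivisor (EffCycle.prodCycle Z))).map
        (rename Prod.snd : MvPolynomial (Fin m × Fin n) K →ₐ[K] MvPolynomial (Fin n) K) := by
  rw [EffCycle.vtCycle, cycleContent, Finsupp.prod_mapDomain_index (fun _ => pow_zero _)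
    (fun _ _ _ => pow_add _ _ _)]
  change _ ≤ Ideal.mapHom (rename Prod.snd :
    MvPolynomial (Fin m × Fin n) K →ₐ[K] MvPolynomial (Fin n) K) _
  rw [cycleContent, Finsupp.prod, Finsupp.prod, map_prod]
  refine Ideal.prod_le_prod_of_le fun P hP => ?_
  rw [map_pow]
  refine Ideal.pow_right_mono (varietyContent_comap_rename_le (fun _ => rfl) ?_) _
  change EffCycle.diagonalIdeal K m n ≤ _
  rw [← hℓ.2, Ideal.span_le]
  rintro _ ⟨k, rfl⟩
  exact (EffCycle.mem_of_mem_support_foldl hP).1 _ ((List.mem_ofFn' _ _).2 ⟨k, rfl⟩)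

/-- The theorem follows from the corresponding property of the product cycle. -/
lemma EffCycle.isIntegralElem_of_mem_chowIdeal_vtCycle
    {Z : Fin m → EffCycle (MvPolynomial (Fin n) K)}
    {ℓ : Fin (n * (m - 1)) → MvPolynomial (Fin m × Fin n) K}
    (hℓ : EffCycle.IsDiagonalSystem ℓ) (r : Fin m) {I : Ideal (MvPolynomial (Fin n) K)}
    (hI : (EffCycle.prodCycle Z).ideal.map
      (rename Prod.snd : MvPolynomial (Fin m × Fin n) K →ₐ[K] MvPolynomial (Fin n) K) ≤ I)
    {f : MvPolynomial (Fin n) K} (hf : f ∈ EffCycle.chowIdeal (EffCycle.vtCycle Z ℓ r)) :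
    I.IsIntegralElem f := by
  refine Ideal.isIntegralElem_of_valuationSubring fun V g => ?_
  set π : MvPolynomial (Fin m × Fin n) K →+* MvPolynomial (Fin n) K :=
    (rename Prod.snd : MvPolynomial (Fin m × Fin n) K →ₐ[K] MvPolynomial (Fin n) K).toRingHom
  have h1 := EffCycle.cycleContent_vtCycle_le Z hℓ r (EffCycle.chowIdeal_le_cycleContent _ hf)
  have h2 := Ideal.mem_map_of_mem g h1
  have h3 : Ideal.map (rename Prod.snd :
      MvPolynomial (Fin m × Fin n) K →ₐ[K] MvPolynomial (Fin n) K) (cycleContent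
      ((List.ofFn ℓ).foldl EffCycle.capDivisor (EffCycle.prodCycle Z))) = Ideal.map π _ := rfl
  rw [h3, Ideal.map_map] at h2
  -- The estimate is used for the restriction to the diagonal followed by `g`; this composite kills
  -- the equations `ℓ k`.
  have h4 := valuativeLE_cycleContent_foldl (List.ofFn ℓ) (EffCycle.prodCycle Z) (by
    intro p hp
    obtain ⟨k, rfl⟩ := (List.mem_ofFn' _ _).1 hp
    exact (hℓ.1 k).le) V (g.comp π) h2
  rw [Ideal.map_sup] at h4
  refine (sup_le ?_ ?_ : _ ≤ I.map g) h4
  · rw [← Ideal.map_map]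
    exact Ideal.map_mono ((Ideal.map_mono (cycleContent_le_ideal _)).trans hI)
  · rw [Ideal.map_span, Ideal.span_le]
    rintro _ ⟨p, hp, rfl⟩
    obtain ⟨k, rfl⟩ := (List.mem_ofFn' _ _).1 hp
    have h5 : ℓ k ∈ EffCycle.diagonalIdeal K m n := by
      rw [← hℓ.2]
      exact Ideal.subset_span ⟨k, rfl⟩
    have h6 : π (ℓ k) = 0 := h5
    rw [RingHom.comp_apply, h6, map_zero]
    exact Ideal.zero_mem _

end IntersectionCycle

/-! ### Ideals without embedded primes -/

section Unmixed

variable {A : Type*} [CommRing A] [IsNoetherianRing A]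

/-- If the power `n + 1` of the maximal ideal is not contained in `I`, adding it to `I` lowers the
coheight, so by induction the sum contains the power `n`. The lemma of Nakayama removes the added
summand. -/
lemma IsLocalRing.maximalIdeal_pow_le_of_coheight_le {B : Type*} [CommRing B] [IsLocalRing B]
    [IsNoetherianRing B] (n : ℕ) : ∀ I : Ideal B, Order.coheight I ≤ n →
      IsLocalRing.maximalIdeal B ^ n ≤ I := by
  induction n with
  | zero =>
    intro I hI
    have : I = ⊤ := by simpa using hI
    rw [this]
    exact le_top
  | succ n ih =>
    intro I hI
    by_contra hn
    set J := I ⊔ IsLocalRing.maximalIdeal B ^ (n + 1) with hJ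
    have hlt : I < J := lt_of_le_not_ge le_sup_left fun h => hn (le_sup_right.trans h)
    have h1 := (Order.coheight_add_one_le hlt).trans hI
    have h2 : Order.coheight J ≤ n := by
      push_cast at h1
      exact (ENat.add_le_add_iff_right (by simp)).1 h1
    have h3 := ih J h2
    refine hn ((Ideal.pow_le_pow_right (Nat.le_succ n)).trans ?_)
    refine Submodule.le_of_le_smul_of_le_jacobson_bot (I := IsLocalRing.maximalIdeal B)
      (IsNoetherian.noetherian _) (IsLocalRing.maximalIdeal_le_jacobson _) ?_
    rwa [smul_eq_mul, ← pow_succ']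

/-- If an ideal has no embedded primes, then it contains the ideal of its cycle. -/
lemma EffCycle.ofIdeal_ideal_le {J : Ideal A}
    (h : ∀ (Q : Ideal A) (r : A), Q.IsPrime → (∀ x, x ∈ Q ↔ x * r ∈ J) → Q ∈ J.minimalPrimes) :
    (EffCycle.ofIdeal J).ideal ≤ J := by
  intro r hr
  by_contra hrJ
  have hr0 : (Ideal.Quotient.mk J r) ≠ 0 := by rwa [Ne, Ideal.Quotient.eq_zero_iff_mem]
  -- The annihilator of `r` modulo `J` lies in an associated prime `Q`, which is minimal over `J`.
  -- Locally at `Q`, the power of the maximal ideal given by the length lies in `J`, so an element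
  -- outside `Q` kills `r`, a contradiction.
  obtain ⟨Q, hQ, hrQ⟩ := exists_le_isAssociatedPrime_of_isNoetherianRing A _ hr0
  obtain ⟨hQp, x, hx⟩ := isAssociatedPrime_iff.1 hQ
  obtain ⟨y, rfl⟩ := Ideal.Quotient.mk_surjective x
  have hcolon : ∀ a b : A, a ∈ (⊥ : Submodule A (A ⧸ J)).colon {Ideal.Quotient.mk J b} ↔
      a * b ∈ J := fun a b => by
    rw [Submodule.mem_colon_singleton, Submodule.mem_bot, ← Ideal.Quotient.eq_zero_iff_mem, map_mul]
    rfl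
  have hmin := h Q y hQp fun a => by rw [hx, hcolon]
  let P : PrimeSpectrum A := ⟨Q, hQp⟩
  have hlen : r ∈ P.asIdeal ^ EffCycle.lengthAt J P := by
    rw [← EffCycle.ofIdeal_apply (P := P) hmin]
    by_cases h0 : P ∈ (EffCycle.ofIdeal J).support
    · exact Ideal.le_of_dvd (Finset.dvd_prod_of_mem (fun P => P.asIdeal ^ EffCycle.ofIdeal J P) h0) hr
    · rw [Finsupp.notMem_support_iff.1 h0, pow_zero, Ideal.one_eq_top]
      trivial
  have h1 := IsLocalRing.maximalIdeal_pow_le_of_coheight_le _ _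
    (EffCycle.coe_lengthAt (P := P) hmin).ge
  have h2 := Ideal.mem_map_of_mem (algebraMap A (Localization.AtPrime P.asIdeal)) hlen
  rw [Ideal.map_pow, Localization.AtPrime.map_eq_maximalIdeal] at h2
  obtain ⟨s, hs, hsr⟩ := (IsLocalization.algebraMap_mem_map_algebraMap_iff
    P.asIdeal.primeCompl _ _ _).1 (h1 h2)
  exact hs (hrQ ((hcolon s r).2 hsr))

variable {K : Type*} [Field K] {σ τ : Type*} [Finite σ] [Finite τ]

/-- An ideal whose quotient ring is a finite torsion-free module over a polynomial ring has no
embedded primes. -/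
lemma FiniteOn.mem_minimalPrimes {w : τ → MvPolynomial σ K} {J : Ideal (MvPolynomial σ K)}
    (hw : FiniteOn w J) (htf : ∀ c x, c ≠ 0 → tupleHom w c * x ∈ J → x ∈ J)
    {Q : Ideal (MvPolynomial σ K)} [hQ : Q.IsPrime] {r : MvPolynomial σ K}
    (hr : ∀ x, x ∈ Q ↔ x * r ∈ J) : Q ∈ J.minimalPrimes := by
  have hJQ : J ≤ Q := fun x hx => (hr x).2 (J.mul_mem_right r hx)
  have hrJ : r ∉ J := fun h => hQ.ne_top ((Ideal.eq_top_iff_one _).2 ((hr 1).2 (by rwa [one_mul])))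
  -- A nonzero `c` with value in `Q` would be a zero divisor, as it kills `r`. So the parameters
  -- stay independent modulo every prime between `J` and `Q`, and these primes all have the same
  -- dimension.
  have hdim : ∀ P : Ideal (MvPolynomial σ K), J ≤ P → P ≤ Q →
      ringKrullDim (MvPolynomial σ K ⧸ P) = Nat.card τ := by
    intro P hJP hPQ
    rw [ringKrullDim_eq_of_isIntegral _ ((finiteOn_iff _ _).1 (hw.mono hJP)),
      MvPolynomial.ringKrullDim_of_isNoetherianRing, ringKrullDim_eq_zero_of_field, zero_add]
    rw [injective_iff_map_eq_zero]
    intro c hc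
    rw [RingHom.comp_apply, Ideal.Quotient.eq_zero_iff_mem] at hc
    by_contra hc0
    exact hrJ (htf c r hc0 ((hr _).1 (hPQ hc)))
  refine ⟨⟨hQ, hJQ⟩, fun P hP hPQ => ?_⟩
  by_contra hn
  have := hP.1
  exact lt_irrefl _ (lt_of_ringKrullDim_eq (lt_of_le_not_ge hPQ hn) (hdim P hP.2 hPQ)
    (hdim Q hJQ le_rfl))

end Unmixed

/-! ### Linear maps on products of affine spaces -/

section ProductOperator

variable {K : Type*} [Field K] {ι : Type*} [Fintype ι] {σ : ι → Type*} {α : Type*} {j : ∀ i, σ i → α}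

lemma sum_mapDomain_apply (hj : Function.Bijective fun p : Σ i, σ i => j p.1 p.2)
    (μ : ∀ i, σ i →₀ ℕ) (i : ι) (s : σ i) :
    (∑ k, Finsupp.mapDomain (j k) (μ k)) (j i s) = μ i s := by
  classical
  have hi : Function.Injective (j i) := fun a b h => by
    simpa using hj.1 (a₁ := ⟨i, a⟩) (a₂ := ⟨i, b⟩) h
  rw [Finsupp.finsetSum_apply, Finset.sum_eq_single i]
  · exact Finsupp.mapDomain_apply hi _ _
  · intro k _ hk
    refine Finsupp.mapDomain_of_notMem_range _ _ ?_
    rintro ⟨t, ht⟩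
    exact hk (congrArg Sigma.fst (hj.1 (a₁ := ⟨k, t⟩) (a₂ := ⟨i, s⟩) ht))
  · simp

lemma prod_rename_monomial (μ : ∀ i, σ i →₀ ℕ) :
    ∏ i, rename (j i) (monomial (μ i) (1 : K)) =
      monomial (∑ i, Finsupp.mapDomain (j i) (μ i)) 1 := by
  simp only [rename_monomial, monomial_sum_one]

variable [∀ i, Finite (σ i)]

lemma exists_eq_sum_mapDomain (hj : Function.Bijective fun p : Σ i, σ i => j p.1 p.2)
    (m : α →₀ ℕ) : ∃ μ : ∀ i, σ i →₀ ℕ, m = ∑ i, Finsupp.mapDomain (j i) (μ i) := by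
  refine ⟨fun i => Finsupp.equivFunOnFinite.symm fun s => m (j i s), ?_⟩
  ext a
  obtain ⟨⟨i, s⟩, rfl⟩ := hj.2 a
  rw [sum_mapDomain_apply hj]
  rfl

/-- Linear maps on a polynomial ring are determined by products of polynomials in disjoint sets of
variables. -/
lemma linearMap_eq_of_prod_rename (hj : Function.Bijective fun p : Σ i, σ i => j p.1 p.2)
    {M : Type*} [AddCommMonoid M] [Module K M] {F G : MvPolynomial α K →ₗ[K] M}
    (h : ∀ f : ∀ i, MvPolynomial (σ i) K,
      F (∏ i, rename (j i) (f i)) = G (∏ i, rename (j i) (f i))) : F = G := by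
  refine (basisMonomials α K).ext fun m => ?_
  obtain ⟨μ, rfl⟩ := exists_eq_sum_mapDomain hj m
  rw [coe_basisMonomials]
  change F (monomial _ 1) = G (monomial _ 1)
  rw [← prod_rename_monomial]
  exact h _

/-- The product of linear maps on polynomial rings in disjoint sets of variables. -/
lemma exists_prodOperator (hj : Function.Bijective fun p : Σ i, σ i => j p.1 p.2)
    {D : Type*} [CommRing D] [Algebra K D] (F : ∀ i, MvPolynomial (σ i) K →ₗ[K] D) :
    ∃ G : MvPolynomial α K →ₗ[K] D, ∀ f : ∀ i, MvPolynomial (σ i) K,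
      G (∏ i, rename (j i) (f i)) = ∏ i, F i (f i) := by
  let G : MvPolynomial α K →ₗ[K] D := (basisMonomials α K).constr K fun m =>
    ∏ i, F i (monomial (Finsupp.equivFunOnFinite.symm fun s => m (j i s)) 1)
  refine ⟨G, fun f => ?_⟩
  have h : G.compMultilinearMap ((MultilinearMap.mkPiAlgebra K ι (MvPolynomial α K)).compLinearMap
      fun i => (rename (j i)).toLinearMap) = (MultilinearMap.mkPiAlgebra K ι D).compLinearMap F := by
    refine Module.Basis.ext_multilinear (fun i => basisMonomials (σ i) K) fun μ => ?_
    simp only [coe_basisMonomials, LinearMap.compMultilinearMap_apply,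
      MultilinearMap.compLinearMap_apply, MultilinearMap.mkPiAlgebra_apply, AlgHom.toLinearMap_apply]
    rw [prod_rename_monomial]
    refine ((basisMonomials α K).constr_basis K _ _).trans ?_
    exact Finset.prod_congr rfl fun i _ => congrArg (fun ν => F i (monomial ν 1))
      (Finsupp.ext fun s => sum_mapDomain_apply hj μ i s)
  exact congrArg (fun H : MultilinearMap K _ D => H f) h

end ProductOperator

/-! ### Embedding a coordinate ring in a free module over its parameters -/

section Functionals

variable {K : Type*} [Field K] {σ τ : Type*}

/-- The coordinates of `s * x` in a free submodule of full rank are unique and linear over the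
parameter ring; they vanish only if `s * x`, and hence `x`, lies in `P`. -/
lemma SpansModulo.exists_functionals {P : PrimeSpectrum (MvPolynomial σ K)}
    {w : τ → MvPolynomial σ K} (hw : FiniteOn w P.asIdeal)
    (hw0 : ∀ c, tupleHom w c ∈ P.asIdeal → c = 0) :
    ∃ (N : ℕ) (F : Fin N → MvPolynomial σ K →ₗ[K] MvPolynomial τ K),
      (∀ k c x, F k (tupleHom w c * x) = c * F k x) ∧ ∀ x, (∀ k, F k x = 0) ↔ x ∈ P.asIdeal := by
  obtain ⟨b, u, hu⟩ := hw
  obtain ⟨t, s, hs, hind, hx⟩ := hu.exists_basis_mapDegree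
  generalize EffCycle.mapDegree (tupleHom w) P = N at t hind hx
  choose c hc using hx
  have huniq : ∀ x d, tupleHom w s * x - ∑ i, tupleHom w (d i) * t i ∈ P.asIdeal → c x = d := by
    intro x d hd
    have h1 := P.asIdeal.sub_mem hd (hc x)
    rw [sub_sub_sub_cancel_left, ← Finset.sum_sub_distrib] at h1
    simp only [← sub_mul, ← map_sub] at h1
    funext i
    exact sub_eq_zero.1 (hw0 _ (hind _ h1 i))
  have hadd : ∀ x y, c (x + y) = c x + c y := fun x y => huniq _ _ (by
    convert P.asIdeal.add_mem (hc x) (hc y) using 1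
    simp only [Pi.add_apply, map_add, add_mul, Finset.sum_add_distrib, mul_add]
    ring)
  have hmul : ∀ d x, c (tupleHom w d * x) = fun i => d * c x i := fun d x => huniq _ _ (by
    convert P.asIdeal.mul_mem_left (tupleHom w d) (hc x) using 1
    simp only [map_mul, mul_sub, Finset.mul_sum, mul_assoc]
    rw [mul_left_comm])
  refine ⟨N, fun k => ⟨⟨fun x => c x k, fun x y => by rw [hadd]; rfl⟩, fun a x => ?_⟩,
    fun k d x => ?_, fun x => ⟨fun h => ?_, fun h k => ?_⟩⟩
  · have h1 := congrFun (hmul (C a) x) k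
    rw [tupleHom_C, C_mul', C_mul'] at h1
    exact h1
  · exact congrFun (hmul d x) k
  · have h1 := hc x
    have h2 : ∀ k, c x k = 0 := h
    simp only [h2, map_zero, zero_mul, Finset.sum_const_zero, sub_zero] at h1
    exact (P.isPrime.mem_or_mem h1).resolve_left hs
  · exact congrFun (huniq x 0 (by simpa using P.asIdeal.mul_mem_left _ h)) k

/-- A generalised inverse exists because all subspaces split. -/
lemma LinearMap.exists_comp_comp_eq {V W : Type*} [AddCommGroup V] [Module K V] [AddCommGroup W]
    [Module K W] (F : V →ₗ[K] W) : ∃ G : W →ₗ[K] V, ∀ x, F (G (F x)) = F x := by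
  obtain ⟨g, hg⟩ := F.rangeRestrict.exists_rightInverse_of_surjective
    (LinearMap.range_eq_top.2 F.surjective_rangeRestrict)
  obtain ⟨G, hG⟩ := g.exists_extend
  refine ⟨G, fun x => ?_⟩
  have h1 : G (F x) = g (F.rangeRestrict x) := LinearMap.congr_fun hG (F.rangeRestrict x)
  rw [h1]
  exact congrArg Subtype.val (LinearMap.congr_fun hg (F.rangeRestrict x))

end Functionals

/-! ### Products of varieties have no embedded components -/

section ProductVariety

variable {K : Type*} [Field K] {ι : Type*} {σ : ι → Type*}
  {α : Type*} {j : ∀ i, σ i → α} {d : ι → ℕ}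

/-- The product of tuples of polynomials in disjoint sets of variables. -/
def prodTuple (j : ∀ i, σ i → α) (w : ∀ i, Fin (d i) → MvPolynomial (σ i) K) :
    (Σ i, Fin (d i)) → MvPolynomial α K := fun p => rename (j p.1) (w p.1 p.2)

lemma tupleHom_prodTuple_rename (w : ∀ i, Fin (d i) → MvPolynomial (σ i) K) (i : ι)
    (c : MvPolynomial (Fin (d i)) K) :
    tupleHom (prodTuple j w) (rename (Sigma.mk i) c) = rename (j i) (tupleHom (w i) c) := by
  rw [← tupleHom_rename, tupleHom_apply, aeval_rename, tupleHom_apply]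
  rfl

variable [∀ i, Finite (σ i)]

lemma finiteOn_prodTuple [Finite α] (hj : Function.Bijective fun p : Σ i, σ i => j p.1 p.2)
    {P : ∀ i, Ideal (MvPolynomial (σ i) K)} {w : ∀ i, Fin (d i) → MvPolynomial (σ i) K}
    (hw : ∀ i, FiniteOn (w i) (P i)) : FiniteOn (prodTuple j w)
      (⨆ i, (P i).map (rename (j i) : MvPolynomial (σ i) K →ₐ[K] MvPolynomial α K)) := by
  set J := ⨆ i, (P i).map (rename (j i) : MvPolynomial (σ i) K →ₐ[K] MvPolynomial α K) with hJ
  refine (finiteOn_X J).of_integral fun a => ?_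
  obtain ⟨⟨i, s⟩, rfl⟩ := hj.2 a
  obtain ⟨p, hp, hp0⟩ := (finiteOn_iff _ _).1 (hw i) (Ideal.Quotient.mk (P i) (X s))
  let ψ : MvPolynomial (σ i) K ⧸ P i →+* MvPolynomial α K ⧸ J := Ideal.quotientMap J
    (rename (j i) : MvPolynomial (σ i) K →ₐ[K] MvPolynomial α K).toRingHom
    (Ideal.map_le_iff_le_comap.1 (le_iSup (fun i => (P i).map
      (rename (j i) : MvPolynomial (σ i) K →ₐ[K] MvPolynomial α K)) i))
  refine ⟨p.map (rename (Sigma.mk (β := fun i => Fin (d i)) i) : MvPolynomial (Fin (d i)) K →ₐ[K]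
    MvPolynomial (Σ i, Fin (d i)) K).toRingHom, hp.map _, ?_⟩
  rw [Polynomial.eval₂_map]
  have h1 := congrArg ψ hp0
  rw [map_zero, Polynomial.hom_eval₂] at h1
  have h2 : ψ (Ideal.Quotient.mk (P i) (X s)) = Ideal.Quotient.mk J (X (j i s)) := by
    rw [← rename_X]
    rfl
  rw [h2] at h1
  have h3 : ((Ideal.Quotient.mk J).comp (tupleHom (prodTuple j w))).comp
      (rename (Sigma.mk (β := fun i => Fin (d i)) i) : MvPolynomial (Fin (d i)) K →ₐ[K]
        MvPolynomial (Σ i, Fin (d i)) K).toRingHom =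
      ψ.comp ((Ideal.Quotient.mk (P i)).comp (tupleHom (w i))) :=
    RingHom.ext fun c => congrArg (Ideal.Quotient.mk J) (tupleHom_prodTuple_rename w i c)
  rw [h3]
  exact h1

variable [Fintype ι]

/-- A product of varieties is torsion-free over a product of Noether normalisations. -/
lemma mem_of_prodTuple_mul_mem (hj : Function.Bijective fun p : Σ i, σ i => j p.1 p.2)
    {P : ∀ i, PrimeSpectrum (MvPolynomial (σ i) K)} {w : ∀ i, Fin (d i) → MvPolynomial (σ i) K}
    (hw : ∀ i, FiniteOn (w i) (P i).asIdeal)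
    (hw0 : ∀ i c, tupleHom (w i) c ∈ (P i).asIdeal → c = 0)
    {c : MvPolynomial (Σ i, Fin (d i)) K} {x : MvPolynomial α K} (hc : c ≠ 0)
    (hx : tupleHom (prodTuple j w) c * x ∈
      ⨆ i, (P i).asIdeal.map (rename (j i) : MvPolynomial (σ i) K →ₐ[K] MvPolynomial α K)) :
    x ∈ ⨆ i, (P i).asIdeal.map (rename (j i) : MvPolynomial (σ i) K →ₐ[K] MvPolynomial α K) := by
  classical
  set J := ⨆ i, (P i).asIdeal.map
    (rename (j i) : MvPolynomial (σ i) K →ₐ[K] MvPolynomial α K) with hJ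
  have hPJ : ∀ i, ∀ p ∈ (P i).asIdeal, rename (j i) p ∈ J := fun i p hp =>
    le_iSup (fun i => (P i).asIdeal.map
      (rename (j i) : MvPolynomial (σ i) K →ₐ[K] MvPolynomial α K)) i (Ideal.mem_map_of_mem _ hp)
  have hj' : Function.Bijective fun p : Σ i, Fin (d i) => (Sigma.mk p.1 p.2 : Σ i, Fin (d i)) :=
    Function.bijective_id
  -- The embeddings of the factors into free modules are multiplied to operators `Λ s`, linear over
  -- the product parameter ring and zero on `J`. Products `R s` of generalised inverses satisfy `∑ R
  -- s ∘ Λ s ≡ id` modulo `J`. Thus `J` is the common kernel of the `Λ s`, and torsion-freeness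
  -- follows as they take values in a domain.
  choose N F hF hF0 using fun i => SpansModulo.exists_functionals (hw i) (hw0 i)
  choose G hG using fun i => LinearMap.exists_comp_comp_eq (LinearMap.pi (F i))
  choose Λ hΛ using fun s : ∀ i, Fin (N i) => exists_prodOperator hj
    fun i => (rename (Sigma.mk (β := fun i => Fin (d i)) i)).toLinearMap ∘ₗ F i (s i)
  choose R hR using fun s : ∀ i, Fin (N i) => exists_prodOperator hj'
    fun i => (rename (j i)).toLinearMap ∘ₗ G i ∘ₗ LinearMap.single K (fun _ => MvPolynomial (Fin (d i)) K) (s i)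
  have hGF : ∀ i f, f - ∑ k, G i (Pi.single k (F i k f)) ∈ (P i).asIdeal := fun i f => by
    rw [← hF0]
    intro k
    have h1 : ∑ k, G i (Pi.single k (F i k f)) = G i (LinearMap.pi (F i) f) := by
      rw [← map_sum]
      congr 1
      exact Finset.univ_sum_single _
    rw [map_sub, h1, sub_eq_zero]
    exact (congrFun (hG i f) k).symm
  have hΛmul : ∀ s c x, Λ s (tupleHom (prodTuple j w) c * x) = c * Λ s x := by
    intro s c x
    let A : MvPolynomial (Σ i, Fin (d i)) K →ₗ[K] MvPolynomial α K :=
      (aeval (prodTuple j w)).toLinearMap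
    have h1 : Λ s ∘ₗ LinearMap.mulRight K x ∘ₗ A = LinearMap.mulRight K (Λ s x) := by
      refine linearMap_eq_of_prod_rename hj' fun c => ?_
      set c' := ∏ i, rename (Sigma.mk i) (c i) with hc'
      have h2 : Λ s ∘ₗ LinearMap.mulLeft K (tupleHom (prodTuple j w) c') =
          LinearMap.mulLeft K c' ∘ₗ Λ s := by
        refine linearMap_eq_of_prod_rename hj fun f => ?_
        rw [LinearMap.comp_apply, LinearMap.comp_apply, LinearMap.mulLeft_apply,
          LinearMap.mulLeft_apply, hc', map_prod, ← Finset.prod_mul_distrib, hΛ,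
          ← Finset.prod_mul_distrib]
        simp only [tupleHom_prodTuple_rename, ← map_mul]
        rw [hΛ]
        refine Finset.prod_congr rfl fun i _ => ?_
        rw [LinearMap.comp_apply, LinearMap.comp_apply, hF, AlgHom.toLinearMap_apply,
          AlgHom.toLinearMap_apply, map_mul]
      exact LinearMap.congr_fun h2 x
    exact LinearMap.congr_fun h1 c
  have hΛJ : ∀ s, ∀ x ∈ J, Λ s x = 0 := by
    intro s x hx
    -- The largest ideal on which `Λ s` vanishes; it suffices to test it on generators of `J`.
    let I : Ideal (MvPolynomial α K) :=
      { carrier := {x | ∀ t, Λ s (t * x) = 0}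
        zero_mem' := fun t => by rw [mul_zero, map_zero]
        add_mem' := fun {a b} ha hb t => by rw [mul_add, map_add, ha, hb, add_zero]
        smul_mem' := fun a b hb t => by rw [smul_eq_mul, ← mul_assoc, hb] }
    have hJI : J ≤ I := by
      refine iSup_le fun i => Ideal.map_le_iff_le_comap.2 fun p hp => ?_
      have h1 : Λ s ∘ₗ LinearMap.mulRight K (rename (j i) p) = 0 := by
        refine linearMap_eq_of_prod_rename hj fun f => ?_
        have h2 : (∏ k, rename (j k) (f k)) * rename (j i) p =
            ∏ k, rename (j k) (Function.update f i (f i * p) k) := by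
          rw [← Finset.mul_prod_erase _ _ (Finset.mem_univ i),
            ← Finset.mul_prod_erase _ (fun k => rename (j k) (Function.update f i (f i * p) k))
              (Finset.mem_univ i), Function.update_self, map_mul, mul_right_comm]
          congr 1
          refine Finset.prod_congr rfl fun k hk => ?_
          rw [Function.update_of_ne (Finset.ne_of_mem_erase hk)]
        rw [LinearMap.comp_apply, LinearMap.mulRight_apply, h2, hΛ, LinearMap.zero_apply]
        refine Finset.prod_eq_zero (Finset.mem_univ i) ?_
        rw [LinearMap.comp_apply, Function.update_self,
          (hF0 i _).2 ((P i).asIdeal.mul_mem_left _ hp), map_zero]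
      exact fun t => LinearMap.congr_fun h1 t
    have h1 := hJI hx 1
    rwa [one_mul] at h1
  have hRΛ : ∀ x, x - ∑ s, R s (Λ s x) ∈ J := by
    intro x
    have h1 : (Ideal.Quotient.mkₐ K J).toLinearMap =
        (Ideal.Quotient.mkₐ K J).toLinearMap ∘ₗ ∑ s, R s ∘ₗ Λ s := by
      refine linearMap_eq_of_prod_rename hj fun f => ?_
      have h2 : (∑ s, R s ∘ₗ Λ s) (∏ i, rename (j i) (f i)) =
          ∏ i, rename (j i) (∑ k, G i (Pi.single k (F i k (f i)))) := by
        simp only [map_sum]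
        rw [Finset.prod_univ_sum, LinearMap.sum_apply, Fintype.piFinset_univ]
        refine Finset.sum_congr rfl fun s _ => ?_
        rw [LinearMap.comp_apply, hΛ]
        exact hR s _
      rw [LinearMap.comp_apply, h2, AlgHom.toLinearMap_apply, AlgHom.toLinearMap_apply, map_prod,
        map_prod]
      refine Finset.prod_congr rfl fun i _ => ?_
      rw [Ideal.Quotient.mkₐ_eq_mk, Ideal.Quotient.eq, ← map_sub]
      exact hPJ i _ (hGF i _)
    have h2 := LinearMap.congr_fun h1 x
    rw [LinearMap.comp_apply, AlgHom.toLinearMap_apply, AlgHom.toLinearMap_apply,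
      Ideal.Quotient.mkₐ_eq_mk, Ideal.Quotient.eq, LinearMap.sum_apply] at h2
    exact h2
  have h0 : ∀ s, Λ s x = 0 := fun s => by
    have := hΛJ s _ hx
    rw [hΛmul] at this
    exact (mul_eq_zero.1 this).resolve_left hc
  simpa [h0] using hRΛ x

/-- The ideal of the cycle of a product of varieties is contained in the ideal of the product. -/
lemma EffCycle.ofIdeal_iSup_map_rename_ideal_le [Finite α]
    (hj : Function.Bijective fun p : Σ i, σ i => j p.1 p.2)
    (P : ∀ i, PrimeSpectrum (MvPolynomial (σ i) K)) :
    (EffCycle.ofIdeal (⨆ i, (P i).asIdeal.map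
      (rename (j i) : MvPolynomial (σ i) K →ₐ[K] MvPolynomial α K))).ideal ≤
      ⨆ i, (P i).asIdeal.map (rename (j i) : MvPolynomial (σ i) K →ₐ[K] MvPolynomial α K) := by
  choose d _ w hw hw0 using fun i => exists_ringKrullDim_eq (P i).asIdeal
  exact EffCycle.ofIdeal_ideal_le fun Q r hQ hr =>
    (finiteOn_prodTuple hj hw).mem_minimalPrimes
      (fun c x hc hx => mem_of_prodTuple_mul_mem hj hw hw0 hc hx) hr

end ProductVariety

/-! ### The ideal of the product cycle -/

section ProductCycle

/-- Induction on the number of factors, splitting off the first: `∏ (I + N) ^ a ⊆ ∏ I ^ a + N` is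
applied once to the other factors with `N = I 0 p`, then to the first factor with `N` the sum
already obtained. -/
lemma Ideal.prod_piFinset_iSup_pow_le {A X : Type*} [CommRing A] {m : ℕ} :
    ∀ (S : Fin m → Finset X) (I : Fin m → X → Ideal A) (a : Fin m → X → ℕ),
      ∏ P ∈ Fintype.piFinset S, (⨆ i, I i (P i)) ^ ∏ i, a i (P i) ≤
        ⨆ i, ∏ p ∈ S i, I i p ^ a i p := by
  induction m with
  | zero => intro S I a; simp
  | succ m ih =>
    intro S I a
    have h1 : ∏ P ∈ Fintype.piFinset S, (⨆ i, I i (P i)) ^ ∏ i, a i (P i) =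
        ∏ p ∈ S 0, (∏ P ∈ Fintype.piFinset fun i : Fin m => S i.succ,
          ((⨆ i : Fin m, I i.succ (P i)) ⊔ I 0 p) ^ ∏ i : Fin m, a i.succ (P i)) ^ a 0 p := by
      simp only [← Finset.prod_pow, ← pow_mul]
      rw [← Finset.prod_product']
      refine Finset.prod_bij' (fun P _ => (P 0, fun i : Fin m => P i.succ))
        (fun q _ => (Fin.cons q.1 q.2 : Fin (m + 1) → X)) ?_ ?_ ?_ ?_ ?_
      · intro P hP
        rw [Fintype.mem_piFinset] at hP
        exact Finset.mem_product.2 ⟨hP 0, Fintype.mem_piFinset.2 fun i => hP i.succ⟩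
      · rintro ⟨p, P⟩ hP
        obtain ⟨h1, h2⟩ := Finset.mem_product.1 hP
        rw [Fintype.mem_piFinset] at h2 ⊢
        exact Fin.cases h1 h2
      · exact fun P _ => Fin.cons_self_tail P
      · intro q _
        simp
      · intro P _
        rw [Fin.prod_univ_succ, mul_comm (a 0 _)]
        congr 1
        refine le_antisymm (iSup_le (Fin.cases le_sup_right fun i => ?_))
          (sup_le (iSup_le fun i : Fin m => ?_) ?_)
        · exact le_iSup (fun i => I i (P i)) i.succ
        · exact le_iSup (fun i => I i (P i)) 0
        · exact le_sup_of_le_left (le_iSup (fun i : Fin m => I i.succ (P i.succ)) i)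
    rw [h1]
    refine le_trans (Ideal.prod_le_prod_of_le fun p _ => Ideal.pow_right_mono
      ((Ideal.prod_sup_pow_le _ _ _ _).trans (sup_le_sup_right (ih _ _ _) _)) _) ?_
    simp only [sup_comm _ (I 0 _)]
    refine (Ideal.prod_sup_pow_le _ _ _ _).trans (sup_le ?_ (iSup_le fun i => ?_))
    · exact le_iSup (fun i => ∏ p ∈ S i, I i p ^ a i p) 0
    · exact le_iSup (fun i => ∏ p ∈ S i, I i p ^ a i p) i.succ

variable {K : Type*} [Field K] {n m : ℕ}

/-- Each component product contributes at most the sum of the ideals of its factors, to the product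
of their multiplicities, and restriction to the diagonal identifies the coordinates of all factors.
-/
lemma EffCycle.map_prodCycle_ideal_le (Z : Fin m → EffCycle (MvPolynomial (Fin n) K)) :
    (EffCycle.prodCycle Z).ideal.map
      (rename Prod.snd : MvPolynomial (Fin m × Fin n) K →ₐ[K] MvPolynomial (Fin n) K) ≤
        ⨆ i, (Z i).ideal := by
  refine le_trans ?_ (Ideal.prod_piFinset_iSup_pow_le (fun i => (Z i).support)
    (fun _ P => P.asIdeal) fun i P => Z i P)
  have hmul : ∀ (a : ℕ) (W : EffCycle (MvPolynomial (Fin m × Fin n) K)),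
      (a • W).ideal = W.ideal ^ a := fun a W => by
    induction a with
    | zero => rw [zero_smul, pow_zero, EffCycle.ideal, Finsupp.prod_zero_index]
    | succ a ih =>
      rw [succ_nsmul, pow_succ, ← ih]
      exact Finsupp.prod_add_index' (fun _ => pow_zero _) fun _ _ _ => pow_add _ _ _
  rw [EffCycle.prodCycle, EffCycle.ideal, ← Finsupp.prod_finsetSum_index (fun _ => pow_zero _)
    (fun _ _ _ => pow_add _ _ _)]
  change Ideal.mapHom (rename Prod.snd : MvPolynomial (Fin m × Fin n) K →ₐ[K] _) _ ≤ _
  rw [map_prod]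
  refine Ideal.prod_le_prod_of_le fun P _ => ?_
  refine le_trans (le_of_eq (congrArg _ (hmul _ _))) ?_
  rw [map_pow]
  refine Ideal.pow_right_mono ?_ _
  refine (Ideal.map_mono (EffCycle.ofIdeal_iSup_map_rename_ideal_le (σ := fun _ : Fin m => Fin n)
    (j := fun i => Prod.mk i) (Equiv.sigmaEquivProd (Fin m) (Fin n)).bijective P)).trans ?_
  rw [Ideal.map_iSup]
  refine iSup_mono fun i => ?_
  rw [Ideal.map_le_iff_le_comap, Ideal.map_le_iff_le_comap]
  intro p hp
  rw [Ideal.mem_comap, Ideal.mem_comap, rename_rename]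
  change rename id p ∈ _
  rwa [rename_id_apply]

end ProductCycle

end

theorem mainTheorem4 {K : Type*} [Field K] {n m : ℕ}
    (Z : Fin m → EffCycle (MvPolynomial (Fin n) K))
    (ℓ : Fin (n * (m - 1)) → MvPolynomial (Fin m × Fin n) K)
    (hℓ : EffCycle.IsDiagonalSystem ℓ) (r : Fin m) :
    ∀ f ∈ EffCycle.chowIdeal (EffCycle.vtCycle Z ℓ r),
      (⨆ i, (Z i).ideal).IsIntegralElem f := fun _ hf =>
  EffCycle.isIntegralElem_of_mem_chowIdeal_vtCycle hℓ r (EffCycle.map_prodCycle_ideal_le Z) hf
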